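/- Let $k$ be an algebraically closed field of characteristic zero. For $f\in k[z]$ let $A(f)$ be the $k$-algebra generated by $x,y,z$ with relations $$xz=(z+1)x,\qquad yz=(z-1)y,\qquad xy=f(z),\qquad yx=f(z-1),$$ graded by $\mathbb Z$ with $\deg x=1$, $\deg y=-1$, $\deg z=0$. For an abelian group $\Gamma$ and a $\Gamma$-graded $k$-algebra $R$ let $\operatorname{gr}(R,\Gamma)$ be the $k$-linear category of finitely generated $\Gamma$-graded right $R$-modules with degree-preserving homomorphisms, and write $\operatorname{gr}A(f)=\operatorname{gr}(A(f),\mathbb Z)$. Let $\operatorname{qgr}A(f)=\operatorname{gr}A(f)/\operatorname{fdim}A(f)$ be the quotient category by the Serre subcategory of modules that are finite-dimensional over $k$, that is, the localization of $\operatorname{gr} A(f)$ at the morphisms with finite-dimensional kernel and cokernel, with its canonical $k$-linear structure. Let $\mathbb Z_{\mathrm{fin}}$ be the group of finite subsets of $\mathbb Z$ under symmetric difference $\oplus$, and let $$B=\frac{k[z][b_n\mid n\in\mathbb Z]}{\left(b_n^2=(z+n)^2\mid n\in\mathbb Z\right)},\qquad \deg z=\emptyset,\quad \deg b_n=\{n\},$$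 a $\mathbb Z_{\mathrm{fin}}$-graded commutative $k$-algebra. 1. $B$ is the ring attached to the multiple root case $A=A(z^2)$: put $M\langle n\rangle_i=M_{i-n}$; for $j\in\mathbb Z$ let $\iota_jA\subseteq A$ be the kernel of the surjection $A\to(A/xA)\langle j\rangle$, $a\mapsto y^ja$, if $j\ge 0$, and of the surjection $A\to(A/yA)\langle j+1\rangle$, $a\mapsto x^{-j-1}a$, if $j<0$; for $J\in\mathbb Z_{\mathrm{fin}}$ let $\iota_JA=\bigcap_{j\in J}\iota_jA$ and $h_J=\prod_{j\in J}(z+j)^2$. Then there are $k$-linear isomorphisms $\Phi_J:B_J\to\operatorname{Hom}_{\operatorname{gr}A}(A,\iota_JA)$ for all $J\in\mathbb Z_{\mathrm{fin}}$ such that $\Phi_\emptyset(1)=\mathrm{id}_A$ and, for $a\in B_I$, $b\in B_J$, $t\in A$, $$h_{I\cap J}\,\Phi_{I\oplus J}(ab)(t)=\Phi_I(a)\bigl(\Phi_J(b)(t)\bigr).$$ 2. For every positive integer $m$ there is a $k$-linear equivalence of categories $$\operatorname{qgr}A\bigl(z(z+m)\bigr)\;\equiv\;\operatorname{gr}(B,\mathbb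 Z_{\mathrm{fin}}).$$ -/

import Mathlib

set_option linter.unusedSectionVars false

open CategoryTheory DirectSum Polynomial

universe u w

/-! ### Finitely generated graded right modules -/

/-- A finitely generated `Γ`-graded right `R`-module over the `Γ`-graded `k`-algebra
`R = ⨁ 𝒜 γ`. Right `R`-modules are modules over `Rᵐᵒᵖ`. -/
structure GrMod {k : Type u} [Field k] {Γ : Type w} [AddCommGroup Γ] [DecidableEq Γ]
    {R : Type u} [Ring R] [Algebra k R] (𝒜 : Γ → Submodule k R) [GradedAlgebra 𝒜] where
  carrier : Type u
  [addCommGroup : AddCommGroup carrier]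
  [moduleBase : Module k carrier]
  [module : Module Rᵐᵒᵖ carrier]
  [isScalarTower : IsScalarTower k Rᵐᵒᵖ carrier]
  /-- the homogeneous components -/
  deg : Γ → Submodule k carrier
  isInternal : DirectSum.IsInternal deg
  smul_mem : ∀ {γ δ : Γ} {m : carrier} {a : R},
    m ∈ deg γ → a ∈ 𝒜 δ → MulOpposite.op a • m ∈ deg (γ + δ)
  finite : Module.Finite Rᵐᵒᵖ carrier

namespace GrMod

attribute [instance] GrMod.addCommGroup GrMod.moduleBase GrMod.module GrMod.isScalarTower
  GrMod.finite

variable {k : Type u} [Field k] {Γ : Type w} [AddCommGroup Γ] [DecidableEq Γ]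
  {R : Type u} [Ring R] [Algebra k R] {𝒜 : Γ → Submodule k R} [GradedAlgebra 𝒜]

/-- Graded right `R`-module homomorphisms (of degree zero). -/
@[ext]
structure Hom (M N : GrMod 𝒜) where
  hom : M.carrier →ₗ[Rᵐᵒᵖ] N.carrier
  map_mem : ∀ {γ : Γ} {m : M.carrier}, m ∈ M.deg γ → hom m ∈ N.deg γ

instance : Category (GrMod 𝒜) where
  Hom M N := Hom M N
  id M := ⟨LinearMap.id, fun h => h⟩
  comp f g := ⟨g.hom.comp f.hom, fun h => g.map_mem (f.map_mem h)⟩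

@[ext]
theorem hom_ext {M N : GrMod 𝒜} {f g : M ⟶ N} (h : ∀ m, f.hom m = g.hom m) : f = g :=
  Hom.ext (LinearMap.ext h)

@[simp] theorem id_hom (M : GrMod 𝒜) : Hom.hom (𝟙 M) = LinearMap.id := rfl

@[simp] theorem comp_hom {M N P : GrMod 𝒜} (f : M ⟶ N) (g : N ⟶ P) :
    (f ≫ g).hom = g.hom.comp f.hom := rfl

/-- Morphisms `M ⟶ N` as a `k`-subspace of the space of all right `R`-linear maps. -/
def homSubmodule (M N : GrMod 𝒜) : Submodule k (M.carrier →ₗ[Rᵐᵒᵖ] N.carrier) where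
  carrier := {f | ∀ (γ : Γ) (m : M.carrier), m ∈ M.deg γ → f m ∈ N.deg γ}
  add_mem' hf hg γ m hm := (N.deg γ).add_mem (hf γ m hm) (hg γ m hm)
  zero_mem' γ _ _ := (N.deg γ).zero_mem
  smul_mem' c _ hf γ m hm := (N.deg γ).smul_mem c (hf γ m hm)

/-- Morphisms `M ⟶ N` are the elements of `homSubmodule M N`. -/
def homEquiv (M N : GrMod 𝒜) : (M ⟶ N) ≃ homSubmodule M N where
  toFun f := ⟨f.hom, fun _ _ h => f.map_mem h⟩
  invFun f := ⟨f.1, fun h => f.2 _ _ h⟩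

instance (M N : GrMod 𝒜) : AddCommGroup (M ⟶ N) := (homEquiv M N).addCommGroup

instance (M N : GrMod 𝒜) : Module k (M ⟶ N) := (homEquiv M N).module k

@[simp] theorem add_hom {M N : GrMod 𝒜} (f g : M ⟶ N) : (f + g).hom = f.hom + g.hom := rfl

@[simp] theorem smul_hom {M N : GrMod 𝒜} (c : k) (f : M ⟶ N) : (c • f).hom = c • f.hom := rfl

@[simp] theorem sub_hom {M N : GrMod 𝒜} (f g : M ⟶ N) : (f - g).hom = f.hom - g.hom := rfl

@[simp] theorem neg_hom {M N : GrMod 𝒜} (f : M ⟶ N) : (-f).hom = -f.hom := rfl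

instance : Preadditive (GrMod 𝒜) where
  add_comp P Q S f f' g := by ext m; simp
  comp_add P Q S f g g' := by ext m; simp

instance : Linear k (GrMod 𝒜) where
  smul_comp P Q S c f g := by
    ext m
    exact (g.hom.restrictScalars k).map_smul c (f.hom m)
  comp_smul P Q S f c g := by ext m; simp

/-! ### Direct sums of two modules and quotients -/

theorem isInternal_of_proj {V : Type*} [AddCommGroup V] [Module k V] (D : Γ → Submodule k V)
    (p : Γ → V →ₗ[k] V) (hp : ∀ γ, ∀ v ∈ D γ, p γ v = v)
    (hp' : ∀ γ δ, γ ≠ δ → ∀ v ∈ D γ, p δ v = 0) (hD : iSup D = ⊤) :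
    DirectSum.IsInternal D := by
  rw [isInternal_submodule_iff_iSupIndep_and_iSup_eq_top]
  refine ⟨fun γ => ?_, hD⟩
  rw [Submodule.disjoint_def]
  intro v hv hv'
  have hle : (⨆ (δ) (_ : δ ≠ γ), D δ) ≤ LinearMap.ker (p γ) :=
    iSup₂_le fun δ hδ x hx => hp' δ γ hδ x hx
  rw [← hp γ v hv]
  exact hle hv'

theorem isInternal_map {V T : Type*} [AddCommGroup V] [Module k V] [AddCommGroup T] [Module k T]
    (D : Γ → Submodule k V) (p : Γ → V →ₗ[k] V) (hp : ∀ γ, ∀ v ∈ D γ, p γ v = v)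
    (hp' : ∀ γ δ, γ ≠ δ → ∀ v ∈ D γ, p δ v = 0) (hD : iSup D = ⊤)
    (π : V →ₗ[k] T) (hπ : Function.Surjective π) (hker : ∀ γ v, π v = 0 → π (p γ v) = 0) :
    DirectSum.IsInternal fun γ => (D γ).map π := by
  obtain ⟨s, hs⟩ := π.exists_rightInverse_of_surjective (LinearMap.range_eq_top.2 hπ)
  have key : ∀ γ v, π (p γ (s (π v))) = π (p γ v) := by
    intro γ v
    rw [← sub_eq_zero, ← map_sub, ← map_sub]
    refine hker γ _ ?_
    rw [map_sub, sub_eq_zero]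
    exact LinearMap.congr_fun hs (π v)
  refine isInternal_of_proj _ (fun γ => π ∘ₗ p γ ∘ₗ s) ?_ ?_ ?_
  · rintro γ _ ⟨v, hv, rfl⟩
    exact (key γ v).trans (congrArg π (hp γ v hv))
  · rintro γ δ h _ ⟨v, hv, rfl⟩
    refine (key δ v).trans ?_
    rw [hp' γ δ h v hv, map_zero]
  · rw [← Submodule.map_iSup, hD, Submodule.map_top, LinearMap.range_eq_top]
    exact hπ

theorem exists_proj (M : GrMod 𝒜) : ∃ p : Γ → M.carrier →ₗ[k] M.carrier,
    (∀ γ v, p γ v ∈ M.deg γ) ∧ (∀ γ, ∀ v ∈ M.deg γ, p γ v = v) ∧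
    (∀ γ δ, γ ≠ δ → ∀ v ∈ M.deg γ, p δ v = 0) := by
  let := M.isInternal.chooseDecomposition
  refine ⟨fun γ => (M.deg γ).subtype ∘ₗ DirectSum.component k Γ (fun i => M.deg i) γ ∘ₗ
    (decomposeLinearEquiv M.deg).toLinearMap, fun γ v => Submodule.coe_mem _, ?_, ?_⟩
  · intro γ v hv
    exact decompose_of_mem_same M.deg hv
  · intro γ δ h v hv
    exact decompose_of_mem_ne M.deg hv h

theorem iSup_deg (M : GrMod 𝒜) : iSup M.deg = ⊤ :=
  ((isInternal_submodule_iff_iSupIndep_and_iSup_eq_top _).1 M.isInternal).2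

/-- The direct sum of two graded modules. -/
def prod (M N : GrMod 𝒜) : GrMod 𝒜 where
  carrier := M.carrier × N.carrier
  deg γ := (M.deg γ).prod (N.deg γ)
  isInternal := by
    obtain ⟨p, -, hp, hp'⟩ := M.exists_proj
    obtain ⟨q, -, hq, hq'⟩ := N.exists_proj
    refine isInternal_of_proj _ (fun γ => (p γ).prodMap (q γ)) ?_ ?_ ?_
    · rintro γ ⟨a, b⟩ ⟨ha, hb⟩
      simp [hp γ a ha, hq γ b hb]
    · rintro γ δ h ⟨a, b⟩ ⟨ha, hb⟩
      simp [hp' γ δ h a ha, hq' γ δ h b hb]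
    · have h1 : LinearMap.range (LinearMap.inl k M.carrier N.carrier) ≤
          ⨆ γ, (M.deg γ).prod (N.deg γ) := by
        rw [← Submodule.map_top, ← M.iSup_deg, Submodule.map_iSup]
        refine iSup_mono fun γ => ?_
        rintro _ ⟨m, hm, rfl⟩
        exact ⟨hm, (N.deg γ).zero_mem⟩
      have h2 : LinearMap.range (LinearMap.inr k M.carrier N.carrier) ≤
          ⨆ γ, (M.deg γ).prod (N.deg γ) := by
        rw [← Submodule.map_top, ← N.iSup_deg, Submodule.map_iSup]
        refine iSup_mono fun γ => ?_
        rintro _ ⟨n, hn, rfl⟩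
        exact ⟨(M.deg γ).zero_mem, hn⟩
      rw [eq_top_iff, ← LinearMap.sup_range_inl_inr]
      exact sup_le h1 h2
  smul_mem hm ha := ⟨M.smul_mem hm.1 ha, N.smul_mem hm.2 ha⟩
  finite := inferInstance

theorem exists_proj_commute {M N : GrMod 𝒜} (f : M ⟶ N) :
    ∃ (p : Γ → M.carrier →ₗ[k] M.carrier) (q : Γ → N.carrier →ₗ[k] N.carrier),
      (∀ γ, ∀ v ∈ N.deg γ, q γ v = v) ∧ (∀ γ δ, γ ≠ δ → ∀ v ∈ N.deg γ, q δ v = 0) ∧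
      ∀ γ m, q γ (f.hom m) = f.hom (p γ m) := by
  obtain ⟨p, -, hp, hp'⟩ := M.exists_proj
  obtain ⟨q, -, hq, hq'⟩ := N.exists_proj
  refine ⟨p, q, hq, hq', fun γ m => ?_⟩
  have : (⊤ : Submodule k M.carrier) ≤
      LinearMap.eqLocus (q γ ∘ₗ f.hom.restrictScalars k) (f.hom.restrictScalars k ∘ₗ p γ) := by
    rw [← M.iSup_deg]
    refine iSup_le fun δ x hx => ?_
    change q γ (f.hom x) = f.hom (p γ x)
    by_cases h : δ = γ
    · subst h
      rw [hp _ x hx, hq _ _ (f.map_mem hx)]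
    · rw [hp' _ _ h x hx, hq' _ _ h _ (f.map_mem hx), map_zero]
  exact this (Submodule.mem_top (x := m))

/-- The quotient map onto the cokernel, as a `k`-linear map. -/
def cokerLin {M N : GrMod 𝒜} (f : M ⟶ N) :
    N.carrier →ₗ[k] (N.carrier ⧸ LinearMap.range f.hom) :=
  (LinearMap.range f.hom).mkQ.restrictScalars k

theorem cokerLin_surjective {M N : GrMod 𝒜} (f : M ⟶ N) : Function.Surjective (cokerLin f) :=
  Submodule.mkQ_surjective (LinearMap.range f.hom)

theorem cokerLin_eq_zero {M N : GrMod 𝒜} (f : M ⟶ N) (n : N.carrier) :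
    cokerLin f n = 0 ↔ ∃ m, f.hom m = n :=
  Submodule.Quotient.mk_eq_zero (LinearMap.range f.hom)

theorem coker_isInternal {M N : GrMod 𝒜} (f : M ⟶ N) :
    DirectSum.IsInternal fun γ => (N.deg γ).map (cokerLin f) := by
  obtain ⟨p, q, hq, hq', hcomm⟩ := exists_proj_commute f
  refine isInternal_map N.deg q hq hq' N.iSup_deg (cokerLin f) (cokerLin_surjective f) ?_
  intro γ n hn
  obtain ⟨m, rfl⟩ := (cokerLin_eq_zero f n).1 hn
  exact (cokerLin_eq_zero f _).2 ⟨p γ m, (hcomm γ m).symm⟩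

/-- The quotient of a graded module by the image of a morphism. -/
def coker {M N : GrMod 𝒜} (f : M ⟶ N) : GrMod 𝒜 where
  carrier := N.carrier ⧸ LinearMap.range f.hom
  deg γ := (N.deg γ).map (cokerLin f)
  isInternal := coker_isInternal f
  smul_mem := by
    rintro γ δ _ a ⟨n, hn, rfl⟩ ha
    exact ⟨MulOpposite.op a • n, N.smul_mem hn ha, rfl⟩
  finite := inferInstance

/-- The projection onto the quotient by the image of a morphism. -/
def cokerMk {M N : GrMod 𝒜} (f : M ⟶ N) : N ⟶ coker f :=
  Hom.mk (LinearMap.range f.hom).mkQ fun hm => ⟨_, hm, rfl⟩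

def inl (M N : GrMod 𝒜) : M ⟶ prod M N :=
  Hom.mk (LinearMap.inl Rᵐᵒᵖ M.carrier N.carrier) fun hm => ⟨hm, (N.deg _).zero_mem⟩

def inr (M N : GrMod 𝒜) : N ⟶ prod M N :=
  Hom.mk (LinearMap.inr Rᵐᵒᵖ M.carrier N.carrier) fun hm => ⟨(M.deg _).zero_mem, hm⟩

/-! ### The quotient by the finite-dimensional modules -/

/-- The morphisms whose kernel and cokernel are finite-dimensional over `k`. -/
def isoModFdim (𝒜 : Γ → Submodule k R) [GradedAlgebra 𝒜] : MorphismProperty (GrMod 𝒜) :=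
  fun _ N f => FiniteDimensional k (LinearMap.ker (f.hom.restrictScalars k)) ∧
    FiniteDimensional k (N.carrier ⧸ LinearMap.range (f.hom.restrictScalars k))

theorem isoModFdim_id (M : GrMod 𝒜) : isoModFdim 𝒜 (𝟙 M) := by
  have h1 : LinearMap.ker ((LinearMap.id : M.carrier →ₗ[Rᵐᵒᵖ] M.carrier).restrictScalars k) = ⊥ :=
    LinearMap.ker_id
  have h2 : LinearMap.range ((LinearMap.id : M.carrier →ₗ[Rᵐᵒᵖ] M.carrier).restrictScalars k) = ⊤ :=
    LinearMap.range_id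
  refine ⟨?_, ?_⟩
  · rw [id_hom, h1]; infer_instance
  · rw [id_hom, h2]; infer_instance

theorem fd_of_ker_le {U V T : Type*} [AddCommGroup U] [AddCommGroup V] [AddCommGroup T]
    [Module k U] [Module k V] [Module k T] (i : U →ₗ[k] V) (p : V →ₗ[k] T)
    [FiniteDimensional k U] [FiniteDimensional k T]
    (h : LinearMap.ker p ≤ LinearMap.range i) : FiniteDimensional k V := by
  have := Submodule.finiteDimensional_of_le h
  exact Module.Finite.of_exact (f := (LinearMap.ker p).subtype) (g := p.rangeRestrict)
    (fun x => by simp [Subtype.ext_iff]) p.surjective_rangeRestrict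

theorem fd_comp {U V T : Type*} [AddCommGroup U] [AddCommGroup V] [AddCommGroup T]
    [Module k U] [Module k V] [Module k T] (f : U →ₗ[k] V) (g : V →ₗ[k] T)
    (hf : FiniteDimensional k (LinearMap.ker f) ∧ FiniteDimensional k (V ⧸ LinearMap.range f))
    (hg : FiniteDimensional k (LinearMap.ker g) ∧ FiniteDimensional k (T ⧸ LinearMap.range g)) :
    FiniteDimensional k (LinearMap.ker (g ∘ₗ f)) ∧
      FiniteDimensional k (T ⧸ LinearMap.range (g ∘ₗ f)) := by
  obtain ⟨hf1, hf2⟩ := hf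
  obtain ⟨hg1, hg2⟩ := hg
  constructor
  · let i : LinearMap.ker f →ₗ[k] LinearMap.ker (g ∘ₗ f) :=
      Submodule.inclusion (LinearMap.ker_le_ker_comp f g)
    let p : LinearMap.ker (g ∘ₗ f) →ₗ[k] LinearMap.ker g :=
      f.restrict fun x hx => hx
    exact fd_of_ker_le i p fun x h => ⟨⟨x.1, congrArg Subtype.val h⟩, rfl⟩
  · let i : (V ⧸ LinearMap.range f) →ₗ[k] (T ⧸ LinearMap.range (g ∘ₗ f)) :=
      Submodule.mapQ _ _ g (by rintro _ ⟨u, rfl⟩; exact ⟨u, rfl⟩)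
    let p : (T ⧸ LinearMap.range (g ∘ₗ f)) →ₗ[k] (T ⧸ LinearMap.range g) :=
      Submodule.mapQ _ _ LinearMap.id (LinearMap.range_comp_le_range f g)
    refine fd_of_ker_le i p fun x h => ?_
    obtain ⟨t, rfl⟩ := Submodule.Quotient.mk_surjective _ x
    obtain ⟨v, rfl⟩ := (Submodule.Quotient.mk_eq_zero _).1 h
    exact ⟨Submodule.Quotient.mk v, rfl⟩

theorem isoModFdim_cokerMk {M N : GrMod 𝒜} (f : M ⟶ N)
    (hf : FiniteDimensional k (LinearMap.range (f.hom.restrictScalars k))) :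
    isoModFdim 𝒜 (cokerMk f) := by
  constructor
  · have : LinearMap.ker ((cokerMk f).hom.restrictScalars k) =
        LinearMap.range (f.hom.restrictScalars k) := by
      ext x
      exact Submodule.Quotient.mk_eq_zero (LinearMap.range f.hom)
    rw [this]
    exact hf
  · have : LinearMap.range ((cokerMk f).hom.restrictScalars k) = ⊤ :=
      LinearMap.range_eq_top.2 (cokerLin_surjective f)
    rw [this]
    infer_instance

instance : (isoModFdim 𝒜).IsMultiplicative where
  id_mem := isoModFdim_id
  comp_mem f g hf hg := fd_comp (f.hom.restrictScalars k) (g.hom.restrictScalars k) hf hg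

instance : (isoModFdim 𝒜).HasLeftCalculusOfFractions where
  exists_leftFraction X Y φ := by
    obtain ⟨s, ⟨hs1, hs2⟩, f⟩ := φ
    rename_i X'
    let d : X' ⟶ prod X Y := s ≫ inl X Y - f ≫ inr X Y
    have hd : ∀ a, d.hom a = (s.hom a, - f.hom a) := by
      intro a
      change ((s.hom a, (0 : Y.carrier)) - ((0 : X.carrier), f.hom a)) = _
      simp
    have hw : s ≫ inl X Y ≫ cokerMk d = f ≫ inr X Y ≫ cokerMk d := by
      ext a
      refine (Submodule.Quotient.eq (LinearMap.range d.hom)).2 ⟨a, rfl⟩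
    refine ⟨⟨inl X Y ≫ cokerMk d, inr X Y ≫ cokerMk d, ?_, ?_⟩, hw.symm⟩
    · have hle : LinearMap.ker ((inr X Y ≫ cokerMk d).hom.restrictScalars k) ≤
          (LinearMap.ker (s.hom.restrictScalars k)).map (f.hom.restrictScalars k) := by
        intro y hy
        obtain ⟨a, ha⟩ := (Submodule.Quotient.mk_eq_zero (LinearMap.range d.hom)).1 hy
        rw [hd] at ha
        replace ha : (s.hom a, - f.hom a) = ((0 : X.carrier), y) := ha
        have h1 : s.hom a = 0 := congrArg Prod.fst ha
        have h2 : - f.hom a = y := congrArg Prod.snd ha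
        refine ⟨-a, ?_, ?_⟩
        · change s.hom (-a) = 0
          rw [map_neg, h1, neg_zero]
        · change f.hom (-a) = y
          rw [map_neg, h2]
      exact Submodule.finiteDimensional_of_le hle
    · let T := LinearMap.range ((inr X Y ≫ cokerMk d).hom.restrictScalars k)
      let j : X.carrier →ₗ[k] (coker d).carrier ⧸ T :=
        T.mkQ ∘ₗ ((inl X Y ≫ cokerMk d).hom.restrictScalars k)
      have hj : LinearMap.range (s.hom.restrictScalars k) ≤ LinearMap.ker j := by
        rintro _ ⟨a, rfl⟩
        refine (Submodule.Quotient.mk_eq_zero T).2 ⟨f.hom a, ?_⟩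
        exact (congrArg (fun g : X' ⟶ coker d => g.hom a) hw).symm
      refine Module.Finite.of_surjective (Submodule.liftQ _ j hj) ?_
      intro t
      obtain ⟨c, rfl⟩ := Submodule.Quotient.mk_surjective _ t
      obtain ⟨⟨a, b⟩, rfl⟩ := Submodule.Quotient.mk_surjective (LinearMap.range d.hom) c
      refine ⟨Submodule.Quotient.mk a, (Submodule.Quotient.eq T).2 ⟨-b, ?_⟩⟩
      refine (Submodule.Quotient.eq (LinearMap.range d.hom)).2 ?_
      refine ⟨0, ?_⟩
      rw [map_zero]
      change (0 : X.carrier × Y.carrier) = ((0 : X.carrier), -b) - ((a, (0 : Y.carrier)) - (a, b))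
      simp
  ext X' X Y f₁ f₂ s hs h := by
    refine ⟨coker (f₁ - f₂), cokerMk (f₁ - f₂), isoModFdim_cokerMk _ ?_, ?_⟩
    · have := hs.2
      let g := (f₁ - f₂).hom.restrictScalars k
      have hg : LinearMap.range (s.hom.restrictScalars k) ≤ LinearMap.ker g := by
        rintro _ ⟨a, rfl⟩
        have h' : f₁.hom (s.hom a) = f₂.hom (s.hom a) :=
          congrArg (fun g : X' ⟶ Y => g.hom a) h
        change f₁.hom (s.hom a) - f₂.hom (s.hom a) = 0
        rw [h', sub_self]
      have : LinearMap.range g = LinearMap.range (Submodule.liftQ _ g hg) :=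
        (Submodule.range_liftQ _ g hg).symm
      change FiniteDimensional k (LinearMap.range g)
      rw [this]
      infer_instance
    · ext x
      exact (Submodule.Quotient.eq (LinearMap.range (f₁ - f₂).hom)).2 ⟨x, rfl⟩

/-- The quotient category of the category of finitely generated graded right modules by the
Serre subcategory of finite-dimensional ones, that is, the localization at the morphisms whose
kernel and cokernel are finite-dimensional. It carries its canonical `k`-linear structure,
for which the quotient functor is `k`-linear. -/
abbrev Qgr (𝒜 : Γ → Submodule k R) [GradedAlgebra 𝒜] : Type _ :=
  (isoModFdim 𝒜).Localization

end GrMod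

/-! ### Gradings determined by the degrees of generators -/

section WordGrading

variable {k : Type u} [Field k] {Γ : Type w} [AddCommGroup Γ] [DecidableEq Γ]
  {R : Type u} [Ring R] [Algebra k R] {X : Type*}

/-- The component of degree `γ` of the `k`-algebra with generators `g x` of degree `d x`: the
span of all words of degree `γ` in the generators. -/
def wordGrading (k : Type u) [Field k] [Algebra k R] (g : X → R) (d : X → Γ) (γ : Γ) :
    Submodule k R :=
  Submodule.span k {r | ∃ l : List X, (l.map d).sum = γ ∧ (l.map g).prod = r}

theorem word_mem_wordGrading (g : X → R) (d : X → Γ) (l : List X) :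
    (l.map g).prod ∈ wordGrading k g d (l.map d).sum :=
  Submodule.subset_span ⟨l, rfl, rfl⟩

theorem gen_mem_wordGrading (g : X → R) (d : X → Γ) (x : X) :
    g x ∈ wordGrading k g d (d x) :=
  Submodule.subset_span ⟨[x], by simp, by simp⟩

instance wordGrading_gradedMonoid (g : X → R) (d : X → Γ) :
    SetLike.GradedMonoid (wordGrading k g d) where
  one_mem := Submodule.subset_span ⟨[], rfl, rfl⟩
  mul_mem := by
    intro i j a b ha hb
    have h := Submodule.mul_mem_mul ha hb
    rw [wordGrading, wordGrading, Submodule.span_mul_span] at h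
    refine Submodule.span_mono ?_ h
    rintro _ ⟨_, ⟨l, rfl, rfl⟩, _, ⟨l', rfl, rfl⟩, rfl⟩
    exact ⟨l ++ l', by simp, by simp⟩

/-- The generator `g x` as a homogeneous element of the direct sum of the components. -/
def homogeneousGen (k : Type u) [Field k] [Algebra k R] (g : X → R) (d : X → Γ) (x : X) :
    ⨁ γ, wordGrading k g d γ :=
  DirectSum.of (fun γ => wordGrading k g d γ) (d x) ⟨g x, gen_mem_wordGrading g d x⟩

theorem prod_homogeneousGen (g : X → R) (d : X → Γ) (l : List X) :
    (l.map (homogeneousGen k g d)).prod =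
      DirectSum.of (fun γ => wordGrading k g d γ) (l.map d).sum
        ⟨(l.map g).prod, word_mem_wordGrading g d l⟩ := by
  induction l with
  | nil => rfl
  | cons x l ih =>
    rw [List.map_cons, List.prod_cons, ih, homogeneousGen, DirectSum.of_mul_of]
    rfl

/-- The words in the generators grade the algebra as soon as the assignment of the generators
to their degrees is compatible with the relations. -/
@[reducible]
def wordGradedAlgebra (g : X → R) (d : X → Γ)
    (φ : R →ₐ[k] ⨁ γ, wordGrading k g d γ) (hφ : ∀ x, φ (g x) = homogeneousGen k g d x)
    (hg : Algebra.adjoin k (Set.range g) = ⊤) : GradedAlgebra (wordGrading k g d) :=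
  GradedAlgebra.ofAlgHom _ φ
    (by
      refine AlgHom.ext_of_adjoin_eq_top hg ?_
      rintro _ ⟨x, rfl⟩
      rw [AlgHom.comp_apply, hφ, homogeneousGen, DirectSum.coeAlgHom_of]
      rfl)
    (by
      have hw : ∀ l : List X, φ (l.map g).prod =
          DirectSum.of (fun γ => wordGrading k g d γ) (l.map d).sum
            ⟨(l.map g).prod, word_mem_wordGrading g d l⟩ := by
        intro l
        rw [← prod_homogeneousGen, map_list_prod, List.map_map]
        congr 2
        funext x
        exact hφ x
      rintro γ ⟨r, hr⟩
      induction hr using Submodule.span_induction with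
      | mem r h =>
        obtain ⟨l, rfl, rfl⟩ := h
        exact hw l
      | zero => exact (map_zero φ).trans (map_zero _).symm
      | add r s hr hs ihr ihs =>
        rw [map_add, ihr, ihs, ← map_add]
        rfl
      | smul c r hr ih =>
        rw [map_smul, ih, ← DirectSum.lof_eq_of k, ← map_smul]
        rfl)

/-- Homogeneous elements of degree `γ` of the direct sum. -/
def homogeneous (k : Type u) [Field k] [Algebra k R] (g : X → R) (d : X → Γ) (γ : Γ) :
    Submodule k (⨁ γ, wordGrading k g d γ) :=
  LinearMap.range (DirectSum.lof k Γ (fun γ => wordGrading k g d γ) γ)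

theorem homogeneousGen_mem (g : X → R) (d : X → Γ) (x : X) :
    homogeneousGen k g d x ∈ homogeneous k g d (d x) :=
  ⟨_, rfl⟩

theorem homogeneous_one (g : X → R) (d : X → Γ) : 1 ∈ homogeneous k g d 0 :=
  ⟨⟨1, SetLike.GradedOne.one_mem⟩, rfl⟩

theorem homogeneous_mul (g : X → R) (d : X → Γ) {γ δ : Γ} {s t : ⨁ γ, wordGrading k g d γ}
    (hs : s ∈ homogeneous k g d γ) (ht : t ∈ homogeneous k g d δ) :
    s * t ∈ homogeneous k g d (γ + δ) := by
  obtain ⟨a, rfl⟩ := hs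
  obtain ⟨b, rfl⟩ := ht
  refine ⟨GradedMonoid.GMul.mul (A := fun γ => wordGrading k g d γ) a b, ?_⟩
  exact (DirectSum.of_mul_of (A := fun γ => wordGrading k g d γ) a b).symm

theorem homogeneous_aeval (g : X → R) (d : X → Γ) {s : ⨁ γ, wordGrading k g d γ}
    (hs : s ∈ homogeneous k g d 0) (p : k[X]) : aeval s p ∈ homogeneous k g d 0 := by
  rw [Polynomial.aeval_eq_sum_range]
  have hpow : ∀ i : ℕ, s ^ i ∈ homogeneous k g d 0 := by
    intro i
    induction i with
    | zero => rw [pow_zero]; exact homogeneous_one g d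
    | succ n ih =>
      rw [pow_succ]
      simpa using homogeneous_mul g d ih hs
  exact Submodule.sum_mem _ fun i _ => Submodule.smul_mem _ _ (hpow i)

theorem homogeneous_ext (g : X → R) (d : X → Γ) {γ : Γ} {s t : ⨁ γ, wordGrading k g d γ}
    (hs : s ∈ homogeneous k g d γ) (ht : t ∈ homogeneous k g d γ)
    (h : DirectSum.coeAlgHom (wordGrading k g d) s = DirectSum.coeAlgHom (wordGrading k g d) t) :
    s = t := by
  obtain ⟨a, rfl⟩ := hs
  obtain ⟨b, rfl⟩ := ht
  rw [DirectSum.lof_eq_of, DirectSum.lof_eq_of, DirectSum.coeAlgHom_of,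
    DirectSum.coeAlgHom_of] at h
  rw [Subtype.ext h]

theorem coe_homogeneousGen (g : X → R) (d : X → Γ) (x : X) :
    DirectSum.coeAlgHom (wordGrading k g d) (homogeneousGen k g d x) = g x := by
  rw [homogeneousGen, DirectSum.coeAlgHom_of]

theorem homogeneousGen_rel_comm (g : X → R) (d : X → Γ) {x z : X} (hz : d z = 0) (p : k[X])
    (h : g x * g z = aeval (g z) p * g x) :
    homogeneousGen k g d x * homogeneousGen k g d z =
      aeval (homogeneousGen k g d z) p * homogeneousGen k g d x := by
  have hx := homogeneousGen_mem (k := k) g d x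
  have hz' := homogeneousGen_mem (k := k) g d z
  rw [hz] at hz'
  refine homogeneous_ext g d (γ := d x) ?_ ?_ ?_
  · simpa using homogeneous_mul g d hx hz'
  · simpa using homogeneous_mul g d (homogeneous_aeval g d hz' p) hx
  · rw [map_mul, map_mul, ← Polynomial.aeval_algHom_apply, coe_homogeneousGen,
      coe_homogeneousGen, h]

theorem homogeneousGen_rel_mul (g : X → R) (d : X → Γ) {x y z : X} (hz : d z = 0)
    (hxy : d x + d y = 0) (p : k[X]) (h : g x * g y = aeval (g z) p) :
    homogeneousGen k g d x * homogeneousGen k g d y = aeval (homogeneousGen k g d z) p := by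
  have hx := homogeneousGen_mem (k := k) g d x
  have hy := homogeneousGen_mem (k := k) g d y
  have hz' := homogeneousGen_mem (k := k) g d z
  rw [hz] at hz'
  refine homogeneous_ext g d (γ := 0) ?_ (homogeneous_aeval g d hz' p) ?_
  · rw [← hxy]
    exact homogeneous_mul g d hx hy
  · rw [map_mul, ← Polynomial.aeval_algHom_apply, coe_homogeneousGen,
      coe_homogeneousGen, coe_homogeneousGen, h]

end WordGrading

section

variable {k : Type u} [Field k] {Γ : Type w} [AddCommGroup Γ] [DecidableEq Γ]
  {R : Type u} [CommRing R] [Algebra k R] {ι : Type*}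

noncomputable instance wordGrading_commRing (g : ι → R) (d : ι → Γ) :
    CommRing (⨁ γ, wordGrading k g d γ) :=
  DirectSum.commRing _

/-- Polynomials in variables mapped to homogeneous generators, with coefficients in the
polynomial ring in one variable mapped to another one. -/
noncomputable def homogeneousLift (g : Option ι → R) (d : Option ι → Γ) :
    MvPolynomial ι k[X] →ₐ[k] ⨁ γ, wordGrading k g d γ :=
  { MvPolynomial.eval₂Hom
      (aeval (R := k) (homogeneousGen k g d none)).toRingHom
      (fun n => homogeneousGen k g d (some n)) with
    commutes' := fun c => by
      change MvPolynomial.eval₂Hom _ _ (MvPolynomial.C (C c)) = _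
      rw [MvPolynomial.eval₂Hom_C]
      exact aeval_C _ c }

theorem homogeneousLift_X (g : Option ι → R) (d : Option ι → Γ) (n : ι) :
    homogeneousLift (k := k) g d (MvPolynomial.X n) = homogeneousGen k g d (some n) :=
  MvPolynomial.eval₂Hom_X' _ _ n

theorem homogeneousLift_C (g : Option ι → R) (d : Option ι → Γ) (p : k[X]) :
    homogeneousLift (k := k) g d (MvPolynomial.C p) = aeval (homogeneousGen k g d none) p :=
  MvPolynomial.eval₂Hom_C _ _ p

end

/-! ### The generalized Weyl algebras `A(f)` -/

namespace GWA

variable {k : Type u} [Field k]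

/-- The generators of `A(f)` as a `k`-algebra. -/
inductive Gen : Type
  | x | y | z

/-- The defining relations `xz = σ(z)x`, `yz = σ⁻¹(z)y`, `xy = f`, `yx = σ⁻¹(f)`, where `σ` is
the automorphism of `k[z]` with `σ(z) = z + 1`. -/
inductive Rel (f : k[X]) : FreeAlgebra k Gen → FreeAlgebra k Gen → Prop
  | xz : Rel f (FreeAlgebra.ι k Gen.x * FreeAlgebra.ι k Gen.z)
      ((FreeAlgebra.ι k Gen.z + 1) * FreeAlgebra.ι k Gen.x)
  | yz : Rel f (FreeAlgebra.ι k Gen.y * FreeAlgebra.ι k Gen.z)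
      ((FreeAlgebra.ι k Gen.z - 1) * FreeAlgebra.ι k Gen.y)
  | xy : Rel f (FreeAlgebra.ι k Gen.x * FreeAlgebra.ι k Gen.y)
      (aeval (FreeAlgebra.ι k Gen.z) f)
  | yx : Rel f (FreeAlgebra.ι k Gen.y * FreeAlgebra.ι k Gen.x)
      (aeval (FreeAlgebra.ι k Gen.z - 1) f)

end GWA

/-- The generalized Weyl algebra `A(f)` with base ring `k[z]`, automorphism `σ(z) = z + 1` and
defining element `f`. -/
abbrev GWA {k : Type u} [Field k] (f : k[X]) : Type u := RingQuot (GWA.Rel f)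

namespace GWA

variable {k : Type u} [Field k]

/-- The images of the generators in `A(f)`. -/
noncomputable def gen (f : k[X]) (i : Gen) : GWA f :=
  RingQuot.mkAlgHom k (Rel f) (FreeAlgebra.ι k i)

/-- `deg x = 1`, `deg y = -1`, `deg z = 0`. -/
def genDeg : Gen → ℤ
  | .x => 1
  | .y => -1
  | .z => 0

/-- The `ℤ`-grading of `A(f)`. -/
noncomputable abbrev grading (f : k[X]) : ℤ → Submodule k (GWA f) :=
  wordGrading k (gen f) genDeg

theorem adjoin_gen (f : k[X]) : Algebra.adjoin k (Set.range (gen f)) = ⊤ := by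
  have : Set.range (gen f) =
      RingQuot.mkAlgHom k (Rel f) '' Set.range (FreeAlgebra.ι k) := by
    rw [← Set.range_comp]
    rfl
  rw [this, ← AlgHom.map_adjoin, FreeAlgebra.adjoin_range_ι, Algebra.map_top,
    AlgHom.range_eq_top]
  exact RingQuot.mkAlgHom_surjective k (Rel f)

theorem gen_x_mul_z (f : k[X]) :
    gen f .x * gen f .z = aeval (gen f .z) (X + 1 : k[X]) * gen f .x := by
  simpa [gen] using RingQuot.mkAlgHom_rel k (Rel.xz (f := f))

theorem gen_y_mul_z (f : k[X]) :
    gen f .y * gen f .z = aeval (gen f .z) (X - 1 : k[X]) * gen f .y := by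
  simpa [gen] using RingQuot.mkAlgHom_rel k (Rel.yz (f := f))

theorem gen_x_mul_y (f : k[X]) : gen f .x * gen f .y = aeval (gen f .z) f := by
  have := RingQuot.mkAlgHom_rel k (Rel.xy (f := f))
  rwa [map_mul, ← Polynomial.aeval_algHom_apply] at this

theorem gen_y_mul_x (f : k[X]) :
    gen f .y * gen f .x = aeval (gen f .z) (f.comp (X - 1)) := by
  have := RingQuot.mkAlgHom_rel k (Rel.yx (f := f))
  rw [map_mul, ← Polynomial.aeval_algHom_apply, map_sub, map_one] at this
  rw [Polynomial.aeval_comp, map_sub, aeval_X, map_one]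
  exact this

theorem lift_rel (f : k[X]) ⦃a b : FreeAlgebra k Gen⦄ (h : Rel f a b) :
    FreeAlgebra.lift k (homogeneousGen k (gen f) genDeg) a =
      FreeAlgebra.lift k (homogeneousGen k (gen f) genDeg) b := by
  cases h with
  | xz =>
    have := homogeneousGen_rel_comm (gen f) genDeg rfl _ (gen_x_mul_z f)
    simpa only [map_mul, map_add, map_one, aeval_X, FreeAlgebra.lift_ι_apply] using this
  | yz =>
    have := homogeneousGen_rel_comm (gen f) genDeg rfl _ (gen_y_mul_z f)
    have e : FreeAlgebra.ι k Gen.z - 1 = aeval (FreeAlgebra.ι k Gen.z) (X - 1 : k[X]) := by simp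
    rw [e, map_mul, map_mul, ← Polynomial.aeval_algHom_apply, FreeAlgebra.lift_ι_apply,
      FreeAlgebra.lift_ι_apply, this]
  | xy =>
    have := homogeneousGen_rel_mul (gen f) genDeg rfl rfl _ (gen_x_mul_y f)
    rw [map_mul, ← Polynomial.aeval_algHom_apply, FreeAlgebra.lift_ι_apply,
      FreeAlgebra.lift_ι_apply, FreeAlgebra.lift_ι_apply, this]
  | yx =>
    have := homogeneousGen_rel_mul (gen f) genDeg rfl rfl _ (gen_y_mul_x f)
    have e : aeval (FreeAlgebra.ι k Gen.z - 1) f =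
        aeval (FreeAlgebra.ι k Gen.z) (f.comp (X - 1)) := by
      rw [Polynomial.aeval_comp, map_sub, aeval_X, map_one]
    rw [e, map_mul, ← Polynomial.aeval_algHom_apply, FreeAlgebra.lift_ι_apply,
      FreeAlgebra.lift_ι_apply, FreeAlgebra.lift_ι_apply, this]

/-- The homomorphism from `A(f)` to the direct sum of its homogeneous components. -/
noncomputable def decomposeHom (f : k[X]) : GWA f →ₐ[k] ⨁ n, grading f n :=
  RingQuot.liftAlgHom k ⟨FreeAlgebra.lift k (homogeneousGen k (gen f) genDeg), lift_rel f⟩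

noncomputable instance (f : k[X]) : GradedAlgebra (grading f) :=
  wordGradedAlgebra (gen f) genDeg (decomposeHom f)
    (fun i => by
      rw [decomposeHom, gen, RingQuot.liftAlgHom_mkAlgHom_apply, FreeAlgebra.lift_ι_apply])
    (adjoin_gen f)

end GWA

/-! ### The ring `B` -/

/-- The group of finite subsets of `ℤ` under symmetric difference (as the additive group of a
Boolean ring whose multiplication is the intersection). -/
abbrev ZFin : Type := AsBoolRing (Finset ℤ)

noncomputable instance : DecidableEq ZFin := Classical.decEq _

/-- The commutative ring `B = k[z][bₙ | n ∈ ℤ] / (bₙ² = (z + n)² | n ∈ ℤ)`. -/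
abbrev BRing (k : Type u) [Field k] : Type u :=
  MvPolynomial ℤ k[X] ⧸ Ideal.span (Set.range fun n : ℤ =>
    (MvPolynomial.X n ^ 2 - MvPolynomial.C ((X + C (n : k)) ^ 2) : MvPolynomial ℤ k[X]))

namespace BRing

variable (k : Type u) [Field k]

/-- The generators of `B` as a `k`-algebra: `none` stands for `z` and `some n` for `bₙ`. -/
noncomputable def gen : Option ℤ → BRing k
  | none => Ideal.Quotient.mk _ (MvPolynomial.C X)
  | some n => Ideal.Quotient.mk _ (MvPolynomial.X n)

/-- `deg z = ∅` and `deg bₙ = {n}`. -/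
def genDeg : Option ℤ → ZFin
  | none => 0
  | some n => toBoolRing {n}

/-- The grading of `B` by the finite subsets of `ℤ`. -/
noncomputable abbrev grading : ZFin → Submodule k (BRing k) :=
  wordGrading k (gen k) genDeg

theorem mk_C (p : k[X]) : (Ideal.Quotient.mk _ (MvPolynomial.C p) : BRing k) =
    aeval (gen k none) p := by
  let φ : k[X] →ₐ[k] BRing k :=
    (Ideal.Quotient.mkₐ k _).comp (IsScalarTower.toAlgHom k k[X] (MvPolynomial ℤ k[X]))
  have h : φ = aeval (gen k none) := by
    refine Polynomial.algHom_ext ?_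
    rw [aeval_X]
    rfl
  exact AlgHom.congr_fun h p

theorem adjoin_gen : Algebra.adjoin k (Set.range (gen k)) = ⊤ := by
  rw [eq_top_iff]
  rintro b -
  obtain ⟨p, rfl⟩ := Ideal.Quotient.mk_surjective b
  induction p using MvPolynomial.induction_on with
  | C p =>
    rw [mk_C]
    exact Algebra.adjoin_mono (Set.singleton_subset_iff.2 (Set.mem_range_self none))
      (aeval_mem_adjoin_singleton k _)
  | add p q hp hq => rw [map_add]; exact Subalgebra.add_mem _ hp hq
  | mul_X p n hp =>
    rw [map_mul]
    exact Subalgebra.mul_mem _ hp (Algebra.subset_adjoin ⟨some n, rfl⟩)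

theorem gen_mul_self (n : ℤ) :
    gen k (some n) * gen k (some n) = aeval (gen k none) ((X + C (n : k)) ^ 2) := by
  rw [← pow_two, ← mk_C]
  exact (map_pow _ _ 2).symm.trans ((Ideal.Quotient.eq).2 (Ideal.subset_span ⟨n, rfl⟩))

theorem genDeg_add_self (n : ℤ) : genDeg (some n) + genDeg (some n) = 0 := by
  change toBoolRing (symmDiff ({n} : Finset ℤ) {n}) = toBoolRing ⊥
  rw [symmDiff_self]

theorem lift_rel (a : MvPolynomial ℤ k[X])
    (ha : a ∈ Ideal.span (Set.range fun n : ℤ =>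
      (MvPolynomial.X n ^ 2 - MvPolynomial.C ((X + C (n : k)) ^ 2) : MvPolynomial ℤ k[X]))) :
    homogeneousLift (k := k) (gen k) genDeg a = 0 := by
  induction ha using Submodule.span_induction with
  | mem a h =>
    obtain ⟨n, rfl⟩ := h
    have := homogeneousGen_rel_mul (gen k) genDeg rfl (genDeg_add_self n) _ (gen_mul_self k n)
    rw [map_sub, sub_eq_zero, map_pow, homogeneousLift_X, homogeneousLift_C, pow_two]
    exact this
  | zero => exact map_zero _
  | add a b _ _ iha ihb => rw [map_add, iha, ihb, add_zero]
  | smul c a _ ih => rw [smul_eq_mul, map_mul, ih, mul_zero]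

/-- The homomorphism from `B` to the direct sum of its homogeneous components. -/
noncomputable def decomposeHom : BRing k →ₐ[k] ⨁ J, grading k J :=
  Ideal.Quotient.liftₐ _ (homogeneousLift (k := k) (gen k) genDeg) (lift_rel k)

noncomputable instance : GradedAlgebra (grading k) :=
  wordGradedAlgebra (gen k) genDeg (decomposeHom k)
    (fun i => by
      cases i with
      | none => exact (homogeneousLift_C (gen k) genDeg X).trans (aeval_X _)
      | some n => exact homogeneousLift_X (gen k) genDeg n)
    (adjoin_gen k)

end BRing

/-! ### The involutions of `gr A(z²)` and the ring they define -/

namespace MultipleRoot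

variable (k : Type u) [Field k]

/-- The generalized Weyl algebra `A(z²)`. -/
abbrev A : Type u := GWA (X ^ 2 : k[X])

variable {k}

/-- Left multiplication by an element, as a homomorphism of right modules. -/
def leftMul (u : A k) : A k →ₗ[(A k)ᵐᵒᵖ] A k where
  toFun a := u * a
  map_add' a b := mul_add u a b
  map_smul' r a := (mul_assoc u a r.unop).symm

variable (k)

/-- The module `ι_j A`: the kernel of the surjection `a ↦ yʲa` from `A` onto `(A/xA)⟨j⟩` if
`0 ≤ j` and the kernel of the surjection `a ↦ x⁻ʲ⁻¹a` from `A` onto `(A/yA)⟨j + 1⟩` if `j < 0`,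
where `M⟨n⟩ᵢ = Mᵢ₋ₙ`. -/
noncomputable def iotaSingle (j : ℤ) : Submodule (A k)ᵐᵒᵖ (A k) :=
  if 0 ≤ j then
    LinearMap.ker ((LinearMap.range (leftMul (GWA.gen (X ^ 2 : k[X]) .x))).mkQ ∘ₗ
      leftMul (GWA.gen (X ^ 2 : k[X]) .y ^ j.toNat))
  else
    LinearMap.ker ((LinearMap.range (leftMul (GWA.gen (X ^ 2 : k[X]) .y))).mkQ ∘ₗ
      leftMul (GWA.gen (X ^ 2 : k[X]) .x ^ (-j - 1).toNat))

/-- The module `ι_J A`, where `ι_J` is the product of the commuting `ι_j`, `j ∈ J`; each `ι_j`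
is a subfunctor of the identity. -/
noncomputable def iota (J : Finset ℤ) : Submodule (A k)ᵐᵒᵖ (A k) :=
  ⨅ j ∈ J, iotaSingle k j

/-- `Hom_{gr A}(A, ι_J A)`: the homomorphisms of degree zero, considered as maps to `A` with
values in `ι_J A`. -/
noncomputable def iotaHom (J : ZFin) : Submodule k (A k →ₗ[(A k)ᵐᵒᵖ] A k) where
  carrier := {φ | (∀ (n : ℤ) (a : A k), a ∈ GWA.grading (X ^ 2 : k[X]) n →
      φ a ∈ GWA.grading (X ^ 2 : k[X]) n) ∧ ∀ a, φ a ∈ iota k (ofBoolRing J)}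
  add_mem' hφ hψ :=
    ⟨fun n a ha => Submodule.add_mem _ (hφ.1 n a ha) (hψ.1 n a ha),
      fun a => Submodule.add_mem _ (hφ.2 a) (hψ.2 a)⟩
  zero_mem' := ⟨fun n _ _ => Submodule.zero_mem _, fun _ => Submodule.zero_mem _⟩
  smul_mem' c φ hφ :=
    ⟨fun n a ha => Submodule.smul_mem _ c (hφ.1 n a ha), fun a => by
      rw [LinearMap.smul_apply, ← algebraMap_smul (A k)ᵐᵒᵖ c (φ a)]
      exact Submodule.smul_mem _ _ (hφ.2 a)⟩

/-- The element `h_J = ∏_{j ∈ J} (z + j)²` of `A`. -/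
noncomputable def h (J : Finset ℤ) : A k :=
  aeval (GWA.gen (X ^ 2 : k[X]) .z) (∏ j ∈ J, (X + C (j : k)) ^ 2)

/-- The graded algebra `ℬ` is the ring `⨁_J Hom_{gr A}(A, ι_J A)` with the multiplication
`a · b = ι_{I ⊕ J}(σ_{I ∩ J}) ∘ ι_J(a) ∘ b` for `a` of degree `I` and `b` of degree `J`.
Here `ι_J(a)` is the restriction of `a` and `σ_K : ι_K² A → A` is left multiplication by the
inverse of `h_K`; so `a · b` is the map `c` with `h_{I ∩ J} c(t) = a(b(t))`. -/
def IsInvolutionRing {B : Type u} [Ring B] [Algebra k B] (ℬ : ZFin → Submodule k B)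
    [GradedAlgebra ℬ] : Prop :=
  ∃ Φ : ∀ J : ZFin, ℬ J ≃ₗ[k] iotaHom k J,
    (Φ 0 ⟨1, SetLike.GradedOne.one_mem⟩).1 = LinearMap.id ∧
    ∀ (I J : ZFin) (a : ℬ I) (b : ℬ J) (t : A k),
      h k (ofBoolRing I ∩ ofBoolRing J) *
          (Φ (I + J) ⟨a.1 * b.1, SetLike.mul_mem_graded a.2 b.2⟩).1 t =
        (Φ I a).1 ((Φ J b).1 t)

end MultipleRoot

/-! Second claim. Let `z` act on the component `M_i` of a graded right `A(z(z+m))`-module through `z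
- i`. Then `x : M_i → M_{i+1}` and `y : M_{i+1} → M_i` are `k[z]`-linear, and both composites across
the step from `i` to `i+1` are multiplication by `(z+i)(z+i+m)`. So every integer `n` (a "point")
contributes the factor `z+n` at exactly two steps, its gaps `n-m` and `n`. For a set `t` of integers
containing everything far to the left and nothing far to the right, let `L_t` be the chain of free
rank one modules in which `x` carries the factor `z+n` at both gaps if `n ∈ t`, and `y` carries it
at both gaps otherwise. A homomorphism `L_t → M` is a compatible family (`Chain.fam`). A finite set
`J` gives the type `ptype J`, which is `{n < 0}` changed at the points of `J`.

The functor is `F(M) = ⊕_J Hom(L_J, M)`. Comparison maps between the `L_J` change the type of one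
point `n`; going there and back collects both gaps, that is `(z+n)²`, so these maps make `F(M)` a
graded `B`-module with `b_n` changing the type of `n`.

Everything rests on one coprimality. A family is recovered from one member far to the left up to a
product of factors `z+n` with `n ∈ t`, and from one member far to the right up to a product of
factors with `n ∉ t` (`Chain.ext_apply_of_mem`, `Chain.coext_apply_of_mem`). Since the two gaps of a
point lie on the same side and the `z+n` are pairwise coprime in characteristic zero, Bézout
recovers the family from both ends (`Chain.mem_of_polyAct_mem`). Hence `F` depends only on the
degrees far out: it inverts morphisms with finite-dimensional kernel and cokernel
(`GrMod.famMapLin_injective`, `GrMod.famMapLin_surjective`), and a stable subspace of `F(M)` which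
exhausts `M` far out is all of `F(M)` (`GrMod.eq_top_of_stable`). Conversely, the values of families
fill `M` up to something finite-dimensional, so only such morphisms are inverted
(`GrMod.ker_finiteDimensional`, `GrMod.coker_finiteDimensional`).

The left adjoint of `F` is the tensor product over `B` with the `L_J`: copies of `N` indexed by `ℤ`,
with `b_n` identified with its weight at each position. The unit is an isomorphism
(`GrMod.unit_injective`, `GrMod.unit_surjective`), so the left adjoint is fully faithful. The counit
becomes invertible under `F`, hence has finite-dimensional kernel and cokernel, and `F` is the
localization.

First claim. A graded homomorphism `A → ι_J A` is left multiplication by a polynomial in `z`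
divisible by `∏ (z+j)²` (`MultipleRoot.aeval_mem_iota`), and `B_J = k[z] ∏ b_j`. Matching the two
generators gives `Φ_J`; the product rule is the identity between products of the `z+j` over `I`,
`J`, `I ⊕ J` and `I ∩ J`. -/

/-! ### Chains of modules over a polynomial ring -/

section Weights

variable {k : Type u} [Field k]

/-- The number of the two gaps `n - m` and `n` of the point `n` which are not to the left
of `i`. -/
def gapCount (m : ℕ) (n i : ℤ) : ℕ := (if i ≤ n then 1 else 0) + (if i + m ≤ n then 1 else 0)

theorem gapCount_le_two (m : ℕ) (n i : ℤ) : gapCount m n i ≤ 2 := by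
  unfold gapCount; split_ifs <;> omega

theorem gapCount_succ (m : ℕ) (n i : ℤ) : gapCount m n i =
    gapCount m n (i + 1) + (if n = i then 1 else 0) + (if n = i + m then 1 else 0) := by
  unfold gapCount
  split_ifs <;> omega

open Classical in
/-- The factor of the point `n` if it has type `t`. -/
noncomputable def pointWeight (lam : ℤ → k[X]) (t : ℤ → Prop) (n : ℤ) : k[X] :=
  if t n then lam n else 1

theorem pointWeight_pos {lam : ℤ → k[X]} {t : ℤ → Prop} {n : ℤ} (h : t n) :
    pointWeight lam t n = lam n := if_pos h

theorem pointWeight_neg {lam : ℤ → k[X]} {t : ℤ → Prop} {n : ℤ} (h : ¬ t n) :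
    pointWeight lam t n = 1 := if_neg h

theorem pointWeight_mul_not (lam : ℤ → k[X]) (t : ℤ → Prop) (n : ℤ) :
    pointWeight lam t n * pointWeight lam (fun j => ¬ t j) n = lam n := by
  by_cases h : t n
  · rw [pointWeight_pos h, pointWeight_neg (not_not.2 h), mul_one]
  · rw [pointWeight_neg h, pointWeight_pos (t := fun j => ¬ t j) h, one_mul]

/-- The factor of the step from `i` to `i + 1` for points of type `t`. -/
noncomputable def stepWeight (lam : ℤ → k[X]) (m : ℕ) (t : ℤ → Prop) (i : ℤ) : k[X] :=
  pointWeight lam t i * pointWeight lam t (i + m)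

theorem stepWeight_mul_not (lam : ℤ → k[X]) (m : ℕ) (t : ℤ → Prop) (i : ℤ) :
    stepWeight lam m t i * stepWeight lam m (fun j => ¬ t j) i = lam i * lam (i + m) := by
  rw [← pointWeight_mul_not lam t i, ← pointWeight_mul_not lam t (i + m), stepWeight, stepWeight]
  ring

/-- Change of the type of the point `n`. -/
def toggle (t : ℤ → Prop) (n : ℤ) : ℤ → Prop := fun j => if j = n then ¬ t j else t j

theorem toggle_self (t : ℤ → Prop) (n : ℤ) : toggle t n n = ¬ t n := if_pos rfl

theorem toggle_ne (t : ℤ → Prop) {n j : ℤ} (h : j ≠ n) : toggle t n j = t j := if_neg h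

theorem pointWeight_toggle_ne (lam : ℤ → k[X]) (t : ℤ → Prop) {n j : ℤ} (h : j ≠ n) :
    pointWeight lam (toggle t n) j = pointWeight lam t j := by
  rw [pointWeight, pointWeight, toggle_ne t h]

open Classical in
/-- The factors of the comparison map which changes the type of the point `n`. -/
noncomputable def toggleWeight (lam : ℤ → k[X]) (m : ℕ) (n : ℤ) (t : ℤ → Prop) (i : ℤ) : k[X] :=
  if t n then lam n ^ (2 - gapCount m n i) else lam n ^ gapCount m n i

theorem toggleWeight_pos {lam : ℤ → k[X]} {m : ℕ} {n : ℤ} {t : ℤ → Prop} (h : t n) (i : ℤ) :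
    toggleWeight lam m n t i = lam n ^ (2 - gapCount m n i) := if_pos h

theorem toggleWeight_neg {lam : ℤ → k[X]} {m : ℕ} {n : ℤ} {t : ℤ → Prop} (h : ¬ t n) (i : ℤ) :
    toggleWeight lam m n t i = lam n ^ gapCount m n i := if_neg h

theorem toggleWeight_congr (lam : ℤ → k[X]) (m : ℕ) {n : ℤ} {t t' : ℤ → Prop} (h : t n ↔ t' n)
    (i : ℤ) : toggleWeight lam m n t i = toggleWeight lam m n t' i := by
  by_cases h' : t n
  · rw [toggleWeight_pos h', toggleWeight_pos (h.1 h')]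
  · rw [toggleWeight_neg h', toggleWeight_neg (mt h.2 h')]

/-- One direction counts the gaps not to the left of `i`, the other the remaining ones; together
these are both gaps, whatever `i` is. This is the source of the relation `bₙ² = (z + n)²`. -/
theorem toggleWeight_mul (lam : ℤ → k[X]) (m : ℕ) {n : ℤ} {t t' : ℤ → Prop} (h : t n ↔ ¬ t' n)
    (i : ℤ) : toggleWeight lam m n t i * toggleWeight lam m n t' i = lam n ^ 2 := by
  have := gapCount_le_two m n i
  by_cases h' : t n
  · rw [toggleWeight_pos h', toggleWeight_neg (h.1 h'), ← pow_add]; congr 1; omega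
  · rw [toggleWeight_neg h', toggleWeight_pos (by tauto), ← pow_add]; congr 1; omega

/-- The weight changes only across the two gaps of `n`, by one factor `lam n`, and this compensates
the factor which passes between `x` and `y` there. Positivity of `m` makes the two gaps distinct
steps. This is compatibility of the comparison map with `x`. -/
theorem toggleWeight_mul_stepWeight (lam : ℤ → k[X]) {m : ℕ} (hm : 0 < m) (n : ℤ) (t : ℤ → Prop)
    (i : ℤ) : toggleWeight lam m n t i * stepWeight lam m t i =
      toggleWeight lam m n t (i + 1) * stepWeight lam m (toggle t n) i := by
  have h2 := gapCount_le_two m n i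
  have h2' := gapCount_le_two m n (i + 1)
  have hs := gapCount_succ m n i
  unfold stepWeight
  by_cases h1 : i = n
  · have h3 : i + m ≠ n := by omega
    rw [pointWeight_toggle_ne lam t h3, ← mul_assoc, ← mul_assoc]
    congr 1
    rw [if_pos h1.symm, if_neg (Ne.symm h3)] at hs
    subst h1
    by_cases ht : t i
    · rw [toggleWeight_pos ht, toggleWeight_pos ht, pointWeight_pos ht,
        pointWeight_neg (by rw [toggle_self]; exact not_not.2 ht), mul_one, ← pow_succ]
      congr 1; omega
    · rw [toggleWeight_neg ht, toggleWeight_neg ht, pointWeight_neg ht,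
        pointWeight_pos (by rw [toggle_self]; exact ht), mul_one, ← pow_succ]
      congr 1
  · rw [pointWeight_toggle_ne lam t h1, if_neg (Ne.symm h1)] at *
    by_cases h3 : i + m = n
    · rw [if_pos h3.symm] at hs
      rw [mul_left_comm, mul_left_comm (toggleWeight lam m n t (i + 1))]
      congr 1
      rw [h3]
      by_cases ht : t n
      · rw [toggleWeight_pos ht, toggleWeight_pos ht, pointWeight_pos ht,
          pointWeight_neg (by rw [toggle_self]; exact not_not.2 ht), mul_one, ← pow_succ]
        congr 1; omega
      · rw [toggleWeight_neg ht, toggleWeight_neg ht, pointWeight_neg ht,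
          pointWeight_pos (by rw [toggle_self]; exact ht), mul_one, ← pow_succ]
        congr 1
    · rw [if_neg (Ne.symm h3)] at hs
      rw [pointWeight_toggle_ne lam t h3]
      congr 1
      by_cases ht : t n
      · rw [toggleWeight_pos ht, toggleWeight_pos ht, hs]
        simp
      · rw [toggleWeight_neg ht, toggleWeight_neg ht, hs]
        simp

theorem pointWeight_ne_zero {lam : ℤ → k[X]} (h0 : ∀ n, lam n ≠ 0) (t : ℤ → Prop) (i : ℤ) :
    pointWeight lam t i ≠ 0 := by
  unfold pointWeight; split_ifs
  · exact h0 i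
  · exact one_ne_zero

theorem stepWeight_ne_zero {lam : ℤ → k[X]} (h0 : ∀ n, lam n ≠ 0) (m : ℕ) (t : ℤ → Prop) (i : ℤ) :
    stepWeight lam m t i ≠ 0 :=
  mul_ne_zero (pointWeight_ne_zero h0 _ _) (pointWeight_ne_zero h0 _ _)

/-- Compatibility with `y` follows from that with `x`: for either type the factors of `x` and `y`
multiply to `lam i * lam (i + m)`, and the step weight can be cancelled in `k[X]`. -/
theorem toggleWeight_mul_stepWeight_not {lam : ℤ → k[X]} (h0 : ∀ n, lam n ≠ 0) {m : ℕ} (hm : 0 < m)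
    (n : ℤ) (t : ℤ → Prop) (i : ℤ) :
    toggleWeight lam m n t (i + 1) * stepWeight lam m (fun j => ¬ t j) i =
      toggleWeight lam m n t i * stepWeight lam m (fun j => ¬ toggle t n j) i := by
  have h := toggleWeight_mul_stepWeight lam hm n t i
  have h1 := stepWeight_mul_not lam m t i
  have h2 := stepWeight_mul_not lam m (toggle t n) i
  refine mul_left_cancel₀ (stepWeight_ne_zero h0 m t i) ?_
  linear_combination toggleWeight lam m n t (i + 1) * h1 -
    toggleWeight lam m n t (i + 1) * h2 - stepWeight lam m (fun j => ¬ toggle t n j) i * h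

/-- All points far to the left have type `t`, and no point far to the right has. -/
def IsHalfLine (t : ℤ → Prop) : Prop := ∃ N : ℤ, ∀ n, (n < -N → t n) ∧ (N ≤ n → ¬ t n)

/-- The products of the factors of points of type `t`. -/
noncomputable def weightMonoid (lam : ℤ → k[X]) (t : ℤ → Prop) : Submonoid k[X] :=
  Submonoid.closure (lam '' {n | t n})

theorem lam_mem_weightMonoid (lam : ℤ → k[X]) {t : ℤ → Prop} {n : ℤ} (h : t n) :
    lam n ∈ weightMonoid lam t := Submonoid.subset_closure ⟨n, h, rfl⟩

/-- A point has one type for both of its gaps, so no point contributes to both monoids. -/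
theorem isCoprime_of_mem_weightMonoid {lam : ℤ → k[X]}
    (hlam : ∀ n n', n ≠ n' → IsCoprime (lam n) (lam n')) {t : ℤ → Prop} {p q : k[X]}
    (hp : p ∈ weightMonoid lam t) (hq : q ∈ weightMonoid lam fun j => ¬ t j) : IsCoprime p q := by
  induction hp using Submonoid.closure_induction with
  | mem p h =>
    obtain ⟨n, hn, rfl⟩ := h
    induction hq using Submonoid.closure_induction with
    | mem q h =>
      obtain ⟨n', hn', rfl⟩ := h
      exact hlam _ _ fun h => hn' (h ▸ hn)
    | one => exact isCoprime_one_right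
    | mul q q' _ _ h h' => exact h.mul_right h'
  | one => exact isCoprime_one_left
  | mul p p' _ _ h h' => exact h.mul_left h'

/-- The factors of the extension of an element in position `a` to a family. -/
noncomputable def extWeight (lam : ℤ → k[X]) (m : ℕ) (S : Finset ℤ) (i : ℤ) : k[X] :=
  ∏ n ∈ S, lam n ^ gapCount m n i

theorem extWeight_mem (lam : ℤ → k[X]) (m : ℕ) {S : Finset ℤ} {t : ℤ → Prop}
    (hS : ∀ n ∈ S, t n) (i : ℤ) : extWeight lam m S i ∈ weightMonoid lam t :=
  Submonoid.prod_mem _ fun n hn => Submonoid.pow_mem _ (lam_mem_weightMonoid lam (hS n hn)) _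

theorem extWeight_eq_one (lam : ℤ → k[X]) (m : ℕ) {S : Finset ℤ} {i : ℤ}
    (hS : ∀ n ∈ S, n < i) : extWeight lam m S i = 1 := by
  refine Finset.prod_eq_one fun n hn => ?_
  have := hS n hn
  have h : gapCount m n i = 0 := by unfold gapCount; split_ifs <;> omega
  rw [h, pow_zero]

/-- `extWeight` at `i` collects the factors which `x` still has to meet from `i` onwards, so a step
removes those of that step. The set is cut at `a` and not at `a + m`: a point with `a ≤ n < a + m`
has its gap `n - m` behind `a` but its gap `n` still ahead. -/
theorem extWeight_succ (lam : ℤ → k[X]) (m : ℕ) {S : Finset ℤ} {t : ℤ → Prop} {a i : ℤ}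
    (hS : ∀ n, n ∈ S ↔ t n ∧ a ≤ n) (hi : a ≤ i) :
    extWeight lam m S i = stepWeight lam m t i * extWeight lam m S (i + 1) := by
  have key : ∀ j, a ≤ j → ∏ n ∈ S, lam n ^ (if n = j then 1 else 0) = pointWeight lam t j := by
    intro j hj
    rw [Finset.prod_congr rfl fun n _ => show lam n ^ (if n = j then 1 else 0) =
      if n = j then lam n else 1 by split_ifs <;> simp, Finset.prod_ite_eq']
    by_cases h : t j
    · rw [if_pos ((hS j).2 ⟨h, hj⟩), pointWeight_pos h]
    · rw [if_neg fun h' => h ((hS j).1 h').1, pointWeight_neg h]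
  unfold extWeight stepWeight
  rw [← key i hi, ← key (i + m) (by omega), ← Finset.prod_mul_distrib, ← Finset.prod_mul_distrib]
  refine Finset.prod_congr rfl fun n _ => ?_
  rw [gapCount_succ m n i, pow_add, pow_add]
  ring

end Weights

/-- A `k`-vector space with operators `x` and `y` and, for each `i`, an action of `k[z]`, such
that `x` and `y` behave as maps `Vᵢ → Vᵢ₊₁` and `Vᵢ₊₁ → Vᵢ` of `k[z]`-modules whose composites are
multiplication by `lam i * lam (i + m)`. -/
structure Chain {k : Type u} [Field k] (lam : ℤ → k[X]) (m : ℕ) (V : Type w) [AddCommGroup V]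
    [Module k V] where
  act : ℤ → k[X] →ₐ[k] Module.End k V
  x : Module.End k V
  y : Module.End k V
  x_act : ∀ i p v, x (act i p v) = act (i + 1) p (x v)
  y_act : ∀ i p v, y (act (i + 1) p v) = act i p (y v)
  y_x : ∀ i v, y (x v) = act i (lam i * lam (i + m)) v
  x_y : ∀ i v, x (y v) = act (i + 1) (lam i * lam (i + m)) v

namespace Chain

variable {k : Type u} [Field k] {lam : ℤ → k[X]} {m : ℕ} {V : Type w} [AddCommGroup V]
  [Module k V] (C : Chain lam m V)

theorem act_mul (i : ℤ) (p q : k[X]) (v : V) : C.act i (p * q) v = C.act i p (C.act i q v) := by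
  rw [map_mul]; rfl

theorem act_comm (i : ℤ) (p q : k[X]) (v : V) :
    C.act i p (C.act i q v) = C.act i q (C.act i p v) := by
  rw [← act_mul, mul_comm, act_mul]

@[simp] theorem act_one (i : ℤ) (v : V) : C.act i 1 v = v := by rw [map_one]; rfl

/-- The componentwise action of a family of polynomials on families of elements. -/
noncomputable def diag (d : ℤ → k[X]) : Module.End k (ℤ → V) where
  toFun u i := C.act i (d i) (u i)
  map_add' u v := by funext i; exact map_add _ _ _
  map_smul' c u := by funext i; exact map_smul _ _ _

@[simp] theorem diag_apply (d : ℤ → k[X]) (u : ℤ → V) (i : ℤ) :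
    C.diag d u i = C.act i (d i) (u i) := rfl

theorem diag_mul (d d' : ℤ → k[X]) (u : ℤ → V) :
    C.diag (d * d') u = C.diag d (C.diag d' u) := by
  funext i; exact C.act_mul _ _ _ _

theorem diag_one (u : ℤ → V) : C.diag 1 u = u := by
  funext i; exact C.act_one _ _

theorem diag_add (d d' : ℤ → k[X]) (u : ℤ → V) :
    C.diag (d + d') u = C.diag d u + C.diag d' u := by
  funext i
  change C.act i (d i + d' i) (u i) = _
  rw [map_add]; rfl

/-- The action of `k[z]` on families of elements. -/
noncomputable abbrev polyAct (p : k[X]) : Module.End k (ℤ → V) := C.diag fun _ => p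

theorem polyAct_mul (p q : k[X]) (u : ℤ → V) :
    C.polyAct (p * q) u = C.polyAct p (C.polyAct q u) := C.diag_mul _ _ u

theorem polyAct_add (p q : k[X]) (u : ℤ → V) :
    C.polyAct (p + q) u = C.polyAct p u + C.polyAct q u := C.diag_add _ _ u

theorem diag_comm (d d' : ℤ → k[X]) (u : ℤ → V) :
    C.diag d (C.diag d' u) = C.diag d' (C.diag d u) := by
  rw [← diag_mul, mul_comm, diag_mul]

/-- The compatible families: the homomorphisms to the chain from the chain of rank one whose
points have type `t`. -/
noncomputable def fam (t : ℤ → Prop) : Submodule k (ℤ → V) where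
  carrier := {u | ∀ i, C.x (u i) = C.act (i + 1) (stepWeight lam m t i) (u (i + 1)) ∧
    C.y (u (i + 1)) = C.act i (stepWeight lam m (fun j => ¬ t j) i) (u i)}
  add_mem' hu hv i := by simp [hu i, hv i]
  zero_mem' i := by simp
  smul_mem' c u hu i := by simp [hu i]

theorem diag_toggleWeight_mem (h0 : ∀ n, lam n ≠ 0) (hm : 0 < m) {t : ℤ → Prop} (n : ℤ)
    {u : ℤ → V} (hu : u ∈ C.fam t) : C.diag (toggleWeight lam m n t) u ∈ C.fam (toggle t n) := by
  intro i
  constructor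
  · rw [diag_apply, C.x_act, (hu i).1, diag_apply, ← act_mul, ← act_mul,
      toggleWeight_mul_stepWeight lam hm, mul_comm]
  · rw [diag_apply, C.y_act, (hu i).2, diag_apply, ← act_mul, ← act_mul,
      toggleWeight_mul_stepWeight_not h0 hm, mul_comm]

theorem polyAct_mem {t : ℤ → Prop} (p : k[X]) {u : ℤ → V} (hu : u ∈ C.fam t) :
    C.polyAct p u ∈ C.fam t := by
  intro i
  constructor
  · rw [diag_apply, C.x_act, (hu i).1, diag_apply, act_comm]
  · rw [diag_apply, C.y_act, (hu i).2, diag_apply, act_comm]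

theorem mem_of_polyAct_mem (hlam : ∀ n n', n ≠ n' → IsCoprime (lam n) (lam n')) {t : ℤ → Prop}
    {K : Submodule k (ℤ → V)} (hK : ∀ p, ∀ u ∈ K, C.polyAct p u ∈ K) {u : ℤ → V} {p q : k[X]}
    (hp : p ∈ weightMonoid lam t) (hq : q ∈ weightMonoid lam fun j => ¬ t j)
    (hpu : C.polyAct p u ∈ K) (hqu : C.polyAct q u ∈ K) : u ∈ K := by
  obtain ⟨a, b, hab⟩ := isCoprime_of_mem_weightMonoid hlam hp hq
  have : u = C.polyAct a (C.polyAct p u) + C.polyAct b (C.polyAct q u) := by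
    rw [← polyAct_mul, ← polyAct_mul, ← polyAct_add, hab]
    exact (C.diag_one u).symm
  rw [this]
  exact add_mem (hK _ _ hpu) (hK _ _ hqu)

/-! ### Extension of elements to families -/

theorem x_pow_act (j : ℕ) (i : ℤ) (p : k[X]) (v : V) :
    (C.x ^ j) (C.act i p v) = C.act (i + j) p ((C.x ^ j) v) := by
  induction j with
  | zero => simp
  | succ j ih =>
    rw [pow_succ', Module.End.mul_apply, ih, C.x_act, Module.End.mul_apply]
    push_cast
    rw [add_assoc]

theorem y_pow_act (j : ℕ) (i : ℤ) (p : k[X]) (v : V) :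
    (C.y ^ j) (C.act i p v) = C.act (i - j) p ((C.y ^ j) v) := by
  induction j with
  | zero => simp
  | succ j ih =>
    rw [pow_succ', Module.End.mul_apply, ih, Module.End.mul_apply, ← C.y_act,
      show i - ((j + 1 : ℕ) : ℤ) + 1 = i - j by push_cast; ring]

/-- The extension of an element in position `a` to a family. -/
noncomputable def ext (S : Finset ℤ) (a : ℤ) : V →ₗ[k] ℤ → V :=
  LinearMap.pi fun i =>
    if a ≤ i then C.act i (extWeight lam m S i) * C.x ^ (i - a).toNat
    else C.act i (extWeight lam m S a) * C.y ^ (a - i).toNat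

theorem ext_apply_add (S : Finset ℤ) (a : ℤ) (j : ℕ) (v : V) :
    C.ext S a v (a + j) = C.act (a + j) (extWeight lam m S (a + j)) ((C.x ^ j) v) := by
  simp [ext]

theorem ext_apply_sub (S : Finset ℤ) (a : ℤ) (j : ℕ) (v : V) :
    C.ext S a v (a - j) = C.act (a - j) (extWeight lam m S a) ((C.y ^ j) v) := by
  cases j with
  | zero => simp [ext]
  | succ j =>
    have : ¬ a ≤ a - ((j + 1 : ℕ) : ℤ) := by omega
    rw [ext, LinearMap.pi_apply, if_neg this]
    simp

theorem stepWeight_of_left {t : ℤ → Prop} {a i : ℤ} (ht : ∀ n, n < a + m → t n) (hi : i < a) :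
    stepWeight lam m (fun j => ¬ t j) i = 1 ∧ stepWeight lam m t i = lam i * lam (i + m) := by
  have h1 : t i := ht i (by omega)
  have h2 : t (i + m) := ht _ (by omega)
  constructor
  · rw [stepWeight, pointWeight_neg (not_not.2 h1), pointWeight_neg (not_not.2 h2), mul_one]
  · rw [stepWeight, pointWeight_pos h1, pointWeight_pos h2]

/-- To the right of `a` the members of a family would be quotients of `x^j v` by the factors met so
far. Multiplying in advance by all factors of type `t` ahead of `a` removes the denominators. To the
left of `a` the map `y` carries no factor, so powers of `y` do the extension. -/
theorem ext_mem {t : ℤ → Prop} {S : Finset ℤ} {a : ℤ} (ht : ∀ n, n < a + m → t n)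
    (hS : ∀ n, n ∈ S ↔ t n ∧ a ≤ n) (v : V) : C.ext S a v ∈ C.fam t := by
  intro i
  by_cases hi : a ≤ i
  · obtain ⟨j, rfl⟩ := Int.le.dest hi
    have hj : a + (j : ℤ) + 1 = a + (j + 1 : ℕ) := by push_cast; ring
    have hw := extWeight_succ lam m hS hi
    constructor
    · rw [ext_apply_add, C.x_act, hw, hj, ext_apply_add, act_mul, pow_succ']
      rfl
    · rw [hj, ext_apply_add, ext_apply_add, ← hj, C.y_act, pow_succ', Module.End.mul_apply,
        C.y_x (a + j), ← act_mul, ← act_mul, hw, ← stepWeight_mul_not lam m t]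
      congr 2
      ring
  · obtain ⟨j, hj⟩ := Int.le.dest (show i + 1 ≤ a by omega)
    obtain rfl : i = a - ((j + 1 : ℕ) : ℤ) := by push_cast; omega
    have hj : a - ((j + 1 : ℕ) : ℤ) + 1 = a - (j : ℤ) := by push_cast; ring
    obtain ⟨h1, h2⟩ := stepWeight_of_left (lam := lam) ht (not_le.1 hi)
    rw [h1, h2, hj, ext_apply_sub, ext_apply_sub, ← hj]
    constructor
    · rw [C.x_act, pow_succ', Module.End.mul_apply, C.x_y (a - ((j + 1 : ℕ) : ℤ)), act_comm]
    · rw [C.y_act, act_one, pow_succ']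
      rfl

/-- On the right, `x^j (u a)` is `u (a + j)` times the factors already met, and the extension
supplies the missing ones; on the left, `y^j (u a) = u (a - j)`. So a single member far to the left
determines the family up to a product of factors of type `t`. -/
theorem ext_apply_of_mem {t : ℤ → Prop} {S : Finset ℤ} {a : ℤ} (ht : ∀ n, n < a + m → t n)
    (hS : ∀ n, n ∈ S ↔ t n ∧ a ≤ n) {u : ℤ → V} (hu : u ∈ C.fam t) :
    C.ext S a (u a) = C.polyAct (extWeight lam m S a) u := by
  have hx : ∀ j : ℕ, ∃ q, (C.x ^ j) (u a) = C.act (a + j) q (u (a + j)) ∧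
      extWeight lam m S (a + j) * q = extWeight lam m S a := by
    intro j
    induction j with
    | zero => exact ⟨1, by simp⟩
    | succ j ih =>
      obtain ⟨q, h1, h2⟩ := ih
      have hj : a + (j : ℤ) + 1 = a + (j + 1 : ℕ) := by push_cast; ring
      refine ⟨q * stepWeight lam m t (a + j), ?_, ?_⟩
      · rw [pow_succ', Module.End.mul_apply, h1, C.x_act, (hu _).1, ← act_mul, hj]
      · rw [← h2, extWeight_succ lam m hS (show a ≤ a + j by omega), hj]
        ring
  have hy : ∀ j : ℕ, (C.y ^ j) (u a) = u (a - j) := by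
    intro j
    induction j with
    | zero => simp
    | succ j ih =>
      have hj : a - ((j + 1 : ℕ) : ℤ) + 1 = a - (j : ℤ) := by push_cast; ring
      rw [pow_succ', Module.End.mul_apply, ih, ← hj, (hu _).2,
        (stepWeight_of_left (lam := lam) ht (by push_cast; omega)).1, act_one]
  funext i
  by_cases hi : a ≤ i
  · obtain ⟨j, rfl⟩ := Int.le.dest hi
    obtain ⟨q, h1, h2⟩ := hx j
    rw [ext_apply_add, h1, ← act_mul, h2, diag_apply]
  · obtain ⟨j, hj⟩ := Int.le.dest (not_le.1 hi).le
    obtain rfl : i = a - j := by omega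
    rw [ext_apply_sub, hy, diag_apply]

theorem ext_act (S : Finset ℤ) (a : ℤ) (p : k[X]) (v : V) :
    C.ext S a (C.act a p v) = C.polyAct p (C.ext S a v) := by
  funext i
  rw [diag_apply]
  by_cases hi : a ≤ i
  · obtain ⟨j, rfl⟩ := Int.le.dest hi
    rw [ext_apply_add, ext_apply_add, x_pow_act, act_comm]
  · obtain ⟨j, hj⟩ := Int.le.dest (not_le.1 hi).le
    obtain rfl : i = a - j := by omega
    rw [ext_apply_sub, ext_apply_sub, y_pow_act, act_comm]

theorem ext_apply_mem {D : ℤ → Submodule k V} (hD : ∀ i p, ∀ v ∈ D i, C.act i p v ∈ D i)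
    (hx : ∀ i, ∀ v ∈ D i, C.x v ∈ D (i + 1)) (hy : ∀ i, ∀ v ∈ D (i + 1), C.y v ∈ D i)
    (S : Finset ℤ) {a : ℤ} {v : V} (hv : v ∈ D a) (i : ℤ) : C.ext S a v i ∈ D i := by
  by_cases hi : a ≤ i
  · obtain ⟨j, rfl⟩ := Int.le.dest hi
    rw [ext_apply_add]
    refine hD _ _ _ ?_
    induction j with
    | zero => simpa using hv
    | succ j ih =>
      rw [pow_succ', Module.End.mul_apply]
      push_cast
      rw [← add_assoc]
      exact hx _ _ (ih (by omega))
  · obtain ⟨j, hj⟩ := Int.le.dest (not_le.1 hi).le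
    obtain rfl : i = a - j := by omega
    rw [ext_apply_sub]
    refine hD _ _ _ ?_
    clear hi hj
    induction j with
    | zero => simpa using hv
    | succ j ih =>
      rw [pow_succ', Module.End.mul_apply]
      refine hy _ _ ?_
      convert ih using 2
      push_cast; ring

/-- A linear map commuting with all operators of two chains. -/
structure IsHom {V' : Type*} [AddCommGroup V'] [Module k V'] (C' : Chain lam m V')
    (f : V →ₗ[k] V') : Prop where
  act : ∀ i p v, f (C.act i p v) = C'.act i p (f v)
  x : ∀ v, f (C.x v) = C'.x (f v)
  y : ∀ v, f (C.y v) = C'.y (f v)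

variable {C} in
theorem IsHom.ext {V' : Type*} [AddCommGroup V'] [Module k V'] {C' : Chain lam m V'}
    {f : V →ₗ[k] V'} (hf : C.IsHom C' f) (S : Finset ℤ) (a : ℤ) (v : V) (i : ℤ) :
    C'.ext S a (f v) i = f (C.ext S a v i) := by
  have hx : ∀ j : ℕ, f ((C.x ^ j) v) = (C'.x ^ j) (f v) := by
    intro j
    induction j with
    | zero => rfl
    | succ j ih => rw [pow_succ', pow_succ', Module.End.mul_apply, hf.x, ih]; rfl
  have hy : ∀ j : ℕ, f ((C.y ^ j) v) = (C'.y ^ j) (f v) := by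
    intro j
    induction j with
    | zero => rfl
    | succ j ih => rw [pow_succ', pow_succ', Module.End.mul_apply, hf.y, ih]; rfl
  by_cases hi : a ≤ i
  · obtain ⟨j, rfl⟩ := Int.le.dest hi
    rw [ext_apply_add, ext_apply_add, hf.act, hx]
  · obtain ⟨j, hj⟩ := Int.le.dest (not_le.1 hi).le
    obtain rfl : i = a - j := by omega
    rw [ext_apply_sub, ext_apply_sub, hf.act, hy]

/-! ### Reflection of chains -/

/-- The chain with `x` and `y` exchanged. -/
noncomputable def reflect : Chain (fun n => lam (m - 1 - n)) m V where
  act i := C.act (-i)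
  x := C.y
  y := C.x
  x_act i p v := by
    have h := C.y_act (-(i + 1)) p v
    rwa [show -(i + 1) + 1 = -i by ring] at h
  y_act i p v := by
    have h := C.x_act (-(i + 1)) p v
    rwa [show -(i + 1) + 1 = -i by ring] at h
  y_x i v := by
    have h := C.x_y (-1 - i) v
    rw [show -1 - i + 1 = -i by ring, show -1 - i + (m : ℤ) = m - 1 - i by ring] at h
    rw [h, show (m : ℤ) - 1 - (i + m) = -1 - i by ring, mul_comm]
  x_y i v := by
    have h := C.y_x (-1 - i) v
    rw [show -1 - i + (m : ℤ) = m - 1 - i by ring] at h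
    rw [h, show (m : ℤ) - 1 - (i + m) = -1 - i by ring, mul_comm,
      show -(i + 1) = -1 - i by ring]

/-- The reflection `i ↦ -i` of positions sends the step at `i` to the step at `-1 - i`. The matching
reflection of points, `n ↦ m - 1 - n`, exchanges the two factors of a step. -/
theorem stepWeight_reflect (t : ℤ → Prop) (i : ℤ) :
    stepWeight (fun n => lam (m - 1 - n)) m (fun n => t (m - 1 - n)) i =
      stepWeight lam m t (-1 - i) := by
  have h : ∀ n, pointWeight (fun n => lam (m - 1 - n)) (fun n => t (m - 1 - n)) n =
      pointWeight lam t (m - 1 - n) := fun _ => rfl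
  rw [stepWeight, stepWeight, h, h, mul_comm, show (m : ℤ) - 1 - (i + m) = -1 - i by ring,
    show (m : ℤ) - 1 - i = -1 - i + m by ring]

/-- Exchanging `x` and `y` exchanges which of them carries a factor, so the type is complemented. A
half-line stays a half-line, and statements about the left end yield those about the right end. -/
theorem mem_fam_reflect {t : ℤ → Prop} {u : ℤ → V} :
    (fun i => u (-i)) ∈ C.reflect.fam (fun n => ¬ t (m - 1 - n)) ↔ u ∈ C.fam t := by
  have key : ∀ i, ((C.reflect.x (u (-i)) = C.reflect.act (i + 1)
      (stepWeight (fun n => lam (m - 1 - n)) m (fun n => ¬ t (m - 1 - n)) i) (u (-(i + 1))) ∧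
      C.reflect.y (u (-(i + 1))) = C.reflect.act i (stepWeight (fun n => lam (m - 1 - n)) m
        (fun n => ¬ ¬ t (m - 1 - n)) i) (u (-i))) ↔
      (C.x (u (-1 - i)) = C.act (-1 - i + 1) (stepWeight lam m t (-1 - i)) (u (-1 - i + 1)) ∧
    C.y (u (-1 - i + 1)) = C.act (-1 - i) (stepWeight lam m (fun j => ¬ t j) (-1 - i))
      (u (-1 - i)))) := by
    intro i
    rw [stepWeight_reflect (fun n => ¬ t n), stepWeight_reflect (fun n => ¬ ¬ t n)]
    simp only [not_not]
    rw [show -(i + 1) = -1 - i by ring, show -1 - i + 1 = -i by ring, and_comm]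
    change (C.x (u (-1 - i)) = C.act (-i) _ _) ∧ (C.y (u (-i)) = C.act (-(i + 1)) _ _) ↔ _
    rw [show -(i + 1) = -1 - i by ring]
  constructor
  · intro h i
    have := (key (-1 - i)).1 (h (-1 - i))
    rwa [show -1 - (-1 - i) = i by ring] at this
  · intro h i
    exact (key i).2 (h (-1 - i))

/-- The extension of an element in position `b` to a family, from the right. -/
noncomputable def coext (S : Finset ℤ) (b : ℤ) : V →ₗ[k] ℤ → V :=
  LinearMap.funLeft k V (fun i : ℤ => -i) ∘ₗ C.reflect.ext S (-b)

theorem coext_apply (S : Finset ℤ) (b : ℤ) (v : V) (i : ℤ) :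
    C.coext S b v i = C.reflect.ext S (-b) v (-i) := rfl

/-- The factors of the extension from the right, for a set of points given in reflected
coordinates. -/
noncomputable def coextWeight (lam : ℤ → k[X]) (m : ℕ) (S : Finset ℤ) (b : ℤ) : k[X] :=
  extWeight (fun n => lam (m - 1 - n)) m S (-b)

theorem coext_mem {t : ℤ → Prop} {S : Finset ℤ} {b : ℤ} (ht : ∀ n, b ≤ n → ¬ t n)
    (hS : ∀ n, n ∈ S ↔ ¬ t (m - 1 - n) ∧ -b ≤ n) (v : V) : C.coext S b v ∈ C.fam t := by
  rw [← mem_fam_reflect]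
  have := C.reflect.ext_mem (t := fun n => ¬ t (m - 1 - n)) (a := -b)
    (fun n hn => ht _ (by omega)) hS v
  convert this using 1
  funext i
  rw [coext_apply, neg_neg]

theorem coext_apply_of_mem {t : ℤ → Prop} {S : Finset ℤ} {b : ℤ} (ht : ∀ n, b ≤ n → ¬ t n)
    (hS : ∀ n, n ∈ S ↔ ¬ t (m - 1 - n) ∧ -b ≤ n) {u : ℤ → V} (hu : u ∈ C.fam t) :
    C.coext S b (u b) = C.polyAct (coextWeight lam m S b) u := by
  have := C.reflect.ext_apply_of_mem (t := fun n => ¬ t (m - 1 - n)) (a := -b)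
    (fun n hn => ht _ (by omega)) hS (C.mem_fam_reflect.2 hu)
  funext i
  rw [coext_apply]
  have h := congrFun this (-i)
  simp only [neg_neg] at h
  rw [h]
  change C.act (- -i) _ (u (- -i)) = _
  rw [neg_neg]; rfl

theorem coext_act (S : Finset ℤ) (b : ℤ) (p : k[X]) (v : V) :
    C.coext S b (C.act b p v) = C.polyAct p (C.coext S b v) := by
  funext i
  have := congrFun (C.reflect.ext_act S (-b) p v) (-i)
  change C.reflect.ext S (-b) (C.act (- -b) p v) (-i) = C.act (- -i) _ _ at this
  rwa [neg_neg, neg_neg] at this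

theorem coext_apply_mem {D : ℤ → Submodule k V} (hD : ∀ i p, ∀ v ∈ D i, C.act i p v ∈ D i)
    (hx : ∀ i, ∀ v ∈ D i, C.x v ∈ D (i + 1)) (hy : ∀ i, ∀ v ∈ D (i + 1), C.y v ∈ D i)
    (S : Finset ℤ) {b : ℤ} {v : V} (hv : v ∈ D b) (i : ℤ) : C.coext S b v i ∈ D i := by
  have := C.reflect.ext_apply_mem (D := fun i => D (-i)) (fun i p v hv => hD (-i) p v hv)
    (fun i v hv => hy _ _ (by rwa [show -(i + 1) + 1 = -i by ring]))
    (fun i v hv => by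
      have := hx _ _ hv
      rwa [show -(i + 1) + 1 = -i by ring] at this) S (a := -b) (v := v) (by rwa [neg_neg]) (-i)
  rwa [neg_neg] at this

variable {C} in
theorem IsHom.coext {V' : Type*} [AddCommGroup V'] [Module k V'] {C' : Chain lam m V'}
    {f : V →ₗ[k] V'} (hf : C.IsHom C' f) (S : Finset ℤ) (b : ℤ) (v : V) (i : ℤ) :
    C'.coext S b (f v) i = f (C.coext S b v i) :=
  IsHom.ext (C := C.reflect) (C' := C'.reflect) ⟨fun i => hf.act (-i), hf.y, hf.x⟩ S (-b) v (-i)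

theorem coextWeight_mem {S : Finset ℤ} {t : ℤ → Prop} (hS : ∀ n ∈ S, ¬ t (m - 1 - n)) (b : ℤ) :
    coextWeight lam m S b ∈ weightMonoid lam fun j => ¬ t j :=
  Submonoid.prod_mem _ fun n hn =>
    Submonoid.pow_mem _ (lam_mem_weightMonoid (t := fun j => ¬ t j) lam (hS n hn)) _

theorem _root_.IsHalfLine.exists_left {t : ℤ → Prop} (h : IsHalfLine t) (m : ℕ) (a₀ : ℤ) :
    ∃ a ≤ a₀, ∃ S : Finset ℤ, (∀ n, n < a + m → t n) ∧ ∀ n, n ∈ S ↔ t n ∧ a ≤ n := by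
  classical
  obtain ⟨N, hN⟩ := h
  -- The additional `-m` turns `n < a + m` into `n < -N`.
  refine ⟨min a₀ (-N - m), min_le_left _ _, (Finset.Ico (min a₀ (-N - m)) N).filter t, ?_, ?_⟩
  · exact fun n hn => (hN n).1 (by omega)
  · intro n
    rw [Finset.mem_filter, Finset.mem_Ico]
    refine ⟨fun h => ⟨h.2, h.1.1⟩, fun h => ⟨⟨h.2, ?_⟩, h.1⟩⟩
    by_contra h'
    exact (hN n).2 (not_lt.1 h') h.1

theorem _root_.IsHalfLine.exists_right {t : ℤ → Prop} (h : IsHalfLine t) (m : ℕ) (b₀ : ℤ) :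
    ∃ b, b₀ ≤ b ∧ ∃ S : Finset ℤ, (∀ n, b ≤ n → ¬ t n) ∧
      ∀ n, n ∈ S ↔ ¬ t (m - 1 - n) ∧ -b ≤ n := by
  classical
  obtain ⟨N, hN⟩ := h
  refine ⟨max b₀ N, le_max_left _ _,
    (Finset.Icc (-max b₀ N) (m - 1 + N)).filter fun n => ¬ t (m - 1 - n), ?_, ?_⟩
  · exact fun n hn => (hN n).2 (by omega)
  · intro n
    rw [Finset.mem_filter, Finset.mem_Icc]
    refine ⟨fun h => ⟨h.2, h.1.1⟩, fun h => ⟨⟨h.2, ?_⟩, h.1⟩⟩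
    by_contra h'
    exact h.1 ((hN _).1 (by omega))

/-- A zero member far to the left gives an annihilator which is a product of factors of type `t`; a
zero member far to the right gives one without such factors. The two are coprime. -/
theorem eq_zero_of_vanish (hlam : ∀ n n', n ≠ n' → IsCoprime (lam n) (lam n')) {t : ℤ → Prop}
    (ht : IsHalfLine t) {u : ℤ → V} (hu : u ∈ C.fam t) {a₀ b₀ : ℤ} (ha : ∀ i ≤ a₀, u i = 0)
    (hb : ∀ i, b₀ ≤ i → u i = 0) : u = 0 := by
  obtain ⟨a, ha', S, h1, h2⟩ := ht.exists_left m a₀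
  obtain ⟨b, hb', S', h1', h2'⟩ := ht.exists_right m b₀
  rw [← Submodule.mem_bot k]
  refine C.mem_of_polyAct_mem hlam (t := t) (K := ⊥) ?_
    (extWeight_mem lam m (fun n hn => ((h2 n).1 hn).1) a)
    (coextWeight_mem (fun n hn => ((h2' n).1 hn).1) b) ?_ ?_
  · rintro p _ rfl; exact map_zero _
  · rw [← C.ext_apply_of_mem h1 h2 hu, ha a ha', map_zero]; rfl
  · rw [← C.coext_apply_of_mem h1' h2' hu, hb b hb', map_zero]; rfl

end Chain

/-! ### Types of points attached to finite sets -/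

/-- The type of the point `n` in the chain of rank one attached to `J`. -/
def ptype (J : ZFin) (n : ℤ) : Prop := ¬ (n < 0 ↔ n ∈ ofBoolRing J)

theorem mem_ofBoolRing_add (I J : ZFin) (n : ℤ) :
    n ∈ ofBoolRing (I + J) ↔ ¬ (n ∈ ofBoolRing I ↔ n ∈ ofBoolRing J) := by
  change n ∈ symmDiff (ofBoolRing I) (ofBoolRing J) ↔ _
  rw [Finset.mem_symmDiff]
  tauto

theorem mem_ofBoolRing_genDeg (n j : ℤ) : j ∈ ofBoolRing (BRing.genDeg (some n)) ↔ j = n := by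
  change j ∈ ({n} : Finset ℤ) ↔ _
  rw [Finset.mem_singleton]

theorem zfin_ext {I J : ZFin} (h : ∀ n, n ∈ ofBoolRing I ↔ n ∈ ofBoolRing J) : I = J :=
  ofBoolRing_inj.1 (Finset.ext h)

theorem ptype_add_genDeg (J : ZFin) (n : ℤ) :
    ptype (J + BRing.genDeg (some n)) = toggle (ptype J) n := by
  funext j
  rw [ptype, mem_ofBoolRing_add, mem_ofBoolRing_genDeg, toggle, ptype]
  split_ifs with h
  · simp only [h, iff_true, eq_iff_iff]; tauto
  · simp only [h, iff_false, eq_iff_iff]; tauto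

theorem isHalfLine_ptype (J : ZFin) : IsHalfLine (ptype J) := by
  obtain ⟨N, hN⟩ : ∃ N : ℕ, ∀ n ∈ ofBoolRing J, n.natAbs < N :=
    ⟨(ofBoolRing J).sup Int.natAbs + 1, fun n hn =>
      Nat.lt_succ_of_le (Finset.le_sup (f := Int.natAbs) hn)⟩
  refine ⟨N, fun n => ⟨fun hn h => ?_, fun hn h => ?_⟩⟩
  · have := hN n (h.1 (by omega))
    omega
  · refine h ⟨fun h => by omega, fun h' => ?_⟩
    have := hN n h'
    omega

theorem exists_ptype_iff_lt (d : ℤ) : ∃ J : ZFin, ∀ n, ptype J n ↔ n < d := by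
  classical
  refine ⟨toBoolRing (Finset.Ico 0 d ∪ Finset.Ico d 0), fun n => ?_⟩
  rw [ptype, ofBoolRing_toBoolRing, Finset.mem_union, Finset.mem_Ico, Finset.mem_Ico]
  omega

theorem ptype_iff_not_of_mem_add {I J : ZFin} {n : ℤ} (h : n ∈ ofBoolRing (I + J)) :
    ptype I n ↔ ¬ ptype J n := by
  rw [mem_ofBoolRing_add] at h
  unfold ptype
  tauto

/-! ### Systems of families stable under polynomials and changes of type -/

namespace Chain

variable {k : Type u} [Field k] {lam : ℤ → k[X]} {m : ℕ} {V : Type w} [AddCommGroup V]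
  [Module k V] (C : Chain lam m V)

/-- The points at which the types differ are toggled one at a time. At the position `a`, a point
which gains the type costs a power of a factor of type `ptype J`. A point which loses it satisfies
`n ≥ a + m`, so both of its gaps are ahead of `a` and the weight is `1`. -/
theorem exists_polyAct_mem_left {K : ZFin → Submodule k (ℤ → V)}
    (hKb : ∀ J n, ∀ u ∈ K J, C.diag (toggleWeight lam m n (ptype J)) u ∈
      K (J + BRing.genDeg (some n)))
    (J : ZFin) {a : ℤ} (ha : ∀ n, n < a + m → ptype J n) (D : Finset ℤ) :
    ∀ J' : ZFin, ofBoolRing (J + J') = D → ∀ v ∈ K J',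
      ∃ p ∈ weightMonoid lam (ptype J), ∃ v' ∈ K J, v' a = C.act a p (v a) := by
  induction D using Finset.induction_on with
  | empty =>
    intro J' hJ v hv
    obtain rfl : J = J' := zfin_ext fun n => by
      have := mem_ofBoolRing_add J J' n
      rw [hJ] at this
      simpa using this
    exact ⟨1, one_mem _, v, hv, by simp⟩
  | insert n D hn ih =>
    intro J' hJ v hv
    have hn' : n ∈ ofBoolRing (J + J') := hJ ▸ Finset.mem_insert_self n D
    have htype := ptype_iff_not_of_mem_add hn'
    obtain ⟨p, hp, v', hv', h⟩ := ih (J' + BRing.genDeg (some n)) (by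
      ext j
      have := mem_ofBoolRing_add (J + J') (BRing.genDeg (some n)) j
      rw [hJ, mem_ofBoolRing_genDeg, add_assoc] at this
      rw [this, Finset.mem_insert]
      by_cases h : j = n
      · subst h; simp [hn]
      · simp [h]) _ (hKb J' n v hv)
    refine ⟨p * toggleWeight lam m n (ptype J') a, mul_mem hp ?_, v', hv', ?_⟩
    · by_cases h : ptype J' n
      · have h1 : ¬ ptype J n := by tauto
        have h2 : ¬ n < a + m := fun h => h1 (ha n h)
        have : gapCount m n a = 2 := by unfold gapCount; split_ifs <;> omega
        rw [toggleWeight_pos h, this]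
        exact one_mem _
      · rw [toggleWeight_neg h]
        exact pow_mem (lam_mem_weightMonoid lam (htype.2 h)) _
    · rw [h, act_mul]; rfl

/-- Same toggling seen from the right end: a point which gains the type lies to the left of `b`, so
it has no gap ahead and weight `1`; a point which loses it contributes a factor not of type `ptype
J`. -/
theorem exists_polyAct_mem_right {K : ZFin → Submodule k (ℤ → V)}
    (hKb : ∀ J n, ∀ u ∈ K J, C.diag (toggleWeight lam m n (ptype J)) u ∈
      K (J + BRing.genDeg (some n)))
    (J : ZFin) {b : ℤ} (hb : ∀ n, b ≤ n → ¬ ptype J n) (D : Finset ℤ) :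
    ∀ J' : ZFin, ofBoolRing (J + J') = D → ∀ v ∈ K J',
      ∃ p ∈ weightMonoid lam (fun n => ¬ ptype J n), ∃ v' ∈ K J, v' b = C.act b p (v b) := by
  induction D using Finset.induction_on with
  | empty =>
    intro J' hJ v hv
    obtain rfl : J = J' := zfin_ext fun n => by
      have := mem_ofBoolRing_add J J' n
      rw [hJ] at this
      simpa using this
    exact ⟨1, one_mem _, v, hv, by simp⟩
  | insert n D hn ih =>
    intro J' hJ v hv
    have hn' : n ∈ ofBoolRing (J + J') := hJ ▸ Finset.mem_insert_self n D
    have htype := ptype_iff_not_of_mem_add hn'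
    obtain ⟨p, hp, v', hv', h⟩ := ih (J' + BRing.genDeg (some n)) (by
      ext j
      have := mem_ofBoolRing_add (J + J') (BRing.genDeg (some n)) j
      rw [hJ, mem_ofBoolRing_genDeg, add_assoc] at this
      rw [this, Finset.mem_insert]
      by_cases h : j = n
      · subst h; simp [hn]
      · simp [h]) _ (hKb J' n v hv)
    refine ⟨p * toggleWeight lam m n (ptype J') b, mul_mem hp ?_, v', hv', ?_⟩
    · by_cases h : ptype J' n
      · rw [toggleWeight_pos h]
        exact pow_mem (lam_mem_weightMonoid (t := fun n => ¬ ptype J n) lam (by tauto)) _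
      · have h2 : ¬ b ≤ n := fun h' => hb n h' (htype.2 h)
        have : gapCount m n b = 0 := by unfold gapCount; split_ifs <;> omega
        rw [toggleWeight_neg h, this]
        exact one_mem _
    · rw [h, act_mul]; rfl

/-- For a sum, the product of the multipliers works for both summands; this is why multipliers are
taken in a submonoid. -/
theorem exists_polyAct_ext_mem {K : Submodule k (ℤ → V)} (hK : ∀ p, ∀ u ∈ K, C.polyAct p u ∈ K)
    (P : Submonoid k[X]) (E : V →ₗ[k] ℤ → V) {ι : Type*} (T : ι → Submodule k V)
    (hT : ∀ j, ∀ v ∈ T j, ∃ p ∈ P, C.polyAct p (E v) ∈ K) {v : V} (hv : v ∈ ⨆ j, T j) :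
    ∃ p ∈ P, C.polyAct p (E v) ∈ K := by
  induction hv using Submodule.iSup_induction' with
  | mem j v hv => exact hT j v hv
  | zero => exact ⟨1, one_mem _, by rw [map_zero, map_zero]; exact zero_mem _⟩
  | add v w _ _ hv hw =>
    obtain ⟨p, hp, hp'⟩ := hv
    obtain ⟨q, hq, hq'⟩ := hw
    refine ⟨p * q, mul_mem hp hq, ?_⟩
    rw [map_add, map_add]
    refine add_mem ?_ ?_
    · rw [mul_comm, polyAct_mul]; exact hK _ _ hp'
    · rw [polyAct_mul]; exact hK _ _ hq'

/-- The member `u a` is a sum of members of families in the system. After multiplication by factors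
of type `ptype J`, each summand is the member at `a` of a family in `K J`, whose extension is a
multiple of that family. The extension of `u a` itself is a multiple of `u`. -/
theorem exists_mem_polyAct_left
    {K : ZFin → Submodule k (ℤ → V)} (hKt : ∀ J, K J ≤ C.fam (ptype J))
    (hKp : ∀ J p, ∀ u ∈ K J, C.polyAct p u ∈ K J)
    (hKb : ∀ J n, ∀ u ∈ K J, C.diag (toggleWeight lam m n (ptype J)) u ∈
      K (J + BRing.genDeg (some n)))
    {J : ZFin} {u : ℤ → V} (hu : u ∈ C.fam (ptype J)) {a₀ : ℤ}
    (ha : ∀ i ≤ a₀, u i ∈ ⨆ J', (K J').map (LinearMap.proj i)) :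
    ∃ p ∈ weightMonoid lam (ptype J), C.polyAct p u ∈ K J := by
  obtain ⟨a, ha', S, h1, h2⟩ := (isHalfLine_ptype J).exists_left m a₀
  have key : ∀ J', ∀ v ∈ (K J').map (LinearMap.proj a),
      ∃ p ∈ weightMonoid lam (ptype J), C.polyAct p (C.ext S a v) ∈ K J := by
    rintro J' _ ⟨v, hv, rfl⟩
    obtain ⟨p, hp, v', hv', h⟩ := C.exists_polyAct_mem_left hKb J h1 _ J' rfl v hv
    refine ⟨p, hp, ?_⟩
    rw [← C.ext_act]
    change C.ext S a (C.act a p (v a)) ∈ _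
    rw [← h, C.ext_apply_of_mem h1 h2 (hKt _ hv')]
    exact hKp _ _ _ hv'
  obtain ⟨p, hp, hpu⟩ := C.exists_polyAct_ext_mem (hKp J) _ _ _ key (ha a ha')
  rw [C.ext_apply_of_mem h1 h2 hu, ← polyAct_mul] at hpu
  exact ⟨_, mul_mem hp (extWeight_mem lam m (fun n hn => ((h2 n).1 hn).1) a), hpu⟩

theorem exists_mem_polyAct_right
    {K : ZFin → Submodule k (ℤ → V)} (hKt : ∀ J, K J ≤ C.fam (ptype J))
    (hKp : ∀ J p, ∀ u ∈ K J, C.polyAct p u ∈ K J)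
    (hKb : ∀ J n, ∀ u ∈ K J, C.diag (toggleWeight lam m n (ptype J)) u ∈
      K (J + BRing.genDeg (some n)))
    {J : ZFin} {u : ℤ → V} (hu : u ∈ C.fam (ptype J)) {b₀ : ℤ}
    (hb : ∀ i, b₀ ≤ i → u i ∈ ⨆ J', (K J').map (LinearMap.proj i)) :
    ∃ p ∈ weightMonoid lam (fun n => ¬ ptype J n), C.polyAct p u ∈ K J := by
  obtain ⟨b, hb', S', h1', h2'⟩ := (isHalfLine_ptype J).exists_right m b₀
  have key : ∀ J', ∀ v ∈ (K J').map (LinearMap.proj b),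
      ∃ p ∈ weightMonoid lam (fun n => ¬ ptype J n), C.polyAct p (C.coext S' b v) ∈ K J := by
    rintro J' _ ⟨v, hv, rfl⟩
    obtain ⟨p, hp, v', hv', h⟩ := C.exists_polyAct_mem_right hKb J h1' _ J' rfl v hv
    refine ⟨p, hp, ?_⟩
    rw [← C.coext_act]
    change C.coext S' b (C.act b p (v b)) ∈ _
    rw [← h, C.coext_apply_of_mem h1' h2' (hKt _ hv')]
    exact hKp _ _ _ hv'
  obtain ⟨p, hp, hpu⟩ := C.exists_polyAct_ext_mem (hKp J) _ _ _ key (hb b hb')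
  rw [C.coext_apply_of_mem h1' h2' hu, ← polyAct_mul] at hpu
  exact ⟨_, mul_mem hp (coextWeight_mem (fun n hn => ((h2' n).1 hn).1) b), hpu⟩

/-- A compatible family whose members far to the left and far to the right are sums of members of
families from a stable system belongs to the system. -/
theorem mem_of_eventually_mem_iSup (hlam : ∀ n n', n ≠ n' → IsCoprime (lam n) (lam n'))
    {K : ZFin → Submodule k (ℤ → V)} (hKt : ∀ J, K J ≤ C.fam (ptype J))
    (hKp : ∀ J p, ∀ u ∈ K J, C.polyAct p u ∈ K J)
    (hKb : ∀ J n, ∀ u ∈ K J, C.diag (toggleWeight lam m n (ptype J)) u ∈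
      K (J + BRing.genDeg (some n)))
    {J : ZFin} {u : ℤ → V} (hu : u ∈ C.fam (ptype J)) {a₀ b₀ : ℤ}
    (ha : ∀ i ≤ a₀, u i ∈ ⨆ J', (K J').map (LinearMap.proj i))
    (hb : ∀ i, b₀ ≤ i → u i ∈ ⨆ J', (K J').map (LinearMap.proj i)) : u ∈ K J := by
  obtain ⟨p, hp, hpu⟩ := C.exists_mem_polyAct_left hKt hKp hKb hu ha
  obtain ⟨q, hq, hqu⟩ := C.exists_mem_polyAct_right hKt hKp hKb hu hb
  exact C.mem_of_polyAct_mem hlam (hKp J) hp hq hpu hqu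

end Chain

/-! ### Modules given by operators -/

section Generators

variable {k : Type u} [Field k] {R : Type u} [Ring R] [Algebra k R] {ι : Type*} {g : ι → R}
  {V : Type u} [AddCommGroup V] [Module k V]

theorem rep_mem_of_gen (ρ : Rᵐᵒᵖ →ₐ[k] Module.End k V) (hg : Algebra.adjoin k (Set.range g) = ⊤)
    (N : Submodule k V) (hN : ∀ i, ∀ v ∈ N, ρ (MulOpposite.op (g i)) v ∈ N) (r : R) {v : V}
    (hv : v ∈ N) : ρ (MulOpposite.op r) v ∈ N := by
  have hr : r ∈ Algebra.adjoin k (Set.range g) := hg ▸ Algebra.mem_top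
  induction hr using Algebra.adjoin_induction generalizing v with
  | mem r h => obtain ⟨i, rfl⟩ := h; exact hN i v hv
  | algebraMap c =>
    rw [← MulOpposite.algebraMap_apply, AlgHom.commutes]
    exact N.smul_mem c hv
  | add r s _ _ hr hs => rw [MulOpposite.op_add, map_add]; exact add_mem (hr hv) (hs hv)
  | mul r s _ _ hr hs => rw [MulOpposite.op_mul, map_mul]; exact hs (hr hv)

theorem rep_mem_deg_of_gen (ρ : Rᵐᵒᵖ →ₐ[k] Module.End k V) {Γ : Type*} [AddCommGroup Γ] {d : ι → Γ}
    (D : Γ → Submodule k V)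
    (hD : ∀ i γ, ∀ v ∈ D γ, ρ (MulOpposite.op (g i)) v ∈ D (γ + d i)) {γ δ : Γ} {v : V} {a : R}
    (hv : v ∈ D γ) (ha : a ∈ wordGrading k g d δ) : ρ (MulOpposite.op a) v ∈ D (γ + δ) := by
  induction ha using Submodule.span_induction with
  | mem a h =>
    obtain ⟨l, rfl, rfl⟩ := h
    induction l generalizing γ v with
    | nil => simpa using hv
    | cons i l ih =>
      simp only [List.map_cons, List.prod_cons, List.sum_cons]
      rw [MulOpposite.op_mul, map_mul, ← add_assoc]
      exact ih (hD i γ v hv)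
  | zero => rw [MulOpposite.op_zero, map_zero]; exact zero_mem _
  | add a b _ _ ha hb => rw [MulOpposite.op_add, map_add]; exact add_mem ha hb
  | smul c a _ ha => rw [MulOpposite.op_smul, map_smul]; exact Submodule.smul_mem _ _ ha

variable [Module Rᵐᵒᵖ V] [IsScalarTower k Rᵐᵒᵖ V]

theorem smul_mem_of_gen (hg : Algebra.adjoin k (Set.range g) = ⊤) (N : Submodule k V)
    (hN : ∀ i, ∀ v ∈ N, MulOpposite.op (g i) • v ∈ N) (r : R) {v : V} (hv : v ∈ N) :
    MulOpposite.op r • v ∈ N :=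
  rep_mem_of_gen (Algebra.lsmul k k V) hg N hN r hv

theorem map_smul_of_gen {V' : Type u} [AddCommGroup V'] [Module k V'] [Module Rᵐᵒᵖ V']
    [IsScalarTower k Rᵐᵒᵖ V'] (hg : Algebra.adjoin k (Set.range g) = ⊤) (f : V →ₗ[k] V')
    (hf : ∀ i v, f (MulOpposite.op (g i) • v) = MulOpposite.op (g i) • f v) (r : R) (v : V) :
    f (MulOpposite.op r • v) = MulOpposite.op r • f v := by
  have hr : r ∈ Algebra.adjoin k (Set.range g) := hg ▸ Algebra.mem_top
  induction hr using Algebra.adjoin_induction generalizing v with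
  | mem r h => obtain ⟨i, rfl⟩ := h; exact hf i v
  | algebraMap c =>
    rw [← MulOpposite.algebraMap_apply, algebraMap_smul, algebraMap_smul, map_smul]
  | add r s _ _ hr hs => rw [MulOpposite.op_add, add_smul, add_smul, map_add, hr, hs]
  | mul r s _ _ hr hs => rw [MulOpposite.op_mul, mul_smul, mul_smul, hs, hr]

end Generators

namespace GrMod

variable {k : Type u} [Field k] {Γ : Type w} [AddCommGroup Γ] [DecidableEq Γ]
  {R : Type u} [Ring R] [Algebra k R] {𝒜 : Γ → Submodule k R} [GradedAlgebra 𝒜]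

theorem ext_of_deg {M : GrMod 𝒜} {T : Type*} [AddCommGroup T] [Module k T]
    {f g : M.carrier →ₗ[k] T} (h : ∀ γ, ∀ v ∈ M.deg γ, f v = g v) : f = g := by
  have : (⊤ : Submodule k M.carrier) ≤ LinearMap.eqLocus f g := by
    rw [← M.iSup_deg]
    exact iSup_le h
  ext v
  exact this (Submodule.mem_top (x := v))

/-- Only the degrees of the inverse need an argument: `f` commutes with the projections to the
components, so the preimage of a homogeneous element equals its own projection. -/
theorem isIso_of_bijective {M N : GrMod 𝒜} (f : M ⟶ N) (hf : Function.Bijective f.hom) :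
    IsIso f := by
  let e := LinearEquiv.ofBijective f.hom hf
  have he : ∀ n, f.hom (e.symm n) = n := fun n => e.apply_symm_apply n
  have hmem : ∀ {γ : Γ} {n : N.carrier}, n ∈ N.deg γ → e.symm n ∈ M.deg γ := by
    intro γ n hn
    obtain ⟨p, hpm, hp, hp'⟩ := M.exists_proj
    obtain ⟨p', q, hq, hq', hc⟩ := exists_proj_commute f
    obtain ⟨q₀, -, hq₀, hq₀'⟩ := N.exists_proj
    have key : (q₀ γ) ∘ₗ f.hom.restrictScalars k = f.hom.restrictScalars k ∘ₗ p γ := by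
      refine ext_of_deg fun δ v hv => ?_
      change q₀ γ (f.hom v) = f.hom (p γ v)
      by_cases h : δ = γ
      · subst h
        rw [hp _ v hv, hq₀ _ _ (f.map_mem hv)]
      · rw [hp' _ _ h v hv, hq₀' _ _ h _ (f.map_mem hv), map_zero]
    have h := LinearMap.congr_fun key (e.symm n)
    change q₀ γ (f.hom (e.symm n)) = f.hom (p γ (e.symm n)) at h
    rw [he, hq₀ _ _ hn] at h
    rw [hf.1 ((he n).trans h)]
    exact hpm _ _
  refine ⟨Hom.mk e.symm.toLinearMap hmem, ?_, ?_⟩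
  · ext m
    exact e.symm_apply_apply m
  · ext n
    exact he n

theorem bijective_of_isIso {M N : GrMod 𝒜} (f : M ⟶ N) [IsIso f] : Function.Bijective f.hom := by
  refine Function.bijective_iff_has_inverse.2 ⟨(inv f).hom, fun m => ?_, fun n => ?_⟩
  · exact congrArg (fun g : M ⟶ M => g.hom m) (IsIso.hom_inv_id f)
  · exact congrArg (fun g : N ⟶ N => g.hom n) (IsIso.inv_hom_id f)

/-- A finitely generated graded module is generated by finitely many homogeneous elements. -/
theorem exists_homogeneous_generators (M : GrMod 𝒜) : ∃ s : Finset M.carrier,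
    (∀ v ∈ s, ∃ γ, v ∈ M.deg γ) ∧ Submodule.span Rᵐᵒᵖ (s : Set M.carrier) = ⊤ := by
  classical
  obtain ⟨s, hs⟩ := M.finite.fg_top
  let D := M.isInternal.chooseDecomposition
  let s' : Finset M.carrier := s.biUnion fun v =>
    (DirectSum.decompose M.deg v).support.image fun γ => (DirectSum.decompose M.deg v γ : M.carrier)
  refine ⟨s', ?_, ?_⟩
  · intro v hv
    obtain ⟨w, -, hw⟩ := Finset.mem_biUnion.1 hv
    obtain ⟨γ, -, rfl⟩ := Finset.mem_image.1 hw
    exact ⟨γ, Submodule.coe_mem _⟩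
  · rw [eq_top_iff, ← hs, Submodule.span_le]
    intro v hv
    rw [← DirectSum.sum_support_decompose M.deg v]
    refine Submodule.sum_mem _ fun γ hγ => Submodule.subset_span ?_
    exact Finset.mem_biUnion.2 ⟨v, hv, Finset.mem_image.2 ⟨γ, hγ, rfl⟩⟩

/-- A homomorphism given by a linear map which commutes with generators. -/
def homOfGen {ι : Type*} {g : ι → R} (hg : Algebra.adjoin k (Set.range g) = ⊤) {M N : GrMod 𝒜}
    (f : M.carrier →ₗ[k] N.carrier)
    (hf : ∀ i v, f (MulOpposite.op (g i) • v) = MulOpposite.op (g i) • f v)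
    (hmem : ∀ {γ : Γ} {v : M.carrier}, v ∈ M.deg γ → f v ∈ N.deg γ) : M ⟶ N :=
  Hom.mk
    { toFun := f
      map_add' := map_add f
      map_smul' := fun r v => map_smul_of_gen hg f hf r.unop v } hmem

/-- The graded module given by a representation. -/
def ofRep (V : Type u) [AddCommGroup V] [Module k V] (ρ : Rᵐᵒᵖ →ₐ[k] Module.End k V)
    (D : Γ → Submodule k V) (hD : DirectSum.IsInternal D)
    (hsmul : ∀ {γ δ : Γ} {v : V} {a : R}, v ∈ D γ → a ∈ 𝒜 δ → ρ (MulOpposite.op a) v ∈ D (γ + δ))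
    (hfin : ∃ s : Finset V, ∀ N : Submodule k V, (∀ r, ∀ v ∈ N, ρ r v ∈ N) → (∀ v ∈ s, v ∈ N) →
      N = ⊤) : GrMod 𝒜 :=
  letI : Module Rᵐᵒᵖ V := Module.compHom V ρ.toRingHom
  haveI : IsScalarTower k Rᵐᵒᵖ V := ⟨fun c r v => by
    change ρ (c • r) v = c • ρ r v
    rw [map_smul]; rfl⟩
  { carrier := V
    deg := D
    isInternal := hD
    smul_mem := hsmul
    finite := by
      obtain ⟨s, hs⟩ := hfin
      refine ⟨⟨s, ?_⟩⟩
      have := hs ((Submodule.span Rᵐᵒᵖ (s : Set V)).restrictScalars k)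
        (fun r v hv => (Submodule.span Rᵐᵒᵖ (s : Set V)).smul_mem r hv)
        (fun v hv => Submodule.subset_span hv)
      rw [eq_top_iff]
      intro v _
      exact this.ge (Submodule.mem_top (x := v)) }

end GrMod

namespace BRing

variable {k : Type u} [Field k]

/-- Representations of `B` are given by commuting operators `Z` and `b n` with
`(b n)² = (Z + n)²`. -/
theorem exists_rep {E : Type*} [Ring E] [Algebra k E] (Z : E) (b : ℤ → E)
    (hZb : ∀ n, Z * b n = b n * Z) (hbb : ∀ n n', b n * b n' = b n' * b n)
    (hb : ∀ n, b n * b n = aeval Z ((X + C (n : k)) ^ 2)) :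
    ∃ ρ : BRing k →ₐ[k] E, ρ (gen k none) = Z ∧ ∀ n, ρ (gen k (some n)) = b n := by
  have hcomm : ∀ x ∈ insert Z (Set.range b), ∀ y ∈ insert Z (Set.range b), x * y = y * x := by
    rintro x (rfl | ⟨n, rfl⟩) y (rfl | ⟨n', rfl⟩)
    · rfl
    · exact hZb _
    · exact (hZb _).symm
    · exact hbb _ _
  -- The universal property of polynomial rings needs a commutative target; the subalgebra generated
  -- by the commuting operators provides one inside `E`.
  let S := Algebra.adjoin k (insert Z (Set.range b))
  have : IsMulCommutative S := Algebra.isMulCommutative_adjoin k hcomm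
  let Z' : S := ⟨Z, Algebra.subset_adjoin (Set.mem_insert _ _)⟩
  let b' : ℤ → S := fun n => ⟨b n, Algebra.subset_adjoin (Set.mem_insert_of_mem _ ⟨n, rfl⟩)⟩
  let inst : CommRing S := { (inferInstance : Ring S) with mul_comm := fun a b => mul_comm' a b }
  let ψ : MvPolynomial ℤ k[X] →ₐ[k] S :=
    { MvPolynomial.eval₂Hom (aeval (R := k) Z').toRingHom b' with
      commutes' := fun c => by
        change MvPolynomial.eval₂Hom _ _ (MvPolynomial.C (C c)) = _
        rw [MvPolynomial.eval₂Hom_C]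
        exact aeval_C _ c }
  have hψC : ∀ p, ψ (MvPolynomial.C p) = aeval Z' p := fun p => MvPolynomial.eval₂Hom_C _ _ p
  have hψX : ∀ n, ψ (MvPolynomial.X n) = b' n := fun n => MvPolynomial.eval₂Hom_X' _ _ n
  have hZ' : ∀ p : k[X], ((aeval Z' p : S) : E) = aeval Z p := fun p =>
    (Polynomial.aeval_algHom_apply S.val Z' p).symm
  have hker : ∀ a ∈ Ideal.span (Set.range fun n : ℤ => (MvPolynomial.X n ^ 2 -
      MvPolynomial.C ((X + C (n : k)) ^ 2) : MvPolynomial ℤ k[X])), ψ a = 0 := by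
    intro a ha
    induction ha using Submodule.span_induction with
    | mem a h =>
      obtain ⟨n, rfl⟩ := h
      rw [map_sub, map_pow, hψC, hψX, sub_eq_zero]
      refine Subtype.ext ?_
      rw [hZ', ← hb, pow_two]
      rfl
    | zero => exact map_zero _
    | add a b _ _ iha ihb => rw [map_add, iha, ihb, add_zero]
    | smul c a _ ih => rw [smul_eq_mul, map_mul, ih, mul_zero]
  refine ⟨S.val.comp (Ideal.Quotient.liftₐ _ ψ hker), ?_, fun n => ?_⟩
  · change ((ψ (MvPolynomial.C X) : S) : E) = Z
    rw [hψC, aeval_X]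
  · change ((ψ (MvPolynomial.X n) : S) : E) = b n
    rw [hψX]

end BRing

/-! ### Graded modules over `A(z(z + m))` as chains -/

/-- The polynomial `z + n`. -/
noncomputable def linFactor (k : Type u) [Field k] (n : ℤ) : k[X] := X + C (n : k)

theorem linFactor_ne_zero (k : Type u) [Field k] (n : ℤ) : linFactor k n ≠ 0 :=
  X_add_C_ne_zero _

theorem isCoprime_linFactor (k : Type u) [Field k] [CharZero k] (n n' : ℤ) (h : n ≠ n') :
    IsCoprime (linFactor k n) (linFactor k n') := by
  have : IsUnit (((-n : ℤ) : k) - ((-n' : ℤ) : k)) := by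
    rw [isUnit_iff_ne_zero, sub_ne_zero]
    exact fun h' => h (neg_injective (Int.cast_injective h'))
  simpa [linFactor] using Polynomial.isCoprime_X_sub_C_of_isUnit_sub this

/-- The polynomial `z(z + m)`. -/
noncomputable abbrev congPoly (k : Type u) [Field k] (m : ℕ) : k[X] := X * (X + C (m : k))

theorem LinearMap.map_aeval_of_comm {k : Type*} [Field k] {V V' : Type*} [AddCommGroup V]
    [Module k V] [AddCommGroup V'] [Module k V'] (φ : V →ₗ[k] V') {S : Module.End k V}
    {T : Module.End k V'} (h : ∀ v, φ (S v) = T (φ v)) (p : k[X]) (v : V) :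
    φ (aeval S p v) = aeval T p (φ v) := by
  induction p using Polynomial.induction_on generalizing v with
  | C a => simp
  | add p q hp hq => simp [hp, hq]
  | monomial n a ih =>
    rw [pow_succ, ← mul_assoc, map_mul (aeval S), map_mul (aeval T), aeval_X, aeval_X,
      Module.End.mul_apply, Module.End.mul_apply, ih, h]

namespace GrMod

variable {k : Type u} [Field k] {m : ℕ} (M : GrMod (GWA.grading (congPoly k m)))

/-- The action of a generator on a graded module. -/
noncomputable def op (i : GWA.Gen) : Module.End k M.carrier :=
  Algebra.lsmul k k M.carrier (MulOpposite.op (GWA.gen (congPoly k m) i))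

/-- Right multiplications compose in the reverse order: `y ∘ x` is multiplication by `xy = f(z)`,
and `x ∘ y` by `yx = f(z - 1)`. -/
theorem op_mul_op (i j : GWA.Gen) : M.op i * M.op j = Algebra.lsmul k k M.carrier
    (MulOpposite.op (GWA.gen (congPoly k m) j * GWA.gen (congPoly k m) i)) := by
  rw [MulOpposite.op_mul, map_mul]; rfl

theorem op_z_mul_x : M.op .z * M.op .x = M.op .x * (M.op .z + 1) := by
  rw [op_mul_op, GWA.gen_x_mul_z, MulOpposite.op_mul, map_mul]
  congr 1
  simp [op]

theorem op_z_mul_y : M.op .z * M.op .y = M.op .y * (M.op .z - 1) := by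
  rw [op_mul_op, GWA.gen_y_mul_z, MulOpposite.op_mul, map_mul]
  congr 1
  simp [op]

theorem op_y_mul_x : M.op .y * M.op .x = M.op .z * (M.op .z + algebraMap k _ (m : k)) := by
  have hcomm : Commute (GWA.gen (congPoly k m) .z)
      (GWA.gen (congPoly k m) .z + algebraMap k _ (m : k)) :=
    (Commute.refl _).add_right (Algebra.commutes (m : k) _).symm
  rw [op_mul_op, GWA.gen_x_mul_y]
  simp only [congPoly, map_mul, map_add, aeval_X, aeval_C]
  rw [hcomm.eq, MulOpposite.op_mul, map_mul, MulOpposite.op_add, map_add,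
    ← MulOpposite.algebraMap_apply, AlgHom.commutes]
  rfl

theorem op_x_mul_y : M.op .x * M.op .y =
    (M.op .z - 1) * (M.op .z - 1 + algebraMap k _ (m : k)) := by
  have hcomm : Commute (GWA.gen (congPoly k m) .z - 1)
      (GWA.gen (congPoly k m) .z - 1 + algebraMap k _ (m : k)) :=
    (Commute.refl _).add_right (Algebra.commutes (m : k) _).symm
  rw [op_mul_op, GWA.gen_y_mul_x]
  simp only [congPoly, mul_comp, add_comp, X_comp, C_comp, map_mul, map_add, map_sub, map_one,
    aeval_X, aeval_C]
  rw [hcomm.eq, MulOpposite.op_mul, map_mul, MulOpposite.op_add, map_add,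
    ← MulOpposite.algebraMap_apply, AlgHom.commutes, MulOpposite.op_sub, map_sub,
    MulOpposite.op_one, map_one]
  rfl

/-- The chain defined by a graded module. -/
noncomputable def chain : Chain (linFactor k) m M.carrier where
  -- The shift by `i` cancels `xz = (z + 1)x`, so that `x` and `y` become `k[z]`-linear between
  -- consecutive positions. Each `act i` is defined on the whole module; the degrees are imposed on
  -- families afterwards.
  act i := aeval (M.op .z - algebraMap k _ (i : k))
  x := M.op .x
  y := M.op .y
  x_act i p v := by
    refine LinearMap.map_aeval_of_comm _ (fun v => ?_) p v
    have h := LinearMap.congr_fun M.op_z_mul_x v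
    simp only [Module.End.mul_apply, LinearMap.add_apply, Module.End.one_apply, map_add] at h
    simp [h]
  y_act i p v := by
    refine LinearMap.map_aeval_of_comm _ (fun v => ?_) p v
    have h := LinearMap.congr_fun M.op_z_mul_y v
    simp only [Module.End.mul_apply, LinearMap.sub_apply, Module.End.one_apply, map_sub] at h
    simp [h]
    abel
  y_x i v := by
    have h := LinearMap.congr_fun M.op_y_mul_x v
    rw [Module.End.mul_apply] at h
    rw [h]
    congr 1
    simp [linFactor]
    congr 1; abel
  x_y i v := by
    have h := LinearMap.congr_fun M.op_x_mul_y v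
    rw [Module.End.mul_apply] at h
    rw [h]
    congr 1
    simp [linFactor]
    congr 1 <;> abel

theorem chain_act (i : ℤ) (p : k[X]) :
    M.chain.act i p = aeval (M.op .z - algebraMap k _ (i : k)) p := rfl

theorem x_mem_deg {i : ℤ} {v : M.carrier} (hv : v ∈ M.deg i) : M.chain.x v ∈ M.deg (i + 1) :=
  M.smul_mem hv (gen_mem_wordGrading (GWA.gen (congPoly k m)) GWA.genDeg .x)

theorem y_mem_deg {i : ℤ} {v : M.carrier} (hv : v ∈ M.deg (i + 1)) : M.chain.y v ∈ M.deg i := by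
  have := M.smul_mem hv (gen_mem_wordGrading (GWA.gen (congPoly k m)) GWA.genDeg .y)
  rwa [show GWA.genDeg .y = -1 from rfl, add_neg_cancel_right] at this

theorem z_mem_deg {i : ℤ} {v : M.carrier} (hv : v ∈ M.deg i) : M.op .z v ∈ M.deg i := by
  have := M.smul_mem hv (gen_mem_wordGrading (GWA.gen (congPoly k m)) GWA.genDeg .z)
  rwa [show GWA.genDeg .z = 0 from rfl, add_zero] at this

theorem aeval_mem {V : Type*} [AddCommGroup V] [Module k V] {S : Module.End k V}
    {D : Submodule k V} (hS : ∀ v ∈ D, S v ∈ D) (p : k[X]) {v : V} (hv : v ∈ D) :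
    aeval S p v ∈ D := by
  induction p using Polynomial.induction_on generalizing v with
  | C a => simpa using D.smul_mem a hv
  | add p q hp hq => rw [map_add]; exact add_mem (hp hv) (hq hv)
  | monomial n a ih =>
    rw [pow_succ, ← mul_assoc, map_mul, aeval_X]
    exact ih (hS v hv)

theorem chain_act_mem {D : Submodule k M.carrier} (hD : ∀ v ∈ D, M.op .z v ∈ D) (i : ℤ) (p : k[X])
    {v : M.carrier} (hv : v ∈ D) : M.chain.act i p v ∈ D := by
  refine aeval_mem (fun v hv => ?_) p hv
  rw [LinearMap.sub_apply, Module.algebraMap_end_apply]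
  exact sub_mem (hD v hv) (D.smul_mem _ hv)

theorem act_mem_deg {i j : ℤ} {p : k[X]} {v : M.carrier} (hv : v ∈ M.deg i) :
    M.chain.act j p v ∈ M.deg i :=
  M.chain_act_mem (fun _ h => M.z_mem_deg h) j p hv

theorem op_z_eq_act (i : ℤ) : M.op .z = M.chain.act i (X + C (i : k)) := by
  simp [chain_act]

theorem isHom_chain {M N : GrMod (GWA.grading (congPoly k m))} (f : M ⟶ N) :
    M.chain.IsHom N.chain (f.hom.restrictScalars k) where
  act i p v := by
    refine LinearMap.map_aeval_of_comm _ (fun v => ?_) p v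
    simp only [LinearMap.sub_apply, map_sub, Module.algebraMap_end_apply, map_smul]
    congr 1
    exact f.hom.map_smul _ _
  x v := f.hom.map_smul _ _
  y v := f.hom.map_smul _ _

/-- Submodules of the components which are stable under the operators and contain generators are
everything. -/
theorem deg_le_of_stable {s : Set M.carrier} (hs : Submodule.span (GWA (congPoly k m))ᵐᵒᵖ s = ⊤)
    (T : ℤ → Submodule k M.carrier) (hT : ∀ i, T i ≤ M.deg i)
    (hx : ∀ i, ∀ v ∈ T i, M.chain.x v ∈ T (i + 1)) (hy : ∀ i, ∀ v ∈ T (i + 1), M.chain.y v ∈ T i)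
    (hz : ∀ i, ∀ v ∈ T i, M.op .z v ∈ T i) (hsT : ∀ v ∈ s, ∃ i, v ∈ T i) (i : ℤ) :
    M.deg i ≤ T i := by
  have hsup : ∀ {S : Module.End k M.carrier}, (∀ i, ∀ v ∈ T i, S v ∈ iSup T) →
      ∀ v ∈ iSup T, S v ∈ iSup T := by
    intro S hS
    have : iSup T ≤ (iSup T).comap S := iSup_le hS
    exact this
  have htop : ∀ v, v ∈ iSup T := by
    intro v
    have hv : v ∈ Submodule.span (GWA (congPoly k m))ᵐᵒᵖ s := hs ▸ Submodule.mem_top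
    induction hv using Submodule.span_induction with
    | mem v h => obtain ⟨i, hi⟩ := hsT v h; exact le_iSup T i hi
    | zero => exact zero_mem _
    | add v w _ _ hv hw => exact add_mem hv hw
    | smul a v _ hv =>
      refine smul_mem_of_gen (GWA.adjoin_gen (congPoly k m)) (iSup T) (fun i v hv => ?_) a.unop hv
      cases i with
      | x => exact hsup (S := M.op .x) (fun i v hv => le_iSup T _ (hx i v hv)) v hv
      | y =>
        refine hsup (S := M.op .y) (fun i v hv => le_iSup T (i - 1) (hy _ v ?_)) v hv
        rwa [sub_add_cancel]
      | z => exact hsup (S := M.op .z) (fun i v hv => le_iSup T _ (hz i v hv)) v hv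
  obtain ⟨p, -, hp, hp'⟩ := M.exists_proj
  have hle : iSup T ≤ (T i).comap (p i) := by
    refine iSup_le fun j v hv => ?_
    change p i v ∈ T i
    by_cases h : j = i
    · subst h; rwa [hp _ _ (hT _ hv)]
    · rw [hp' _ _ h _ (hT _ hv)]; exact zero_mem _
  intro v hv
  rw [← hp i v hv]
  exact hle (htop v)

/-- The element `v` of degree `d` moved to degree `i`. -/
noncomputable def move (d : ℤ) (v : M.carrier) (i : ℤ) : M.carrier :=
  if d ≤ i then (M.chain.x ^ (i - d).toNat) v else (M.chain.y ^ (d - i).toNat) v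

theorem move_of_le {d i : ℤ} (h : d ≤ i) (v : M.carrier) :
    M.move d v i = (M.chain.x ^ (i - d).toNat) v := if_pos h

theorem move_of_ge {d i : ℤ} (h : i ≤ d) (v : M.carrier) :
    M.move d v i = (M.chain.y ^ (d - i).toNat) v := by
  rcases h.eq_or_lt with rfl | h
  · simp [move]
  · exact if_neg (not_le.2 h)

@[simp] theorem move_self (d : ℤ) (v : M.carrier) : M.move d v d = v := by
  simp [move]

theorem x_move {d i : ℤ} (h : d ≤ i) (v : M.carrier) :
    M.chain.x (M.move d v i) = M.move d v (i + 1) := by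
  rw [M.move_of_le h, M.move_of_le (by omega), show (i + 1 - d).toNat = (i - d).toNat + 1 by omega,
    pow_succ']
  rfl

theorem y_move {d i : ℤ} (h : i < d) (v : M.carrier) :
    M.chain.y (M.move d v (i + 1)) = M.move d v i := by
  rw [M.move_of_ge (by omega), M.move_of_ge (by omega),
    show (d - i).toNat = (d - (i + 1)).toNat + 1 by omega, pow_succ']
  rfl

theorem x_move_of_lt {d i : ℤ} (h : i < d) (v : M.carrier) : M.chain.x (M.move d v i) =
    M.chain.act (i + 1) (linFactor k i * linFactor k (i + m)) (M.move d v (i + 1)) := by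
  rw [← M.y_move h, M.chain.x_y i]

theorem y_move_of_le {d i : ℤ} (h : d ≤ i) (v : M.carrier) : M.chain.y (M.move d v (i + 1)) =
    M.chain.act i (linFactor k i * linFactor k (i + m)) (M.move d v i) := by
  rw [← M.x_move h, M.chain.y_x i]

theorem move_mem_deg {d : ℤ} {v : M.carrier} (hv : v ∈ M.deg d) (i : ℤ) :
    M.move d v i ∈ M.deg i := by
  rcases le_total d i with h | h
  · induction i, h using Int.leInduction with
    | base => simpa using hv
    | succ i h ih => rw [← M.x_move h]; exact M.x_mem_deg ih
  · induction i, h using Int.leInductionDown with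
    | base => simpa using hv
    | pred i h ih =>
      rw [← M.y_move (by omega)]
      refine M.y_mem_deg ?_
      rwa [sub_add_cancel]

/-- The multiples of `v` in degree `i`. -/
noncomputable def orbit (d : ℤ) (v : M.carrier) (i : ℤ) : Submodule k M.carrier :=
  LinearMap.range ((LinearMap.applyₗ (M.move d v i)).comp (M.chain.act i).toLinearMap)

/-- Finitely many homogeneous elements generate each component under moves and polynomials. -/
theorem exists_generators : ∃ (s : Finset M.carrier) (d : M.carrier → ℤ),
    (∀ v ∈ s, v ∈ M.deg (d v)) ∧ Submodule.span (GWA (congPoly k m))ᵐᵒᵖ (s : Set M.carrier) = ⊤ ∧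
      ∀ i, M.deg i ≤ ⨆ v ∈ s, M.orbit (d v) v i := by
  classical
  obtain ⟨s, hs, hs'⟩ := M.exists_homogeneous_generators
  choose! d hd using hs
  refine ⟨s, d, hd, hs', M.deg_le_of_stable hs' _ ?_ ?_ ?_ ?_ ?_⟩
  · refine fun i => iSup₂_le fun v hv => ?_
    rintro _ ⟨p, rfl⟩
    exact M.act_mem_deg (M.move_mem_deg (hd v hv) i)
  · intro i
    have : (⨆ v ∈ s, M.orbit (d v) v i) ≤
        (⨆ v ∈ s, M.orbit (d v) v (i + 1)).comap M.chain.x := by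
      refine iSup₂_le fun v hv => ?_
      rintro _ ⟨p, rfl⟩
      refine (le_iSup₂_of_le (f := fun v (_ : v ∈ s) => M.orbit (d v) v (i + 1)) v hv le_rfl) ?_
      change M.chain.x (M.chain.act i p (M.move (d v) v i)) ∈ _
      rw [M.chain.x_act]
      rcases le_or_gt (d v) i with h | h
      · rw [M.x_move h]; exact ⟨p, rfl⟩
      -- Below the degree of `v`, a step by `x` undoes a step by `y` up to the polynomial of that
      -- step, hence stays among the polynomial multiples.
      · rw [M.x_move_of_lt h, ← M.chain.act_mul]; exact ⟨_, rfl⟩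
    exact this
  · intro i
    have : (⨆ v ∈ s, M.orbit (d v) v (i + 1)) ≤
        (⨆ v ∈ s, M.orbit (d v) v i).comap M.chain.y := by
      refine iSup₂_le fun v hv => ?_
      rintro _ ⟨p, rfl⟩
      refine (le_iSup₂_of_le (f := fun v (_ : v ∈ s) => M.orbit (d v) v i) v hv le_rfl) ?_
      change M.chain.y (M.chain.act (i + 1) p (M.move (d v) v (i + 1))) ∈ _
      rw [M.chain.y_act]
      rcases le_or_gt (d v) i with h | h
      · rw [M.y_move_of_le h, ← M.chain.act_mul]; exact ⟨_, rfl⟩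
      · rw [M.y_move h]; exact ⟨p, rfl⟩
    exact this
  · intro i
    have : (⨆ v ∈ s, M.orbit (d v) v i) ≤ (⨆ v ∈ s, M.orbit (d v) v i).comap (M.op .z) := by
      refine iSup₂_le fun v hv => ?_
      rintro _ ⟨p, rfl⟩
      refine (le_iSup₂_of_le (f := fun v (_ : v ∈ s) => M.orbit (d v) v i) v hv le_rfl) ?_
      rw [M.op_z_eq_act i]
      exact ⟨(X + C (i : k)) * p, M.chain.act_mul _ _ _ _⟩
    exact this
  · intro v hv
    refine ⟨d v, (le_iSup₂_of_le (f := fun w (_ : w ∈ s) => M.orbit (d w) w (d v)) v hv le_rfl) ?_⟩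
    exact ⟨1, by simp⟩

end GrMod

/-! ### The functor to graded modules over `B` -/

section Operators

variable {k : Type u} [Field k] {m : ℕ} {V : Type u} [AddCommGroup V] [Module k V]
  (C : Chain (linFactor k) m V)

/-- The degree of `bₙ`. -/
abbrev bdeg (n : ℤ) : ZFin := BRing.genDeg (some n)

theorem bdeg_add_bdeg (J : ZFin) (n : ℤ) : J + bdeg n + bdeg n = J := by
  rw [add_assoc, BRing.genDeg_add_self, add_zero]

theorem ptype_add_bdeg_self (J : ZFin) (n : ℤ) : ptype (J + bdeg n) n ↔ ¬ ptype J n := by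
  rw [ptype_add_genDeg, toggle_self]

theorem ptype_add_bdeg_ne (J : ZFin) {n n' : ℤ} (h : n' ≠ n) :
    ptype (J + bdeg n) n' ↔ ptype J n' := by
  rw [ptype_add_genDeg, toggle_ne _ h]

namespace Chain

/-- The action of `bₙ` on formal sums of families. -/
noncomputable def bOp (n : ℤ) : Module.End k (ZFin →₀ (ℤ → V)) :=
  Finsupp.lsum k fun J => Finsupp.lsingle (J + bdeg n) ∘ₗ
    C.diag (toggleWeight (linFactor k) m n (ptype J))

theorem bOp_single (n : ℤ) (J : ZFin) (u : ℤ → V) : C.bOp n (Finsupp.single J u) =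
    Finsupp.single (J + bdeg n) (C.diag (toggleWeight (linFactor k) m n (ptype J)) u) := by
  rw [bOp, Finsupp.lsum_single]; rfl

theorem bOp_apply (n : ℤ) (φ : ZFin →₀ (ℤ → V)) (J : ZFin) : C.bOp n φ J =
    C.diag (toggleWeight (linFactor k) m n (ptype (J + bdeg n))) (φ (J + bdeg n)) := by
  induction φ using Finsupp.induction_linear with
  | zero => simp
  | add φ ψ h1 h2 => rw [map_add (C.bOp n), Finsupp.add_apply, h1, h2, Finsupp.add_apply, map_add (C.diag _)]
  | single I u =>
    rw [bOp_single]
    by_cases h : I = J + bdeg n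
    · rw [h, bdeg_add_bdeg, Finsupp.single_eq_same, Finsupp.single_eq_same]
    · rw [Finsupp.single_eq_of_ne (Ne.symm h), map_zero, Finsupp.single_eq_of_ne]
      intro h'
      exact h (by rw [h', bdeg_add_bdeg])

/-- The action of polynomials on formal sums of families. -/
noncomputable def pOp (p : k[X]) : Module.End k (ZFin →₀ (ℤ → V)) :=
  Finsupp.mapRange.linearMap (C.polyAct p)

theorem pOp_single (p : k[X]) (J : ZFin) (u : ℤ → V) :
    C.pOp p (Finsupp.single J u) = Finsupp.single J (C.polyAct p u) :=
  Finsupp.mapRange_single (hf := map_zero _)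

theorem pOp_mul_bOp (p : k[X]) (n : ℤ) : C.pOp p * C.bOp n = C.bOp n * C.pOp p := by
  refine Finsupp.lhom_ext fun J u => ?_
  rw [Module.End.mul_apply, Module.End.mul_apply, bOp_single, pOp_single, pOp_single, bOp_single,
    diag_comm]

/-- For distinct points, the weight of one does not see the type of the other, and polynomial
weights commute. -/
theorem bOp_mul_bOp (n n' : ℤ) : C.bOp n * C.bOp n' = C.bOp n' * C.bOp n := by
  by_cases h : n = n'
  · rw [h]
  refine Finsupp.lhom_ext fun J u => ?_
  rw [Module.End.mul_apply, Module.End.mul_apply, bOp_single, bOp_single, bOp_single, bOp_single,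
    diag_comm, add_right_comm]
  congr 2
  · exact congrArg C.diag (funext fun i => toggleWeight_congr _ _
      (ptype_add_bdeg_ne J (Ne.symm h)).symm i)
  · refine LinearMap.congr_fun (congrArg C.diag (funext fun i => toggleWeight_congr _ _
      (ptype_add_bdeg_ne J h) i)) u

/-- The two weights belong to opposite types of `n`, so `toggleWeight_mul` applies at every
position. -/
theorem bOp_mul_self (n : ℤ) : C.bOp n * C.bOp n = C.pOp (linFactor k n ^ 2) := by
  refine Finsupp.lhom_ext fun J u => ?_
  rw [Module.End.mul_apply, bOp_single, bOp_single, pOp_single, bdeg_add_bdeg, ← diag_mul]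
  congr 3
  funext i
  exact toggleWeight_mul _ _ (ptype_add_bdeg_self J n) i

theorem aeval_pOp (p : k[X]) : aeval (C.pOp X) p = C.pOp p := by
  refine LinearMap.ext fun φ => Finsupp.ext fun J => funext fun i => ?_
  have h1 : aeval (C.pOp X) p φ J = aeval (C.polyAct X) p (φ J) :=
    LinearMap.map_aeval_of_comm (Finsupp.lapply J) (fun φ => rfl) p φ
  have h2 : aeval (C.polyAct X) p (φ J) i = aeval (C.act i X) p (φ J i) :=
    LinearMap.map_aeval_of_comm (LinearMap.proj (φ := fun _ => V) i) (S := C.polyAct X)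
      (T := C.act i X) (fun φ => rfl) p (φ J)
  rw [h1, h2, Polynomial.aeval_algHom_apply, aeval_X_left_apply]
  rfl

end Chain

end Operators

namespace GrMod

variable {k : Type u} [Field k] {m : ℕ} (M : GrMod (GWA.grading (congPoly k m)))

/-- The compatible families of type `J` with members of the right degrees. -/
noncomputable def gfam (J : ZFin) : Submodule k (ℤ → M.carrier) :=
  M.chain.fam (ptype J) ⊓ Submodule.pi Set.univ M.deg

theorem mem_gfam {J : ZFin} {u : ℤ → M.carrier} :
    u ∈ M.gfam J ↔ u ∈ M.chain.fam (ptype J) ∧ ∀ i, u i ∈ M.deg i := by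
  simp [gfam, Submodule.mem_pi]

theorem polyAct_mem_gfam {J : ZFin} (p : k[X]) {u : ℤ → M.carrier} (hu : u ∈ M.gfam J) :
    M.chain.polyAct p u ∈ M.gfam J :=
  M.mem_gfam.2 ⟨M.chain.polyAct_mem p (M.mem_gfam.1 hu).1,
    fun i => M.act_mem_deg ((M.mem_gfam.1 hu).2 i)⟩

theorem toggle_mem_gfam (hm : 0 < m) {J : ZFin} (n : ℤ) {u : ℤ → M.carrier} (hu : u ∈ M.gfam J) :
    M.chain.diag (toggleWeight (linFactor k) m n (ptype J)) u ∈ M.gfam (J + bdeg n) := by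
  refine M.mem_gfam.2 ⟨?_, fun i => M.act_mem_deg ((M.mem_gfam.1 hu).2 i)⟩
  rw [ptype_add_genDeg]
  exact M.chain.diag_toggleWeight_mem (linFactor_ne_zero k) hm n (M.mem_gfam.1 hu).1

/-- The formal sums of families of all types. -/
noncomputable def famSubmodule : Submodule k (ZFin →₀ (ℤ → M.carrier)) where
  carrier := {φ | ∀ J, φ J ∈ M.gfam J}
  add_mem' h h' J := add_mem (h J) (h' J)
  zero_mem' _ := zero_mem _
  smul_mem' c _ h J := Submodule.smul_mem _ c (h J)

theorem single_mem_famSubmodule {J : ZFin} {u : ℤ → M.carrier} (hu : u ∈ M.gfam J) :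
    Finsupp.single J u ∈ M.famSubmodule := by
  classical
  intro I
  rw [Finsupp.single_apply]
  split_ifs with h
  · exact h ▸ hu
  · exact zero_mem _

/-- The sum of the spaces of families of all types. -/
def totalFam : Type u := M.famSubmodule

noncomputable instance : AddCommGroup M.totalFam := inferInstanceAs (AddCommGroup M.famSubmodule)

noncomputable instance : Module k M.totalFam := inferInstanceAs (Module k M.famSubmodule)

/-- The inclusion of the sum of the spaces of families. -/
noncomputable def famVal : M.totalFam →ₗ[k] ZFin →₀ (ℤ → M.carrier) := M.famSubmodule.subtype

theorem famVal_injective : Function.Injective M.famVal := Subtype.val_injective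

theorem famVal_mem (φ : M.totalFam) (J : ZFin) : M.famVal φ J ∈ M.gfam J := φ.2 J

/-- The homogeneous element given by a family. -/
noncomputable def famSingle (J : ZFin) : M.gfam J →ₗ[k] M.totalFam :=
  ((Finsupp.lsingle J).domRestrict (M.gfam J)).codRestrict M.famSubmodule
    fun u => M.single_mem_famSubmodule u.2

theorem famVal_famSingle (J : ZFin) (u : M.gfam J) :
    M.famVal (M.famSingle J u) = Finsupp.single J u.1 := rfl

/-- The component of type `J`. -/
noncomputable def famComp (J : ZFin) : M.totalFam →ₗ[k] M.gfam J :=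
  ((Finsupp.lapply J).comp M.famVal).codRestrict _ fun φ => M.famVal_mem φ J

theorem totalFam_induction {P : M.totalFam → Prop} (φ : M.totalFam) (h0 : P 0)
    (hadd : ∀ φ ψ, P φ → P ψ → P (φ + ψ)) (hs : ∀ J (u : M.gfam J), P (M.famSingle J u)) : P φ := by
  classical
  have : φ = ∑ J ∈ (M.famVal φ).support, M.famSingle J (M.famComp J φ) := by
    refine M.famVal_injective ?_
    rw [map_sum]
    exact (Finsupp.sum_single (M.famVal φ)).symm
  rw [this]
  exact Finset.sum_induction _ P hadd h0 fun J _ => hs _ _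

theorem bOp_mem (hm : 0 < m) (n : ℤ) {φ : ZFin →₀ (ℤ → M.carrier)} (hφ : φ ∈ M.famSubmodule) :
    M.chain.bOp n φ ∈ M.famSubmodule := by
  intro J
  rw [Chain.bOp_apply]
  have := M.toggle_mem_gfam hm n (hφ (J + bdeg n))
  rwa [bdeg_add_bdeg] at this

/-- The action of `bₙ`. -/
noncomputable def famB (hm : 0 < m) (n : ℤ) : Module.End k M.totalFam :=
  ((M.chain.bOp n).comp M.famVal).codRestrict M.famSubmodule fun φ => M.bOp_mem hm n φ.2

theorem famVal_famB (hm : 0 < m) (n : ℤ) (φ : M.totalFam) :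
    M.famVal (M.famB hm n φ) = M.chain.bOp n (M.famVal φ) := rfl

/-- The action of polynomials. -/
noncomputable def famP (p : k[X]) : Module.End k M.totalFam :=
  ((M.chain.pOp p).comp M.famVal).codRestrict M.famSubmodule
    fun φ J => M.polyAct_mem_gfam p (φ.2 J)

theorem famVal_famP (p : k[X]) (φ : M.totalFam) :
    M.famVal (M.famP p φ) = M.chain.pOp p (M.famVal φ) := rfl

theorem aeval_famP (p : k[X]) : aeval (M.famP X) p = M.famP p := by
  refine LinearMap.ext fun φ => M.famVal_injective ?_
  rw [LinearMap.map_aeval_of_comm M.famVal (S := M.famP X) (T := M.chain.pOp X)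
    (fun φ => rfl) p φ, Chain.aeval_pOp, famVal_famP]

theorem exists_famRep (hm : 0 < m) : ∃ ρ : BRing k →ₐ[k] Module.End k M.totalFam,
    ρ (BRing.gen k none) = M.famP X ∧ ∀ n, ρ (BRing.gen k (some n)) = M.famB hm n := by
  refine BRing.exists_rep (M.famP X) (M.famB hm) (fun n => ?_) (fun n n' => ?_) fun n => ?_
  · exact LinearMap.ext fun φ => M.famVal_injective
      (LinearMap.congr_fun (M.chain.pOp_mul_bOp X n) (M.famVal φ))
  · exact LinearMap.ext fun φ => M.famVal_injective
      (LinearMap.congr_fun (M.chain.bOp_mul_bOp n n') (M.famVal φ))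
  · rw [aeval_famP]
    exact LinearMap.ext fun φ => M.famVal_injective
      (LinearMap.congr_fun (M.chain.bOp_mul_self n) (M.famVal φ))

/-- The action of `B` on families. -/
noncomputable def famRep (hm : 0 < m) : (BRing k)ᵐᵒᵖ →ₐ[k] Module.End k M.totalFam :=
  (M.exists_famRep hm).choose.comp (AlgEquiv.toOpposite k (BRing k)).symm.toAlgHom

theorem famRep_z (hm : 0 < m) : M.famRep hm (MulOpposite.op (BRing.gen k none)) = M.famP X :=
  (M.exists_famRep hm).choose_spec.1

theorem famRep_b (hm : 0 < m) (n : ℤ) : M.famRep hm (MulOpposite.op (BRing.gen k (some n))) = M.famB hm n :=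
  (M.exists_famRep hm).choose_spec.2 n

theorem famRep_aeval (hm : 0 < m) (p : k[X]) :
    M.famRep hm (MulOpposite.op (aeval (BRing.gen k none) p)) = M.famP p := by
  rw [← aeval_famP, ← (M.exists_famRep hm).choose_spec.1, Polynomial.aeval_algHom_apply]
  rfl

theorem famB_famSingle (hm : 0 < m) (n : ℤ) (J : ZFin) (u : M.gfam J) :
    M.famB hm n (M.famSingle J u) = M.famSingle (J + bdeg n) ⟨_, M.toggle_mem_gfam hm n u.2⟩ :=
  M.famVal_injective (M.chain.bOp_single n J u.1)

theorem famP_famSingle (p : k[X]) (J : ZFin) (u : M.gfam J) :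
    M.famP p (M.famSingle J u) = M.famSingle J ⟨_, M.polyAct_mem_gfam p u.2⟩ :=
  M.famVal_injective (M.chain.pOp_single p J u.1)

/-- The homogeneous components. -/
noncomputable def famDeg (J : ZFin) : Submodule k M.totalFam := LinearMap.range (M.famSingle J)

theorem famDeg_isInternal : DirectSum.IsInternal M.famDeg := by
  refine isInternal_of_proj _ (fun J => M.famSingle J ∘ₗ M.famComp J) ?_ ?_ ?_
  · rintro J _ ⟨u, rfl⟩
    refine congrArg (M.famSingle J) (Subtype.ext ?_)
    exact Finsupp.single_eq_same
  · rintro J I h _ ⟨u, rfl⟩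
    have : M.famComp I (M.famSingle J u) = 0 := Subtype.ext (Finsupp.single_eq_of_ne (Ne.symm h))
    rw [LinearMap.comp_apply, this, map_zero]
  · rw [eq_top_iff]
    intro φ _
    induction φ using M.totalFam_induction with
    | h0 => exact zero_mem _
    | hadd φ ψ h h' => exact add_mem (h trivial) (h' trivial)
    | hs J u => exact Submodule.mem_iSup_of_mem J ⟨u, rfl⟩

theorem famRep_mem_famDeg (hm : 0 < m) {I J : ZFin} {φ : M.totalFam} {a : BRing k} (hφ : φ ∈ M.famDeg I)
    (ha : a ∈ BRing.grading k J) : M.famRep hm (MulOpposite.op a) φ ∈ M.famDeg (I + J) := by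
  refine rep_mem_deg_of_gen (M.famRep hm) M.famDeg ?_ hφ ha
  rintro (_ | n) I _ ⟨u, rfl⟩
  · rw [famRep_z, famP_famSingle, show BRing.genDeg none = 0 from rfl, add_zero]
    exact ⟨_, rfl⟩
  · rw [famRep_b, famB_famSingle]
    exact ⟨_, rfl⟩

end GrMod

/-! ### Families which extend one homogeneous element -/

namespace Chain

variable {k : Type u} [Field k] {lam : ℤ → k[X]} {m : ℕ} {V : Type w} [AddCommGroup V]
  [Module k V] (C : Chain lam m V)

/-- The extension of an element of degree `d` to a family in which exactly the points to the left
of `d + m` have the type. -/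
noncomputable def rightExt (d : ℤ) : V →ₗ[k] ℤ → V := C.ext (Finset.Ico d (d + m)) d

/-- The extension of an element of degree `d` to a family in which exactly the points to the left
of `d` have the type. -/
noncomputable def leftExt (d : ℤ) : V →ₗ[k] ℤ → V := C.coext (Finset.Ico (-d) (m - d)) d

theorem rightExt_mem {t : ℤ → Prop} {d : ℤ} (ht : ∀ n, t n ↔ n < d + m) (v : V) :
    C.rightExt d v ∈ C.fam t := by
  refine C.ext_mem (fun n hn => (ht n).2 hn) (fun n => ?_) v
  rw [Finset.mem_Ico, ht]
  tauto

theorem leftExt_mem {t : ℤ → Prop} {d : ℤ} (ht : ∀ n, t n ↔ n < d) (v : V) :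
    C.leftExt d v ∈ C.fam t := by
  refine C.coext_mem (fun n hn h => absurd ((ht n).1 h) (by omega)) (fun n => ?_) v
  rw [Finset.mem_Ico, ht]
  omega

/-- The only points with weights lie in `[d, d + m)`, and their gaps are all behind `d + m`. So from
`d + m` on, the family consists of the powers of `x` applied to `v`, without a factor. -/
theorem rightExt_apply {d : ℤ} {j : ℕ} (hj : m ≤ j) (v : V) :
    C.rightExt d v (d + j) = (C.x ^ j) v := by
  rw [rightExt, ext_apply_add, extWeight_eq_one, act_one]
  intro n hn
  rw [Finset.mem_Ico] at hn
  omega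

theorem leftExt_apply {d : ℤ} {j : ℕ} (hj : m ≤ j) (v : V) :
    C.leftExt d v (d - j) = (C.y ^ j) v := by
  rw [leftExt, coext_apply, show -(d - (j : ℤ)) = -d + j by ring, ext_apply_add, extWeight_eq_one,
    act_one]
  · rfl
  · intro n hn
    rw [Finset.mem_Ico] at hn
    omega

/-- At its own degree an element is a value of a family only after multiplication by a fixed nonzero
polynomial. This bounds the defect in the finitely many degrees not reached from far out. -/
theorem exists_rightExt_self (h0 : ∀ n, lam n ≠ 0) (d : ℤ) :
    ∃ p ≠ 0, ∀ v, C.rightExt d v d = C.act d p v := by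
  refine ⟨extWeight lam m (Finset.Ico d (d + m)) d,
    Finset.prod_ne_zero_iff.2 fun n _ => pow_ne_zero _ (h0 n), fun v => ?_⟩
  simpa [rightExt] using C.ext_apply_add (Finset.Ico d (d + m)) d 0 v

end Chain

namespace GrMod

variable {k : Type u} [Field k] {m : ℕ} (M : GrMod (GWA.grading (congPoly k m)))

theorem exists_rightExt_mem {d : ℤ} : ∃ J, ∀ v ∈ M.deg d, M.chain.rightExt d v ∈ M.gfam J := by
  obtain ⟨J, hJ⟩ := exists_ptype_iff_lt (d + m)
  refine ⟨J, fun v hv => M.mem_gfam.2 ⟨M.chain.rightExt_mem hJ v, ?_⟩⟩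
  exact M.chain.ext_apply_mem (fun _ _ _ => M.act_mem_deg) (fun _ _ => M.x_mem_deg)
    (fun _ _ => M.y_mem_deg) _ hv

theorem exists_leftExt_mem {d : ℤ} : ∃ J, ∀ v ∈ M.deg d, M.chain.leftExt d v ∈ M.gfam J := by
  obtain ⟨J, hJ⟩ := exists_ptype_iff_lt d
  refine ⟨J, fun v hv => M.mem_gfam.2 ⟨M.chain.leftExt_mem hJ v, ?_⟩⟩
  exact M.chain.coext_apply_mem (fun _ _ _ => M.act_mem_deg) (fun _ _ => M.x_mem_deg)
    (fun _ _ => M.y_mem_deg) _ hv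

variable [CharZero k]

/-- A stable subspace of the sum of the spaces of families which exhausts the module far to the
left and far to the right is everything. -/
theorem eq_top_of_stable (hm : 0 < m) (N : Submodule k M.totalFam)
    (hP : ∀ p, ∀ φ ∈ N, M.famP p φ ∈ N) (hB : ∀ n, ∀ φ ∈ N, M.famB hm n φ ∈ N) {a₀ b₀ : ℤ}
    (ha : ∀ i ≤ a₀, ∀ v ∈ M.deg i, v ∈ Submodule.span k
      {w | ∃ J, ∃ u : M.gfam J, M.famSingle J u ∈ N ∧ u.1 i = w})
    (hb : ∀ i, b₀ ≤ i → ∀ v ∈ M.deg i, v ∈ Submodule.span k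
      {w | ∃ J, ∃ u : M.gfam J, M.famSingle J u ∈ N ∧ u.1 i = w}) : N = ⊤ := by
  let K : ZFin → Submodule k (ℤ → M.carrier) := fun J =>
    (N.comap (M.famSingle J)).map (M.gfam J).subtype
  have hK : ∀ i, ∀ v ∈ Submodule.span k
      {w | ∃ J, ∃ u : M.gfam J, M.famSingle J u ∈ N ∧ u.1 i = w},
      v ∈ ⨆ J, (K J).map (LinearMap.proj i) := by
    intro i
    rw [← SetLike.le_def, Submodule.span_le]
    rintro _ ⟨J, u, hu, rfl⟩
    exact Submodule.mem_iSup_of_mem J ⟨u.1, ⟨u, hu, rfl⟩, rfl⟩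
  have key : ∀ J, ∀ u ∈ M.gfam J, u ∈ K J := by
    intro J u hu
    rw [mem_gfam] at hu
    refine M.chain.mem_of_eventually_mem_iSup (isCoprime_linFactor k) (K := K) ?_ ?_ ?_ hu.1
      (fun i hi => hK i _ (ha i hi _ (hu.2 i))) (fun i hi => hK i _ (hb i hi _ (hu.2 i)))
    · rintro J _ ⟨u, -, rfl⟩
      exact (M.mem_gfam.1 u.2).1
    · rintro J p _ ⟨u, hu, rfl⟩
      refine ⟨⟨_, M.polyAct_mem_gfam p u.2⟩, ?_, rfl⟩
      have := hP p _ hu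
      rwa [famP_famSingle] at this
    · rintro J n _ ⟨u, hu, rfl⟩
      refine ⟨⟨_, M.toggle_mem_gfam hm n u.2⟩, ?_, rfl⟩
      have := hB n _ hu
      rwa [famB_famSingle] at this
  rw [eq_top_iff]
  intro φ _
  induction φ using M.totalFam_induction with
  | h0 => exact zero_mem _
  | hadd φ ψ h h' => exact add_mem (h trivial) (h' trivial)
  | hs J u =>
    obtain ⟨u', hu', h⟩ := key J u.1 u.2
    rwa [← Subtype.ext h]

/-- The right and left extensions of finitely many homogeneous generators of `M` suffice. Far to the
right `M` is spanned by polynomial multiples of the `x^j v`, far to the left by those of the `y^j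
v`, and these are values of the extensions; `eq_top_of_stable` does the rest. -/
theorem famRep_finite (hm : 0 < m) : ∃ s : Finset M.totalFam, ∀ N : Submodule k M.totalFam,
    (∀ r, ∀ φ ∈ N, M.famRep hm r φ ∈ N) → (∀ φ ∈ s, φ ∈ N) → N = ⊤ := by
  classical
  obtain ⟨s, d, hd, -, hs⟩ := M.exists_generators
  choose JR hJR using fun d => M.exists_rightExt_mem (d := d)
  choose JL hJL using fun d => M.exists_leftExt_mem (d := d)
  let fR : s → M.totalFam := fun v => M.famSingle (JR (d v.1)) ⟨_, hJR _ v.1 (hd v.1 v.2)⟩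
  let fL : s → M.totalFam := fun v => M.famSingle (JL (d v.1)) ⟨_, hJL _ v.1 (hd v.1 v.2)⟩
  refine ⟨s.attach.image fR ∪ s.attach.image fL, fun N hN hsN => ?_⟩
  have hP : ∀ p, ∀ φ ∈ N, M.famP p φ ∈ N := by
    intro p φ hφ
    rw [← M.famRep_aeval hm]
    exact hN _ _ hφ
  have hB : ∀ n, ∀ φ ∈ N, M.famB hm n φ ∈ N := by
    intro n φ hφ
    rw [← M.famRep_b hm]
    exact hN _ _ hφ
  obtain ⟨a, ha⟩ : ∃ a : ℕ, ∀ v ∈ s, (d v).natAbs ≤ a :=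
    ⟨s.sup fun v => (d v).natAbs, fun v hv => Finset.le_sup (f := fun v => (d v).natAbs) hv⟩
  -- Beyond these bounds a position is at least `m` away from the degree of every generator, as
  -- `leftExt_apply` and `rightExt_apply` require.
  refine M.eq_top_of_stable hm N hP hB (a₀ := -a - m) (b₀ := a + m) ?_ ?_
  · intro i hi w hw
    refine (show (⨆ v ∈ s, M.orbit (d v) v i) ≤ _ from iSup₂_le fun v hv => ?_) (hs i hw)
    rintro _ ⟨p, rfl⟩
    have hdi := ha v hv
    obtain ⟨j, hj⟩ := Int.le.dest (show i + m ≤ d v by omega)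
    have hmem := hP p _ (hsN (fL ⟨v, hv⟩) (Finset.mem_union_right _
      (Finset.mem_image_of_mem _ (Finset.mem_attach _ _))))
    rw [M.famP_famSingle] at hmem
    refine Submodule.subset_span ⟨_, _, hmem, ?_⟩
    change M.chain.act i p (M.chain.leftExt (d v) v i) = M.chain.act i p (M.move (d v) v i)
    rw [M.move_of_ge (by omega)]
    have := M.chain.leftExt_apply (d := d v) (j := (d v - i).toNat) (by omega) v
    rw [show d v - ((d v - i).toNat : ℤ) = i by omega] at this
    rw [this]
  · intro i hi w hw
    refine (show (⨆ v ∈ s, M.orbit (d v) v i) ≤ _ from iSup₂_le fun v hv => ?_) (hs i hw)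
    rintro _ ⟨p, rfl⟩
    have hdi := ha v hv
    have hmem := hP p _ (hsN (fR ⟨v, hv⟩) (Finset.mem_union_left _
      (Finset.mem_image_of_mem _ (Finset.mem_attach _ _))))
    rw [M.famP_famSingle] at hmem
    refine Submodule.subset_span ⟨_, _, hmem, ?_⟩
    change M.chain.act i p (M.chain.rightExt (d v) v i) = M.chain.act i p (M.move (d v) v i)
    rw [M.move_of_le (by omega)]
    have := M.chain.rightExt_apply (d := d v) (j := (i - d v).toNat) (by omega) v
    rw [show d v + ((i - d v).toNat : ℤ) = i by omega] at this
    rw [this]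

/-- The graded `B`-module of families of elements of a graded `A(z(z + m))`-module. -/
noncomputable def famObj (hm : 0 < m) : GrMod (BRing.grading k) :=
  ofRep M.totalFam (M.famRep hm) M.famDeg M.famDeg_isInternal (M.famRep_mem_famDeg hm)
    (M.famRep_finite hm)

theorem famObj_smul_z (hm : 0 < m) (φ : (M.famObj hm).carrier) :
    MulOpposite.op (BRing.gen k none) • φ = M.famP X φ :=
  LinearMap.congr_fun (M.famRep_z hm) φ

theorem famObj_smul_b (hm : 0 < m) (n : ℤ) (φ : (M.famObj hm).carrier) :
    MulOpposite.op (BRing.gen k (some n)) • φ = M.famB hm n φ :=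
  LinearMap.congr_fun (M.famRep_b hm n) φ

theorem famObj_smul_aeval (hm : 0 < m) (p : k[X]) (φ : (M.famObj hm).carrier) :
    MulOpposite.op (aeval (BRing.gen k none) p) • φ = M.famP p φ :=
  LinearMap.congr_fun (M.famRep_aeval hm p) φ

/-! ### Functoriality of families -/

variable {M} {N : GrMod (GWA.grading (congPoly k m))}

theorem comp_mem_gfam (f : M ⟶ N) {J : ZFin} {u : ℤ → M.carrier} (hu : u ∈ M.gfam J) :
    (fun i => f.hom (u i)) ∈ N.gfam J := by
  rw [mem_gfam] at hu ⊢
  refine ⟨fun i => ⟨?_, ?_⟩, fun i => f.map_mem (hu.2 i)⟩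
  · have h := congrArg f.hom (hu.1 i).1
    exact ((isHom_chain f).x _).symm.trans (h.trans ((isHom_chain f).act _ _ _))
  · have h := congrArg f.hom (hu.1 i).2
    exact ((isHom_chain f).y _).symm.trans (h.trans ((isHom_chain f).act _ _ _))

/-- The map on families induced by a homomorphism. -/
noncomputable def famMapLin (f : M ⟶ N) : M.totalFam →ₗ[k] N.totalFam :=
  ((Finsupp.mapRange.linearMap ((f.hom.restrictScalars k).compLeft ℤ)).comp
    M.famVal).codRestrict N.famSubmodule fun φ J => comp_mem_gfam f (M.famVal_mem φ J)

theorem famVal_famMapLin (f : M ⟶ N) (φ : M.totalFam) (J : ZFin) (i : ℤ) :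
    N.famVal (famMapLin f φ) J i = f.hom (M.famVal φ J i) := rfl

theorem famMapLin_famSingle (f : M ⟶ N) (J : ZFin) (u : M.gfam J) :
    famMapLin f (M.famSingle J u) = N.famSingle J ⟨_, comp_mem_gfam f u.2⟩ := by
  refine N.famVal_injective ?_
  exact Finsupp.mapRange_single (hf := map_zero _)

theorem famMapLin_famP (f : M ⟶ N) (p : k[X]) (φ : M.totalFam) :
    famMapLin f (M.famP p φ) = N.famP p (famMapLin f φ) := by
  refine N.famVal_injective (Finsupp.ext fun J => funext fun i => ?_)
  exact (isHom_chain f).act _ _ _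

theorem famMapLin_famB (hm : 0 < m) (f : M ⟶ N) (n : ℤ) (φ : M.totalFam) :
    famMapLin f (M.famB hm n φ) = N.famB hm n (famMapLin f φ) := by
  refine N.famVal_injective (Finsupp.ext fun J => funext fun i => ?_)
  rw [famVal_famMapLin, famVal_famB, famVal_famB, Chain.bOp_apply, Chain.bOp_apply]
  exact (isHom_chain f).act _ _ _

/-- The map on families induced by a homomorphism, as a homomorphism of graded `B`-modules. -/
noncomputable def famMap (hm : 0 < m) (f : M ⟶ N) : M.famObj hm ⟶ N.famObj hm :=
  homOfGen (M := M.famObj hm) (N := N.famObj hm) (BRing.adjoin_gen k) (famMapLin f)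
    (by
      rintro (_ | n) φ
      · rw [famObj_smul_z, famObj_smul_z]
        exact famMapLin_famP f X φ
      · rw [famObj_smul_b, famObj_smul_b]
        exact famMapLin_famB hm f n φ)
    (by
      rintro J _ ⟨u, rfl⟩
      exact ⟨_, (famMapLin_famSingle f J u).symm⟩)

variable (k) in
/-- The functor of families. -/
noncomputable def famFunctor (hm : 0 < m) :
    GrMod (GWA.grading (congPoly k m)) ⥤ GrMod (BRing.grading k) where
  obj M := M.famObj hm
  map f := famMap hm f
  map_id M := by
    ext φ
    exact M.famVal_injective (Finsupp.ext fun J => funext fun i => rfl)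
  map_comp {M N P} f g := by
    ext φ
    exact P.famVal_injective (Finsupp.ext fun J => funext fun i => rfl)

instance (hm : 0 < m) : (famFunctor k hm).Additive where
  map_add {M N f g} := by
    ext φ
    exact N.famVal_injective (Finsupp.ext fun J => funext fun i => rfl)

instance (hm : 0 < m) : (famFunctor k hm).Linear k where
  map_smul {M N} f c := by
    ext φ
    exact N.famVal_injective (Finsupp.ext fun J => funext fun i => rfl)

end GrMod

/-! ### Morphisms which become invertible on families -/

/-- Nonzero vectors chosen from the nonzero `D i` are linearly independent in the finite-dimensional
space `U`, so there are finitely many of them. -/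
theorem exists_natAbs_bound_of_iSupIndep {k V : Type*} [Field k] [AddCommGroup V] [Module k V]
    {D : ℤ → Submodule k V} (hD : iSupIndep D) (U : Submodule k V) [FiniteDimensional k U]
    (hU : ∀ i, D i ≤ U) : ∃ N : ℕ, ∀ i : ℤ, N ≤ i.natAbs → D i = ⊥ := by
  let I := {i : ℤ | D i ≠ ⊥}
  have hv : ∀ i : I, ∃ v ∈ D i, v ≠ 0 := fun i => (Submodule.ne_bot_iff _).1 i.2
  choose v hv hv0 using hv
  have hli : LinearIndependent k v :=
    (hD.comp Subtype.val_injective).linearIndependent (fun i : I => D i) hv hv0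
  have hli' : LinearIndependent k fun i : I => (⟨v i, hU _ (hv i)⟩ : U) :=
    LinearIndependent.of_comp U.subtype hli
  have hfin : Finite I := hli'.finite
  have hfin' : I.Finite := hfin
  refine ⟨hfin'.toFinset.sup Int.natAbs + 1, fun i hi => ?_⟩
  by_contra h
  have := Finset.le_sup (f := Int.natAbs) (hfin'.mem_toFinset.2 h)
  omega

/-- Division with remainder by `p` shows that the polynomials of degree less than `p.natDegree`
already have the full image. -/
theorem finiteDimensional_range_of_mul_eq_zero {k V : Type*} [Field k] [AddCommGroup V]
    [Module k V] (L : k[X] →ₗ[k] V) {p : k[X]} (hp : p ≠ 0) (hL : ∀ q, L (q * p) = 0) :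
    FiniteDimensional k (LinearMap.range L) := by
  have hle : LinearMap.range L ≤ (degreeLT k p.natDegree).map L := by
    rintro _ ⟨q, rfl⟩
    refine ⟨q % p, ?_, ?_⟩
    · rw [SetLike.mem_coe, mem_degreeLT, ← degree_eq_natDegree hp]
      exact degree_mod_lt q hp
    · conv_rhs => rw [← EuclideanDomain.mod_add_div q p]
      rw [map_add, mul_comm, hL, add_zero]
  have : FiniteDimensional k (degreeLT k p.natDegree) :=
    (degreeLTEquiv k p.natDegree).symm.finiteDimensional
  exact Submodule.finiteDimensional_of_le hle

namespace GrMod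

section General

variable {k : Type u} [Field k] {Γ : Type w} [AddCommGroup Γ] [DecidableEq Γ]
  {R : Type u} [Ring R] [Algebra k R] {𝒜 : Γ → Submodule k R} [GradedAlgebra 𝒜]

theorem exists_proj_commute_mem {M N : GrMod 𝒜} (f : M ⟶ N) :
    ∃ (p : Γ → M.carrier →ₗ[k] M.carrier) (q : Γ → N.carrier →ₗ[k] N.carrier),
      (∀ γ v, p γ v ∈ M.deg γ) ∧ (∀ v, ∃ t : Finset Γ, v = ∑ γ ∈ t, p γ v) ∧
      (∀ γ, ∀ v ∈ N.deg γ, q γ v = v) ∧ ∀ γ v, q γ (f.hom v) = f.hom (p γ v) := by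
  classical
  obtain ⟨q, -, hq, hq'⟩ := N.exists_proj
  let D := M.isInternal.chooseDecomposition
  let p : Γ → M.carrier →ₗ[k] M.carrier := fun γ => (M.deg γ).subtype ∘ₗ
    DirectSum.component k Γ (fun i => M.deg i) γ ∘ₗ (decomposeLinearEquiv M.deg).toLinearMap
  have hp : ∀ γ v, p γ v = (decompose M.deg v γ : M.carrier) := fun γ v => rfl
  refine ⟨p, q, fun γ v => Submodule.coe_mem _, fun v => ⟨(decompose M.deg v).support,
    (DirectSum.sum_support_decompose M.deg v).symm⟩, hq, fun γ => ?_⟩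
  have : (q γ) ∘ₗ f.hom.restrictScalars k = f.hom.restrictScalars k ∘ₗ p γ := by
    refine ext_of_deg fun δ v hv => ?_
    change q γ (f.hom v) = f.hom (p γ v)
    by_cases h : δ = γ
    · subst h
      rw [hp, decompose_of_mem_same M.deg hv, hq _ _ (f.map_mem hv)]
    · rw [hp, decompose_of_mem_ne M.deg hv h, hq' _ _ h _ (f.map_mem hv), map_zero]
  exact LinearMap.congr_fun this

theorem exists_preimage_mem_deg {M N : GrMod 𝒜} (f : M ⟶ N) {γ : Γ} {n : N.carrier}
    (hn : n ∈ N.deg γ) (h : ∃ v, f.hom v = n) : ∃ v ∈ M.deg γ, f.hom v = n := by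
  obtain ⟨p, q, hp, -, hq, hc⟩ := exists_proj_commute_mem f
  obtain ⟨v, rfl⟩ := h
  exact ⟨p γ v, hp γ v, by rw [← hc, hq _ _ hn]⟩

theorem ker_le_iSup {M N : GrMod 𝒜} (f : M ⟶ N) : LinearMap.ker (f.hom.restrictScalars k) ≤
    ⨆ γ, LinearMap.ker (f.hom.restrictScalars k) ⊓ M.deg γ := by
  obtain ⟨p, q, hp, hsum, hq, hc⟩ := exists_proj_commute_mem f
  intro v hv
  obtain ⟨t, ht⟩ := hsum v
  rw [ht]
  refine Submodule.sum_mem _ fun γ _ => Submodule.mem_iSup_of_mem γ ⟨?_, hp γ v⟩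
  change f.hom (p γ v) = 0
  rw [← hc, show f.hom v = 0 from hv, map_zero]

end General

variable {k : Type u} [Field k] {m : ℕ} {M N : GrMod (GWA.grading (congPoly k m))}

theorem iSupIndep_deg (M : GrMod (GWA.grading (congPoly k m))) : iSupIndep M.deg :=
  ((isInternal_submodule_iff_iSupIndep_and_iSup_eq_top _).1 M.isInternal).1

theorem exists_ker_bound {f : M ⟶ N} (hf : isoModFdim _ f) :
    ∃ n : ℕ, ∀ i : ℤ, n ≤ i.natAbs → ∀ v ∈ M.deg i, f.hom v = 0 → v = 0 := by
  have := hf.1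
  obtain ⟨n, hn⟩ := exists_natAbs_bound_of_iSupIndep
    (D := fun i => LinearMap.ker (f.hom.restrictScalars k) ⊓ M.deg i)
    (M.iSupIndep_deg.mono fun i => inf_le_right) (LinearMap.ker (f.hom.restrictScalars k))
    fun i => inf_le_left
  refine ⟨n, fun i hi v hv hfv => ?_⟩
  have : v ∈ LinearMap.ker (f.hom.restrictScalars k) ⊓ M.deg i := ⟨hfv, hv⟩
  rwa [hn i hi, Submodule.mem_bot] at this

theorem exists_coker_bound {f : M ⟶ N} (hf : isoModFdim _ f) :
    ∃ n : ℕ, ∀ i : ℤ, n ≤ i.natAbs → ∀ v ∈ N.deg i, ∃ w ∈ M.deg i, f.hom w = v := by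
  have h2 : FiniteDimensional k (N.carrier ⧸ LinearMap.range f.hom) := hf.2
  obtain ⟨n, hn⟩ := exists_natAbs_bound_of_iSupIndep
    ((isInternal_submodule_iff_iSupIndep_and_iSup_eq_top _).1 (coker_isInternal f)).1 ⊤
    fun i => le_top
  refine ⟨n, fun i hi v hv => exists_preimage_mem_deg f hv ?_⟩
  have : cokerLin f v ∈ (N.deg i).map (cokerLin f) := ⟨v, hv, rfl⟩
  rw [hn i hi, Submodule.mem_bot, cokerLin_eq_zero] at this
  exact this

variable [CharZero k]

/-- A finite-dimensional kernel lives in finitely many degrees, so a family killed by `f` vanishes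
at both ends and `eq_zero_of_vanish` applies. -/
theorem famMapLin_injective {f : M ⟶ N} (hf : isoModFdim _ f) :
    Function.Injective (famMapLin f) := by
  rw [injective_iff_map_eq_zero]
  intro φ hφ
  obtain ⟨n, hn⟩ := exists_ker_bound hf
  refine M.famVal_injective (Finsupp.ext fun J => ?_)
  have hu := M.mem_gfam.1 (M.famVal_mem φ J)
  have h0 : ∀ i, f.hom (M.famVal φ J i) = 0 := fun i => by
    rw [← famVal_famMapLin, hφ, map_zero]; rfl
  rw [map_zero]
  exact M.chain.eq_zero_of_vanish (isCoprime_linFactor k) (isHalfLine_ptype J) hu.1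
    (a₀ := -n) (b₀ := n) (fun i hi => hn i (by omega) _ (hu.2 i) (h0 i))
    (fun i hi => hn i (by omega) _ (hu.2 i) (h0 i))

/-- One member far to the left and one far to the right can be lifted through `f`. The families in
`M` extending these lifts map to two coprime multiples of the given family, so Bézout lifts the
family itself. -/
theorem famMapLin_surjective {f : M ⟶ N} (hf : isoModFdim _ f) :
    Function.Surjective (famMapLin f) := by
  intro φ
  induction φ using N.totalFam_induction with
  | h0 => exact ⟨0, map_zero _⟩
  | hadd φ ψ h h' =>
    obtain ⟨a, rfl⟩ := h
    obtain ⟨b, rfl⟩ := h'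
    exact ⟨a + b, map_add _ _ _⟩
  | hs J u =>
    obtain ⟨n, hn⟩ := exists_coker_bound hf
    obtain ⟨hu, hu'⟩ := N.mem_gfam.1 u.2
    let K : Submodule k (ℤ → N.carrier) := (M.gfam J).map ((f.hom.restrictScalars k).compLeft ℤ)
    have hK : ∀ p, ∀ w ∈ K, N.chain.polyAct p w ∈ K := by
      rintro p _ ⟨w, hw, rfl⟩
      refine ⟨_, M.polyAct_mem_gfam p hw, ?_⟩
      funext i
      exact (isHom_chain f).act _ _ _
    obtain ⟨a, ha, S, h1, h2⟩ := (isHalfLine_ptype J).exists_left m (-n)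
    obtain ⟨b, hb, S', h1', h2'⟩ := (isHalfLine_ptype J).exists_right m n
    obtain ⟨va, hva, hva'⟩ := hn a (by omega) _ (hu' a)
    obtain ⟨vb, hvb, hvb'⟩ := hn b (by omega) _ (hu' b)
    have hmem : u.1 ∈ K := by
      refine N.chain.mem_of_polyAct_mem (isCoprime_linFactor k) (t := ptype J) hK
        (extWeight_mem _ m (fun n hn => ((h2 n).1 hn).1) a)
        (Chain.coextWeight_mem (fun n hn => ((h2' n).1 hn).1) b) ?_ ?_
      · rw [← N.chain.ext_apply_of_mem h1 h2 hu, ← hva']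
        refine ⟨M.chain.ext S a va, M.mem_gfam.2 ⟨M.chain.ext_mem h1 h2 va,
          M.chain.ext_apply_mem (fun _ _ _ => M.act_mem_deg) (fun _ _ => M.x_mem_deg)
            (fun _ _ => M.y_mem_deg) _ hva⟩, funext fun i => ?_⟩
        exact ((isHom_chain f).ext S a va i).symm
      · rw [← N.chain.coext_apply_of_mem h1' h2' hu, ← hvb']
        refine ⟨M.chain.coext S' b vb, M.mem_gfam.2 ⟨M.chain.coext_mem h1' h2' vb,
          M.chain.coext_apply_mem (fun _ _ _ => M.act_mem_deg) (fun _ _ => M.x_mem_deg)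
            (fun _ _ => M.y_mem_deg) _ hvb⟩, funext fun i => ?_⟩
        exact ((isHom_chain f).coext S' b vb i).symm
    obtain ⟨w, hw, hw'⟩ := hmem
    refine ⟨M.famSingle J ⟨w, hw⟩, ?_⟩
    rw [famMapLin_famSingle]
    exact congrArg _ (Subtype.ext hw')

theorem isIso_famMap (hm : 0 < m) {f : M ⟶ N} (hf : isoModFdim _ f) : IsIso (famMap hm f) :=
  isIso_of_bijective _ ⟨famMapLin_injective hf, famMapLin_surjective hf⟩

/-! ### Finite-dimensionality of kernels and cokernels -/

theorem move_act (M : GrMod (GWA.grading (congPoly k m))) (d : ℤ) (p : k[X]) (v : M.carrier)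
    (i : ℤ) : M.move d (M.chain.act d p v) i = M.chain.act i p (M.move d v i) := by
  rcases le_total d i with h | h
  · rw [M.move_of_le h, M.move_of_le h, Chain.x_pow_act, show d + ((i - d).toNat : ℤ) = i by omega]
  · rw [M.move_of_ge h, M.move_of_ge h, Chain.y_pow_act, show d - ((d - i).toNat : ℤ) = i by omega]

/-- Every value of a family in `N` lies in the image of `f`. For a generator `v`, this covers the
multiples of `v` in all degrees at distance at least `m` from that of `v`; in the finitely many
other degrees they are annihilated modulo the image by a fixed nonzero polynomial. -/
theorem coker_finiteDimensional {f : M ⟶ N} (hf : Function.Surjective (famMapLin f)) :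
    FiniteDimensional k (N.carrier ⧸ LinearMap.range (f.hom.restrictScalars k)) := by
  classical
  obtain ⟨s, d, hd, -, hs⟩ := N.exists_generators
  have hgf : ∀ {J} {u : ℤ → N.carrier}, u ∈ N.gfam J → ∀ i, ∃ w, f.hom w = u i := by
    intro J u hu i
    obtain ⟨φ, hφ⟩ := hf (N.famSingle J ⟨u, hu⟩)
    refine ⟨M.famVal φ J i, ?_⟩
    rw [← famVal_famMapLin, hφ, famVal_famSingle, Finsupp.single_eq_same]
  have hfx : ∀ (i : ℤ) p {v}, (∃ w, f.hom w = v) → ∃ w, f.hom w = N.chain.act i p v := by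
    rintro i p _ ⟨w, rfl⟩
    exact ⟨_, (isHom_chain f).act i p w⟩
  have hmove : ∀ (d : ℤ) {v}, (∃ w, f.hom w = v) → ∀ i, ∃ w, f.hom w = N.move d v i := by
    rintro d _ ⟨w, rfl⟩ i
    refine ⟨M.move d w i, ?_⟩
    have hx : ∀ j : ℕ, f.hom ((M.chain.x ^ j) w) = (N.chain.x ^ j) (f.hom w) := by
      intro j
      induction j with
      | zero => rfl
      | succ j ih =>
        rw [pow_succ', pow_succ', Module.End.mul_apply, Module.End.mul_apply, ← ih]
        exact (isHom_chain f).x _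
    have hy : ∀ j : ℕ, f.hom ((M.chain.y ^ j) w) = (N.chain.y ^ j) (f.hom w) := by
      intro j
      induction j with
      | zero => rfl
      | succ j ih =>
        rw [pow_succ', pow_succ', Module.End.mul_apply, Module.End.mul_apply, ← ih]
        exact (isHom_chain f).y _
    unfold move
    split_ifs
    · exact hx _
    · exact hy _
  let π : N.carrier →ₗ[k] N.carrier ⧸ LinearMap.range (f.hom.restrictScalars k) :=
    (LinearMap.range (f.hom.restrictScalars k)).mkQ
  have hπ : ∀ {v}, (∃ w, f.hom w = v) → π v = 0 := fun ⟨w, hw⟩ =>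
    (Submodule.Quotient.mk_eq_zero _).2 ⟨w, hw⟩
  have hfar : ∀ v ∈ s, ∀ i : ℤ, m ≤ (i - d v).natAbs → (N.orbit (d v) v i).map π = ⊥ := by
    intro v hv i hi
    rw [eq_bot_iff]
    rintro _ ⟨_, ⟨p, rfl⟩, rfl⟩
    refine hπ (hfx i p ?_)
    rcases le_total (d v) i with h | h
    · obtain ⟨J, hJ⟩ := N.exists_rightExt_mem (d := d v)
      have := hgf (hJ v (hd v hv)) i
      have h' := N.chain.rightExt_apply (d := d v) (j := (i - d v).toNat) (by omega) v
      rw [show d v + ((i - d v).toNat : ℤ) = i by omega] at h'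
      rwa [N.move_of_le h, ← h']
    · obtain ⟨J, hJ⟩ := N.exists_leftExt_mem (d := d v)
      have := hgf (hJ v (hd v hv)) i
      have h' := N.chain.leftExt_apply (d := d v) (j := (d v - i).toNat) (by omega) v
      rw [show d v - ((d v - i).toNat : ℤ) = i by omega] at h'
      rwa [N.move_of_ge h, ← h']
  -- The multiple `p • v` is a value of the right extension of `v`, hence in the image of `f`, and
  -- so are all its moves to other degrees.
  have hnear : ∀ v ∈ s, ∀ i : ℤ, FiniteDimensional k ((N.orbit (d v) v i).map π) := by
    intro v hv i
    obtain ⟨p, hp, hp'⟩ := N.chain.exists_rightExt_self (linFactor_ne_zero k) (d v)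
    obtain ⟨J, hJ⟩ := N.exists_rightExt_mem (d := d v)
    have h := hgf (hJ v (hd v hv)) (d v)
    rw [hp'] at h
    rw [orbit, ← LinearMap.range_comp]
    refine finiteDimensional_range_of_mul_eq_zero _ hp fun q => ?_
    change π (N.chain.act i (q * p) (N.move (d v) v i)) = 0
    rw [N.chain.act_mul, ← move_act]
    exact hπ (hfx _ _ (hmove _ h i))
  let T : s → Submodule k (N.carrier ⧸ LinearMap.range (f.hom.restrictScalars k)) := fun v =>
    ⨆ i : Finset.Ioo (d v.1 - m) (d v.1 + m), (N.orbit (d v.1) v.1 i).map π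
  have hT : FiniteDimensional k (⨆ v, T v : Submodule k _) := by
    have : ∀ v, FiniteDimensional k (T v) := fun v => by
      have : ∀ i : Finset.Ioo (d v.1 - m) (d v.1 + m),
          FiniteDimensional k ((N.orbit (d v.1) v.1 i).map π) := fun i => hnear v.1 v.2 i
      exact Submodule.finiteDimensional_iSup _
    exact Submodule.finiteDimensional_iSup _
  have htop : (⨆ v, T v) = ⊤ := by
    have hle : (⊤ : Submodule k N.carrier) ≤ (⨆ v, T v).comap π := by
      rw [← N.iSup_deg]
      refine iSup_le fun i => (hs i).trans ?_
      refine iSup₂_le fun v hv => Submodule.map_le_iff_le_comap.1 ?_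
      by_cases h : m ≤ (i - d v).natAbs
      · exact (hfar v hv i h).le.trans bot_le
      · refine le_trans ?_ (le_iSup T ⟨v, hv⟩)
        exact le_iSup (fun i : Finset.Ioo (d v - m) (d v + m) => (N.orbit (d v) v i).map π)
          ⟨i, Finset.mem_Ioo.2 ⟨by omega, by omega⟩⟩
    rw [eq_top_iff]
    rintro q -
    obtain ⟨n, rfl⟩ := Submodule.mkQ_surjective _ q
    exact hle (Submodule.mem_top (x := n))
  rw [htop] at hT
  exact Module.Finite.equiv (Submodule.topEquiv (R := k))

/-! ### Noetherian arguments for the components and kernels -/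

/-- The map from a free module over the polynomials onto the component of degree `i` given by
generators. -/
noncomputable def genMap (M : GrMod (GWA.grading (congPoly k m))) (s : Finset M.carrier)
    (d : M.carrier → ℤ) (i : ℤ) : (s → k[X]) →ₗ[k] M.carrier :=
  ∑ v : s, ((LinearMap.applyₗ (M.move (d v.1) v.1 i)).comp (M.chain.act i).toLinearMap).comp
    (LinearMap.proj v)

theorem genMap_apply (s : Finset M.carrier) (d : M.carrier → ℤ) (i : ℤ) (P : s → k[X]) :
    M.genMap s d i P = ∑ v : s, M.chain.act i (P v) (M.move (d v.1) v.1 i) := by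
  rw [genMap, LinearMap.sum_apply]; rfl

theorem genMap_smul (s : Finset M.carrier) (d : M.carrier → ℤ) (i : ℤ) (q : k[X])
    (P : s → k[X]) : M.genMap s d i (q • P) = M.chain.act i q (M.genMap s d i P) := by
  rw [genMap_apply, genMap_apply, map_sum]
  exact Finset.sum_congr rfl fun v _ => M.chain.act_mul _ _ _ _

theorem x_genMap {s : Finset M.carrier} {d : M.carrier → ℤ} {i : ℤ} (hi : ∀ v ∈ s, d v ≤ i)
    (P : s → k[X]) : M.chain.x (M.genMap s d i P) = M.genMap s d (i + 1) P := by
  rw [genMap_apply, genMap_apply, map_sum]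
  refine Finset.sum_congr rfl fun v _ => ?_
  rw [M.chain.x_act, M.x_move (hi v.1 v.2)]

theorem y_genMap {s : Finset M.carrier} {d : M.carrier → ℤ} {i : ℤ} (hi : ∀ v ∈ s, i < d v)
    (P : s → k[X]) : M.chain.y (M.genMap s d (i + 1) P) = M.genMap s d i P := by
  rw [genMap_apply, genMap_apply, map_sum]
  refine Finset.sum_congr rfl fun v _ => ?_
  rw [M.chain.y_act, M.y_move (hi v.1 v.2)]

theorem exists_genMap_eq {s : Finset M.carrier} {d : M.carrier → ℤ}
    (hs : ∀ i, M.deg i ≤ ⨆ v ∈ s, M.orbit (d v) v i) {i : ℤ} {v : M.carrier} (hv : v ∈ M.deg i) :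
    ∃ P, M.genMap s d i P = v := by
  classical
  refine (show (⨆ v ∈ s, M.orbit (d v) v i) ≤ LinearMap.range (M.genMap s d i) from
    iSup₂_le fun v hv => ?_) (hs i hv)
  rintro _ ⟨p, rfl⟩
  refine ⟨Pi.single ⟨v, hv⟩ p, ?_⟩
  rw [genMap_apply, Finset.sum_eq_single ⟨v, hv⟩, Pi.single_eq_same]
  · rfl
  · intro w _ hw
    rw [Pi.single_eq_of_ne hw, map_zero]; rfl
  · simp

/-- The coefficients whose combination in degree `i` is in the kernel of `f`. -/
noncomputable def genKer (f : M ⟶ N) (s : Finset M.carrier) (d : M.carrier → ℤ) (i : ℤ) :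
    Submodule k[X] (s → k[X]) where
  carrier := {P | f.hom (M.genMap s d i P) = 0}
  add_mem' {P Q} hP hQ := by
    change f.hom _ = 0
    rw [map_add, map_add, show f.hom (M.genMap s d i P) = 0 from hP,
      show f.hom (M.genMap s d i Q) = 0 from hQ, add_zero]
  zero_mem' := by
    change f.hom _ = 0
    rw [map_zero, map_zero]
  smul_mem' q P hP := by
    change f.hom _ = 0
    rw [genMap_smul]
    refine ((isHom_chain f).act _ _ _).trans ?_
    rw [show (f.hom.restrictScalars k) (M.genMap s d i P) = 0 from hP, map_zero]

/-- To the right of the degrees of all generators, `x` keeps the coefficients of a combination, so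
the relation modules in `k[X]^s` form an ascending chain. Once it is stationary, `x` creates no new
relation. -/
theorem exists_x_injective (M : GrMod (GWA.grading (congPoly k m))) :
    ∃ n : ℤ, ∀ i, n ≤ i → ∀ v ∈ M.deg i, M.chain.x v = 0 → v = 0 := by
  obtain ⟨s, d, hd, -, hs⟩ := M.exists_generators
  obtain ⟨a, ha⟩ : ∃ a : ℕ, ∀ v ∈ s, (d v).natAbs ≤ a :=
    ⟨s.sup fun v => (d v).natAbs, fun v hv => Finset.le_sup (f := fun v => (d v).natAbs) hv⟩
  have hstep : ∀ j : ℕ, ∀ P : s → k[X],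
      M.chain.x (M.genMap s d (a + j) P) = M.genMap s d (a + (j + 1 : ℕ)) P := by
    intro j P
    rw [x_genMap fun v hv => by have := ha v hv; omega]
    push_cast; rw [add_assoc]
  let c : ℕ →o Submodule k[X] (s → k[X]) :=
    ⟨fun j => genKer (𝟙 M) s d (a + j), monotone_nat_of_le_succ fun j P hP => by
      change M.genMap s d (a + (j + 1 : ℕ)) P = 0
      rw [← hstep, show M.genMap s d (a + j) P = 0 from hP, map_zero]⟩
  obtain ⟨j₀, hj₀⟩ := monotone_stabilizes_iff_noetherian.2
    (inferInstance : IsNoetherian k[X] (s → k[X])) c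
  refine ⟨a + j₀, fun i hi v hv hxv => ?_⟩
  obtain ⟨j, rfl⟩ := Int.le.dest (show (a : ℤ) ≤ i by omega)
  obtain ⟨P, rfl⟩ := exists_genMap_eq hs hv
  have h1 : P ∈ c (j + 1) := by
    change M.genMap s d (a + (j + 1 : ℕ)) P = 0
    rw [← hstep, hxv]
  rw [← hj₀ (j + 1) (by omega), hj₀ j (by omega)] at h1
  exact h1

theorem exists_y_injective (M : GrMod (GWA.grading (congPoly k m))) :
    ∃ n : ℤ, ∀ i, i ≤ n → ∀ v ∈ M.deg i, M.chain.y v = 0 → v = 0 := by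
  obtain ⟨s, d, hd, -, hs⟩ := M.exists_generators
  obtain ⟨a, ha⟩ : ∃ a : ℕ, ∀ v ∈ s, (d v).natAbs ≤ a :=
    ⟨s.sup fun v => (d v).natAbs, fun v hv => Finset.le_sup (f := fun v => (d v).natAbs) hv⟩
  have hstep : ∀ j : ℕ, ∀ P : s → k[X],
      M.chain.y (M.genMap s d (-a - j) P) = M.genMap s d (-a - (j + 1 : ℕ)) P := by
    intro j P
    rw [← y_genMap (i := -a - (j + 1 : ℕ)) fun v hv => by have := ha v hv; omega]
    congr 3
    push_cast; ring
  let c : ℕ →o Submodule k[X] (s → k[X]) :=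
    ⟨fun j => genKer (𝟙 M) s d (-a - j), monotone_nat_of_le_succ fun j P hP => by
      change M.genMap s d (-a - (j + 1 : ℕ)) P = 0
      rw [← hstep, show M.genMap s d (-a - j) P = 0 from hP, map_zero]⟩
  obtain ⟨j₀, hj₀⟩ := monotone_stabilizes_iff_noetherian.2
    (inferInstance : IsNoetherian k[X] (s → k[X])) c
  refine ⟨-a - j₀, fun i hi v hv hyv => ?_⟩
  obtain ⟨j, hj⟩ := Int.le.dest (show i ≤ -(a : ℤ) by omega)
  obtain rfl : i = -a - j := by omega
  obtain ⟨P, rfl⟩ := exists_genMap_eq hs hv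
  have h1 : P ∈ c (j + 1) := by
    change M.genMap s d (-a - (j + 1 : ℕ)) P = 0
    rw [← hstep, hyv]
  rw [← hj₀ (j + 1) (by omega), hj₀ j (by omega)] at h1
  exact h1

/-- If `v` of degree `i` is in the kernel, its extensions are families killed by `f`, hence zero.
Far to the right this gives `x^m v = 0`, far to the left `y^m v = 0`, and so `v = 0` there. In each
of the remaining finitely many degrees the kernel is annihilated by a fixed nonzero polynomial and
finitely generated over `k[z]`. -/
theorem ker_finiteDimensional {f : M ⟶ N} (hf : Function.Injective (famMapLin f)) :
    FiniteDimensional k (LinearMap.ker (f.hom.restrictScalars k)) := by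
  obtain ⟨s, d, hd, -, hs⟩ := M.exists_generators
  have hgf : ∀ {J} {u : ℤ → M.carrier} (hu : u ∈ M.gfam J), (∀ i, f.hom (u i) = 0) → u = 0 := by
    intro J u hu h
    have : famMapLin f (M.famSingle J ⟨u, hu⟩) = 0 := by
      rw [famMapLin_famSingle]
      have h0 : (⟨_, comp_mem_gfam f hu⟩ : N.gfam J) = 0 := Subtype.ext (funext h)
      rw [h0, map_zero]
    have h' := congrArg M.famVal (hf (this.trans (map_zero _).symm))
    rw [famVal_famSingle, map_zero, Finsupp.single_eq_zero] at h'
    exact h'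
  have hR : ∀ {i : ℤ} {v}, v ∈ M.deg i → f.hom v = 0 → M.chain.rightExt i v = 0 := by
    intro i v hv hfv
    obtain ⟨J, hJ⟩ := M.exists_rightExt_mem (d := i)
    refine hgf (hJ v hv) fun j => ?_
    refine ((isHom_chain f).ext _ i v j).symm.trans ?_
    rw [show (f.hom.restrictScalars k) v = 0 from hfv, map_zero]; rfl
  have hL : ∀ {i : ℤ} {v}, v ∈ M.deg i → f.hom v = 0 → M.chain.leftExt i v = 0 := by
    intro i v hv hfv
    obtain ⟨J, hJ⟩ := M.exists_leftExt_mem (d := i)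
    refine hgf (hJ v hv) fun j => ?_
    refine ((isHom_chain f).coext _ i v j).symm.trans ?_
    rw [show (f.hom.restrictScalars k) v = 0 from hfv, map_zero]; rfl
  obtain ⟨b, hb⟩ := M.exists_x_injective
  obtain ⟨a, ha⟩ := M.exists_y_injective
  have hxm : ∀ j : ℕ, ∀ i, b ≤ i → ∀ v ∈ M.deg i, (M.chain.x ^ j) v = 0 → v = 0 := by
    intro j
    induction j with
    | zero => exact fun i _ v _ h => h
    | succ j ih =>
      intro i hi v hv h
      rw [pow_succ, Module.End.mul_apply] at h
      exact hb i hi v hv (ih (i + 1) (by omega) _ (M.x_mem_deg hv) h)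
  have hym : ∀ j : ℕ, ∀ i, i ≤ a → ∀ v ∈ M.deg i, (M.chain.y ^ j) v = 0 → v = 0 := by
    intro j
    induction j with
    | zero => exact fun i _ v _ h => h
    | succ j ih =>
      intro i hi v hv h
      rw [pow_succ, Module.End.mul_apply] at h
      refine ha i hi v hv (ih (i - 1) (by omega) _ (M.y_mem_deg ?_) h)
      rwa [sub_add_cancel]
  have hfar : ∀ i, (i ≤ a ∨ b ≤ i) → LinearMap.ker (f.hom.restrictScalars k) ⊓ M.deg i = ⊥ := by
    intro i hi
    rw [eq_bot_iff]
    rintro v ⟨hfv, hv⟩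
    rcases hi with hi | hi
    · refine hym m i hi v hv ?_
      rw [← M.chain.leftExt_apply (d := i) le_rfl, hL hv hfv]; rfl
    · refine hxm m i hi v hv ?_
      rw [← M.chain.rightExt_apply (d := i) le_rfl, hR hv hfv]; rfl
  have hnear : ∀ i, FiniteDimensional k
      (LinearMap.ker (f.hom.restrictScalars k) ⊓ M.deg i : Submodule k M.carrier) := by
    intro i
    obtain ⟨p, hp, hp'⟩ := M.chain.exists_rightExt_self (linFactor_ne_zero k) i
    -- Finite generation of the kernel in degree `i` is obtained upstairs, for its preimage in
    -- `k[X]^s`.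
    obtain ⟨S, hS⟩ := IsNoetherian.noetherian (genKer f s d i)
    have hmem : ∀ P, M.genMap s d i P ∈ M.deg i := by
      intro P
      rw [genMap_apply]
      exact Submodule.sum_mem _ fun v _ => M.act_mem_deg (M.move_mem_deg (hd v.1 v.2) i)
    let L : (s → k[X]) → k[X] →ₗ[k] M.carrier := fun P =>
      (LinearMap.applyₗ (M.genMap s d i P)).comp (M.chain.act i).toLinearMap
    have hL' : ∀ P : S, FiniteDimensional k (LinearMap.range (L P.1)) := by
      intro P
      have hP : P.1 ∈ genKer f s d i := hS ▸ Submodule.subset_span P.2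
      refine finiteDimensional_range_of_mul_eq_zero _ hp fun q => ?_
      change M.chain.act i (q * p) (M.genMap s d i P.1) = 0
      rw [M.chain.act_mul, ← hp', hR (hmem _) hP, Pi.zero_apply, map_zero]
    have : FiniteDimensional k (⨆ P : S, LinearMap.range (L P.1) : Submodule k _) :=
      Submodule.finiteDimensional_iSup _
    refine Submodule.finiteDimensional_of_le (S₂ := ⨆ P : S, LinearMap.range (L P.1)) ?_
    rintro v ⟨hfv, hv⟩
    obtain ⟨P, rfl⟩ := exists_genMap_eq hs hv
    have hP : P ∈ Submodule.span k[X] (S : Set (s → k[X])) := hS ▸ hfv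
    have hspan : ∀ q : k[X], M.chain.act i q (M.genMap s d i P) ∈
        ⨆ P : S, LinearMap.range (L P.1) := by
      clear hfv hv
      induction hP using Submodule.span_induction with
      | mem P h => exact fun q => Submodule.mem_iSup_of_mem ⟨P, h⟩ ⟨q, rfl⟩
      | zero => intro q; rw [map_zero, map_zero]; exact zero_mem _
      | add P Q _ _ hP hQ => intro q; rw [map_add, map_add]; exact add_mem (hP q) (hQ q)
      | smul r P _ hP => intro q; rw [genMap_smul, ← M.chain.act_mul]; exact hP _
    simpa using hspan 1
  have : ∀ i : Finset.Ioo a b, FiniteDimensional k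
      (LinearMap.ker (f.hom.restrictScalars k) ⊓ M.deg i : Submodule k M.carrier) :=
    fun i => hnear i
  refine Submodule.finiteDimensional_of_le (S₂ := ⨆ i : Finset.Ioo a b,
    LinearMap.ker (f.hom.restrictScalars k) ⊓ M.deg i) ((ker_le_iSup f).trans (iSup_le fun i => ?_))
  by_cases h : i ≤ a ∨ b ≤ i
  · rw [hfar i h]; exact bot_le
  · push Not at h
    exact le_iSup (fun i : Finset.Ioo a b => LinearMap.ker (f.hom.restrictScalars k) ⊓ M.deg i)
      ⟨i, Finset.mem_Ioo.2 h⟩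

end GrMod

/-! ### The left adjoint of the functor of families -/

/-- Right modules over `A(f)` are given by operators which satisfy the relations. -/
theorem GWA.exists_rep {k : Type u} [Field k] (f : k[X]) {E : Type*} [Ring E] [Algebra k E]
    (x y z : E) (hxz : z * x = x * (z + 1)) (hyz : z * y = y * (z - 1)) (hxy : y * x = aeval z f)
    (hyx : x * y = aeval (z - 1) f) : ∃ ρ : (GWA f)ᵐᵒᵖ →ₐ[k] E,
      ρ (MulOpposite.op (GWA.gen f .x)) = x ∧ ρ (MulOpposite.op (GWA.gen f .y)) = y ∧
        ρ (MulOpposite.op (GWA.gen f .z)) = z := by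
  -- The relations of the free algebra are checked in `Eᵐᵒᵖ`, because the given operators act from
  -- the right.
  let g : GWA.Gen → Eᵐᵒᵖ
    | .x => MulOpposite.op x
    | .y => MulOpposite.op y
    | .z => MulOpposite.op z
  have haeval : ∀ (e : E) (p : k[X]), aeval (MulOpposite.op e) p = MulOpposite.op (aeval e p) := by
    intro e p
    induction p using Polynomial.induction_on' with
    | add p q hp hq => simp [hp, hq]
    | monomial n a =>
      rw [aeval_monomial, aeval_monomial, MulOpposite.op_mul, MulOpposite.op_pow,
        ← MulOpposite.algebraMap_apply]
      exact Algebra.commutes a _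
  have hrel : ∀ ⦃a b : FreeAlgebra k GWA.Gen⦄, GWA.Rel f a b →
      FreeAlgebra.lift k g a = FreeAlgebra.lift k g b := by
    intro a b h
    cases h with
    | xz =>
      simp only [map_mul, map_add, map_one, FreeAlgebra.lift_ι_apply, g]
      exact congrArg MulOpposite.op hxz
    | yz =>
      simp only [map_mul, map_sub, map_one, FreeAlgebra.lift_ι_apply, g]
      exact congrArg MulOpposite.op hyz
    | xy =>
      rw [← Polynomial.aeval_algHom_apply]
      simp only [map_mul, FreeAlgebra.lift_ι_apply, g, haeval]
      exact congrArg MulOpposite.op hxy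
    | yx =>
      rw [← Polynomial.aeval_algHom_apply]
      simp only [map_mul, map_sub, map_one, FreeAlgebra.lift_ι_apply, g]
      rw [← MulOpposite.op_one, ← MulOpposite.op_sub, haeval]
      exact congrArg MulOpposite.op hyx
  let φ : GWA f →ₐ[k] Eᵐᵒᵖ := RingQuot.liftAlgHom k ⟨FreeAlgebra.lift k g, hrel⟩
  have hφ : ∀ i, φ (GWA.gen f i) = g i := fun i => by
    rw [GWA.gen, RingQuot.liftAlgHom_mkAlgHom_apply, FreeAlgebra.lift_ι_apply]
  refine ⟨AlgHom.opComm φ, ?_, ?_, ?_⟩ <;> simp [AlgHom.opComm, hφ, g]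

/-- The polynomials in `z` in `B`. -/
noncomputable def BRing.ofPoly (k : Type u) [Field k] : k[X] →ₐ[k] BRing k :=
  aeval (BRing.gen k none)

namespace GrMod

section DegreewiseMaps

variable {k : Type u} [Field k] {Γ : Type w} [AddCommGroup Γ] [DecidableEq Γ]
  {R : Type u} [Ring R] [Algebra k R] {𝒜 : Γ → Submodule k R} [GradedAlgebra 𝒜]

/-- The linear map with given restrictions to the homogeneous components. -/
noncomputable def degLift (N : GrMod 𝒜) {T : Type*} [AddCommGroup T] [Module k T]
    (φ : ∀ γ, N.deg γ →ₗ[k] T) : N.carrier →ₗ[k] T :=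
  letI := N.isInternal.chooseDecomposition
  DirectSum.toModule k Γ T φ ∘ₗ (decomposeLinearEquiv N.deg).toLinearMap

theorem degLift_apply (N : GrMod 𝒜) {T : Type*} [AddCommGroup T] [Module k T]
    (φ : ∀ γ, N.deg γ →ₗ[k] T) {γ : Γ} (v : N.deg γ) : N.degLift φ v = φ γ v := by
  let := N.isInternal.chooseDecomposition
  change DirectSum.toModule k Γ T φ (decompose N.deg v.1) = _
  rw [decompose_coe]
  exact DirectSum.toModule_lof (φ := φ) k γ v

end DegreewiseMaps

/-! ### Operators on a graded `B`-module and the free chain over it -/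

variable {k : Type u} [Field k] (m : ℕ) (N : GrMod (BRing.grading k))

/-- The action of `B` on a graded module. -/
noncomputable def bAct : BRing k →ₐ[k] Module.End k N.carrier :=
  (Algebra.lsmul k k N.carrier).comp (AlgEquiv.toOpposite k (BRing k)).toAlgHom

theorem bAct_apply (r : BRing k) (v : N.carrier) : N.bAct r v = MulOpposite.op r • v := rfl

theorem bAct_comm (r s : BRing k) (v : N.carrier) :
    N.bAct r (N.bAct s v) = N.bAct s (N.bAct r v) := by
  exact LinearMap.congr_fun
    ((map_mul N.bAct r s).symm.trans ((congrArg N.bAct (mul_comm r s)).trans (map_mul _ s r))) v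

/-- The action of polynomials on a graded `B`-module. -/
noncomputable def pAct : k[X] →ₐ[k] Module.End k N.carrier := N.bAct.comp (BRing.ofPoly k)

theorem pAct_apply (p : k[X]) (v : N.carrier) : N.pAct p v = N.bAct (BRing.ofPoly k p) v := rfl

theorem pAct_mul (p q : k[X]) (v : N.carrier) : N.pAct (p * q) v = N.pAct p (N.pAct q v) := by
  rw [map_mul]; rfl

theorem pAct_C (c : k) (v : N.carrier) : N.pAct (C c) v = c • v :=
  LinearMap.congr_fun (N.pAct.commutes c) v

theorem pAct_mem_deg {J : ZFin} (p : k[X]) {v : N.carrier} (hv : v ∈ N.deg J) :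
    N.pAct p v ∈ N.deg J := by
  have hS : ∀ v ∈ N.deg J, N.bAct (BRing.gen k none) v ∈ N.deg J := by
    intro v hv
    have := N.smul_mem hv (gen_mem_wordGrading (BRing.gen k) BRing.genDeg none)
    rwa [show BRing.genDeg none = 0 from rfl, add_zero] at this
  have := aeval_mem hS p hv
  rwa [Polynomial.aeval_algHom_apply] at this

/-- The action of `bₙ` on a graded `B`-module. -/
noncomputable def toggleAct (n : ℤ) : Module.End k N.carrier := N.bAct (BRing.gen k (some n))

theorem toggleAct_mem_deg {J : ZFin} (n : ℤ) {v : N.carrier} (hv : v ∈ N.deg J) :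
    N.toggleAct n v ∈ N.deg (J + bdeg n) :=
  N.smul_mem hv (gen_mem_wordGrading (BRing.gen k) BRing.genDeg (some n))

theorem pAct_toggleAct (p : k[X]) (n : ℤ) (v : N.carrier) :
    N.pAct p (N.toggleAct n v) = N.toggleAct n (N.pAct p v) := N.bAct_comm _ _ _

/-- The action of polynomials which depend on the degree. -/
noncomputable def degAct (d : ZFin → k[X]) : Module.End k N.carrier :=
  N.degLift fun J => N.pAct (d J) ∘ₗ (N.deg J).subtype

theorem degAct_apply (d : ZFin → k[X]) {J : ZFin} {v : N.carrier} (hv : v ∈ N.deg J) :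
    N.degAct d v = N.pAct (d J) v := N.degLift_apply _ ⟨v, hv⟩

theorem degAct_degAct (d d' : ZFin → k[X]) (v : N.carrier) :
    N.degAct d (N.degAct d' v) = N.degAct (d * d') v := by
  refine LinearMap.congr_fun (f := N.degAct d ∘ₗ N.degAct d') (ext_of_deg fun J v hv => ?_) v
  rw [LinearMap.comp_apply, N.degAct_apply d' hv, N.degAct_apply d (N.pAct_mem_deg _ hv),
    N.degAct_apply _ hv, Pi.mul_apply, pAct_mul]

theorem degAct_const (p : k[X]) : N.degAct (fun _ => p) = N.pAct p :=
  ext_of_deg fun _ _ hv => N.degAct_apply _ hv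

theorem degAct_toggleAct (d : ZFin → k[X]) (n : ℤ) (v : N.carrier) :
    N.degAct d (N.toggleAct n v) = N.toggleAct n (N.degAct (fun J => d (J + bdeg n)) v) := by
  refine LinearMap.congr_fun (f := N.degAct d ∘ₗ N.toggleAct n)
    (g := N.toggleAct n ∘ₗ N.degAct fun J => d (J + bdeg n)) (ext_of_deg fun J v hv => ?_) v
  rw [LinearMap.comp_apply, LinearMap.comp_apply, N.degAct_apply _ hv,
    N.degAct_apply _ (N.toggleAct_mem_deg n hv), pAct_toggleAct]

/-- The operator `x` on the free chain over `N`. -/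
noncomputable def freeX : Module.End k (ℤ →₀ N.carrier) := Finsupp.lsum k fun i =>
  -- On the component `N_J` the step has the weight of the rank one chain of type `ptype J`: the
  -- free chain is the sum of the `N_J ⊗ L_J` over `k[z]`.
  Finsupp.lsingle (i + 1) ∘ₗ N.degAct fun J => stepWeight (linFactor k) m (ptype J) i

/-- The operator `y` on the free chain over `N`. -/
noncomputable def freeY : Module.End k (ℤ →₀ N.carrier) := Finsupp.lsum k fun i =>
  Finsupp.lsingle (i - 1) ∘ₗ
    N.degAct fun J => stepWeight (linFactor k) m (fun j => ¬ ptype J j) (i - 1)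

/-- The operator `z` on the free chain over `N`. -/
noncomputable def freeZ : Module.End k (ℤ →₀ N.carrier) := Finsupp.lsum k fun i =>
  Finsupp.lsingle i ∘ₗ N.pAct (linFactor k i)

theorem freeX_single (i : ℤ) (v : N.carrier) : N.freeX m (Finsupp.single i v) =
    Finsupp.single (i + 1) (N.degAct (fun J => stepWeight (linFactor k) m (ptype J) i) v) := by
  rw [freeX, Finsupp.lsum_single]; rfl

theorem freeY_single (i : ℤ) (v : N.carrier) : N.freeY m (Finsupp.single i v) =
    Finsupp.single (i - 1)
      (N.degAct (fun J => stepWeight (linFactor k) m (fun j => ¬ ptype J j) (i - 1)) v) := by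
  rw [freeY, Finsupp.lsum_single]; rfl

theorem freeZ_single (i : ℤ) (v : N.carrier) :
    N.freeZ (Finsupp.single i v) = Finsupp.single i (N.pAct (linFactor k i) v) := by
  rw [freeZ, Finsupp.lsum_single]; rfl

theorem aeval_freeZ_single (p : k[X]) (c i : ℤ) (v : N.carrier) :
    aeval (N.freeZ - algebraMap k _ (c : k)) p (Finsupp.single i v) =
      Finsupp.single i (N.pAct (p.comp (linFactor k (i - c))) v) := by
  have h := LinearMap.map_aeval_of_comm (Finsupp.lsingle (R := k) i)
    (S := N.pAct (linFactor k (i - c))) (T := N.freeZ - algebraMap k _ (c : k)) ?_ p v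
  · rw [Polynomial.aeval_algHom_apply] at h
    rw [Polynomial.comp_eq_aeval]
    exact h.symm
  · intro v
    rw [LinearMap.sub_apply]
    simp only [Finsupp.lsingle_apply]
    rw [freeZ_single, Module.algebraMap_end_apply, Finsupp.smul_single, ← Finsupp.single_sub]
    congr 1
    rw [linFactor, Int.cast_sub, C_sub, map_add, map_sub, linFactor, map_add, LinearMap.add_apply,
      LinearMap.sub_apply, LinearMap.add_apply, ← N.pAct_C (c : k) v]
    abel

theorem linFactor_mul_linFactor (i : ℤ) : (linFactor k i * linFactor k (i + m)) =
    (congPoly k m).comp (linFactor k i) := by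
  simp [congPoly, linFactor, add_assoc]

theorem freeZ_mul_freeX : N.freeZ * N.freeX m = N.freeX m * (N.freeZ + 1) := by
  refine Finsupp.lhom_ext fun i v => ?_
  rw [Module.End.mul_apply, Module.End.mul_apply, LinearMap.add_apply, Module.End.one_apply,
    map_add, freeX_single, freeZ_single, freeZ_single, freeX_single, ← Finsupp.single_add,
    ← map_add, ← N.degAct_const, degAct_degAct, ← N.degAct_const, mul_comm, ← degAct_degAct]
  congr 2
  rw [N.degAct_const, N.degAct_const]
  simp only [linFactor, Int.cast_add, Int.cast_one, map_add, map_one, LinearMap.add_apply]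
  simp [add_assoc]

theorem freeZ_mul_freeY : N.freeZ * N.freeY m = N.freeY m * (N.freeZ - 1) := by
  refine Finsupp.lhom_ext fun i v => ?_
  rw [Module.End.mul_apply, Module.End.mul_apply, LinearMap.sub_apply, Module.End.one_apply,
    map_sub, freeY_single, freeZ_single, freeZ_single, freeY_single, ← Finsupp.single_sub,
    ← map_sub, ← N.degAct_const, degAct_degAct, ← N.degAct_const, mul_comm, ← degAct_degAct]
  congr 2
  rw [N.degAct_const, N.degAct_const]
  simp only [linFactor, Int.cast_sub, Int.cast_one, map_add, map_sub, map_one,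
    LinearMap.add_apply, LinearMap.sub_apply]
  simp
  abel

theorem freeY_mul_freeX : N.freeY m * N.freeX m = aeval N.freeZ (congPoly k m) := by
  refine Finsupp.lhom_ext fun i v => ?_
  have h := N.aeval_freeZ_single (congPoly k m) 0 i v
  rw [Int.cast_zero, map_zero, sub_zero, sub_zero] at h
  rw [h, ← linFactor_mul_linFactor, Module.End.mul_apply, freeX_single, freeY_single,
    degAct_degAct, ← N.degAct_const, add_sub_cancel_right]
  congr 3
  funext J
  rw [← stepWeight_mul_not (linFactor k) m (ptype J) i, mul_comm]
  rfl

theorem freeX_mul_freeY : N.freeX m * N.freeY m = aeval (N.freeZ - 1) (congPoly k m) := by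
  refine Finsupp.lhom_ext fun i v => ?_
  have h := N.aeval_freeZ_single (congPoly k m) 1 i v
  rw [Int.cast_one, map_one] at h
  rw [h, ← linFactor_mul_linFactor, Module.End.mul_apply, freeY_single, freeX_single,
    degAct_degAct, ← N.degAct_const, sub_add_cancel]
  congr 3
  funext J
  exact stepWeight_mul_not (linFactor k) m (ptype J) (i - 1)

end GrMod

/-! ### The quotient of the free chain by the comparison relations -/

namespace GrMod

variable {k : Type u} [Field k] (m : ℕ) (N : GrMod (BRing.grading k))

/-- The relations which identify `bₙ` with the comparison maps. -/
noncomputable def famRel : Submodule k (ℤ →₀ N.carrier) := Submodule.span k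
  {w | ∃ (i n : ℤ) (J : ZFin), ∃ v ∈ N.deg J, Finsupp.single i (N.toggleAct n v -
    N.pAct (toggleWeight (linFactor k) m n (ptype J) i) v) = w}

theorem single_mem_famRel (i n : ℤ) {J : ZFin} {v : N.carrier} (hv : v ∈ N.deg J) :
    Finsupp.single i (N.toggleAct n v - N.pAct (toggleWeight (linFactor k) m n (ptype J) i) v) ∈
      N.famRel m := Submodule.subset_span ⟨i, n, J, v, hv, rfl⟩

-- Compatibility of comparison weights with steps carries the relation for `v` at position `i` to
-- the relation at `i + 1` for a polynomial multiple of `v`.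
variable {m} in
theorem freeX_mem_famRel (hm : 0 < m) : N.famRel m ≤ (N.famRel m).comap (N.freeX m) := by
  refine Submodule.span_le.2 ?_
  rintro _ ⟨i, n, J, v, hv, rfl⟩
  change N.freeX m _ ∈ N.famRel m
  rw [freeX_single, map_sub, N.degAct_apply _ (N.toggleAct_mem_deg n hv),
    N.degAct_apply _ (N.pAct_mem_deg _ hv), ← pAct_mul, mul_comm,
    toggleWeight_mul_stepWeight _ hm, pAct_toggleAct, pAct_mul, ← ptype_add_genDeg]
  exact N.single_mem_famRel m _ _ (N.pAct_mem_deg _ hv)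

variable {m} in
theorem freeY_mem_famRel (hm : 0 < m) : N.famRel m ≤ (N.famRel m).comap (N.freeY m) := by
  refine Submodule.span_le.2 ?_
  rintro _ ⟨i, n, J, v, hv, rfl⟩
  change N.freeY m _ ∈ N.famRel m
  have h := toggleWeight_mul_stepWeight_not (linFactor_ne_zero k) hm n (ptype J) (i - 1)
  rw [sub_add_cancel] at h
  rw [freeY_single, map_sub, N.degAct_apply _ (N.toggleAct_mem_deg n hv),
    N.degAct_apply _ (N.pAct_mem_deg _ hv), ← pAct_mul, mul_comm, h, pAct_toggleAct, pAct_mul,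
    ← ptype_add_genDeg]
  exact N.single_mem_famRel m _ _ (N.pAct_mem_deg _ hv)

theorem freeZ_mem_famRel : N.famRel m ≤ (N.famRel m).comap N.freeZ := by
  refine Submodule.span_le.2 ?_
  rintro _ ⟨i, n, J, v, hv, rfl⟩
  change N.freeZ _ ∈ N.famRel m
  rw [freeZ_single, map_sub, ← pAct_mul, mul_comm, pAct_toggleAct, pAct_mul]
  exact N.single_mem_famRel m _ _ (N.pAct_mem_deg _ hv)

/-- The underlying space of the left adjoint. -/
abbrev CoFam : Type u := (ℤ →₀ N.carrier) ⧸ N.famRel m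

/-- The elements of degree `i` of the left adjoint. -/
noncomputable def coGen (i : ℤ) : N.carrier →ₗ[k] N.CoFam m :=
  (N.famRel m).mkQ ∘ₗ Finsupp.lsingle i

theorem coFam_hom_ext {T : Type*} [AddCommGroup T] [Module k T] {f g : N.CoFam m →ₗ[k] T}
    (h : ∀ i J, ∀ v ∈ N.deg J, f (N.coGen m i v) = g (N.coGen m i v)) : f = g := by
  refine Submodule.linearMap_qext _ (Finsupp.lhom_ext' fun i => ext_of_deg fun J v hv => ?_)
  exact h i J v hv

theorem coGen_toggleAct (i n : ℤ) (v : N.carrier) : N.coGen m i (N.toggleAct n v) =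
    N.coGen m i (N.degAct (fun J => toggleWeight (linFactor k) m n (ptype J) i) v) := by
  refine LinearMap.congr_fun (f := N.coGen m i ∘ₗ N.toggleAct n)
    (g := N.coGen m i ∘ₗ N.degAct _) (ext_of_deg fun J v hv => ?_) v
  rw [LinearMap.comp_apply, LinearMap.comp_apply, N.degAct_apply _ hv, ← sub_eq_zero, ← map_sub]
  exact (Submodule.Quotient.mk_eq_zero _).2 (N.single_mem_famRel m i n hv)

theorem exists_coRep (hm : 0 < m) : ∃ ρ : (GWA (congPoly k m))ᵐᵒᵖ →ₐ[k] Module.End k (N.CoFam m),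
    ρ (MulOpposite.op (GWA.gen _ .x)) = (N.famRel m).mapQ _ (N.freeX m) (N.freeX_mem_famRel hm) ∧
    ρ (MulOpposite.op (GWA.gen _ .y)) = (N.famRel m).mapQ _ (N.freeY m) (N.freeY_mem_famRel hm) ∧
    ρ (MulOpposite.op (GWA.gen _ .z)) = (N.famRel m).mapQ _ N.freeZ (N.freeZ_mem_famRel m) := by
  refine GWA.exists_rep (congPoly k m) _ _ _ ?_ ?_ ?_ ?_
  all_goals refine Submodule.linearMap_qext _ (LinearMap.ext fun w => ?_)
  · exact congrArg (N.famRel m).mkQ (LinearMap.congr_fun (N.freeZ_mul_freeX m) w)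
  · exact congrArg (N.famRel m).mkQ (LinearMap.congr_fun (N.freeZ_mul_freeY m) w)
  · refine (congrArg (N.famRel m).mkQ (LinearMap.congr_fun (N.freeY_mul_freeX m) w)).trans ?_
    exact LinearMap.map_aeval_of_comm (N.famRel m).mkQ (fun w => rfl) _ _
  · refine (congrArg (N.famRel m).mkQ (LinearMap.congr_fun (N.freeX_mul_freeY m) w)).trans ?_
    exact LinearMap.map_aeval_of_comm (N.famRel m).mkQ (fun w => rfl) _ _

variable {m}

/-- The action of `A(z(z + m))` on the left adjoint. -/
noncomputable def coRep (hm : 0 < m) : (GWA (congPoly k m))ᵐᵒᵖ →ₐ[k] Module.End k (N.CoFam m) :=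
  (N.exists_coRep m hm).choose

theorem coRep_x (hm : 0 < m) (i : ℤ) (v : N.carrier) :
    N.coRep hm (MulOpposite.op (GWA.gen _ .x)) (N.coGen m i v) =
      N.coGen m (i + 1) (N.degAct (fun J => stepWeight (linFactor k) m (ptype J) i) v) := by
  refine (LinearMap.congr_fun (N.exists_coRep m hm).choose_spec.1 _).trans ?_
  exact congrArg (N.famRel m).mkQ (N.freeX_single m i v)

theorem coRep_y (hm : 0 < m) (i : ℤ) (v : N.carrier) :
    N.coRep hm (MulOpposite.op (GWA.gen _ .y)) (N.coGen m i v) = N.coGen m (i - 1)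
      (N.degAct (fun J => stepWeight (linFactor k) m (fun j => ¬ ptype J j) (i - 1)) v) := by
  refine (LinearMap.congr_fun (N.exists_coRep m hm).choose_spec.2.1 _).trans ?_
  exact congrArg (N.famRel m).mkQ (N.freeY_single m i v)

theorem coRep_z (hm : 0 < m) (i : ℤ) (v : N.carrier) :
    N.coRep hm (MulOpposite.op (GWA.gen _ .z)) (N.coGen m i v) =
      N.coGen m i (N.pAct (linFactor k i) v) := by
  refine (LinearMap.congr_fun (N.exists_coRep m hm).choose_spec.2.2 _).trans ?_
  exact congrArg (N.famRel m).mkQ (N.freeZ_single i v)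

/-- Each defining relation involves a single position, so the decomposition of the free chain by
positions descends to the quotient. -/
theorem coGen_isInternal : DirectSum.IsInternal fun i => LinearMap.range (N.coGen m i) := by
  have h := isInternal_map (k := k) (fun i : ℤ => LinearMap.range (Finsupp.lsingle i))
    (fun i => Finsupp.lsingle i ∘ₗ Finsupp.lapply i) ?_ ?_ Finsupp.iSup_lsingle_range
    (N.famRel m).mkQ (Submodule.mkQ_surjective _) ?_
  · have h' : (fun i => LinearMap.range (N.coGen m i)) =
        fun i => (LinearMap.range (Finsupp.lsingle i)).map (N.famRel m).mkQ :=
      funext fun i => LinearMap.range_comp _ _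
    rw [h']
    exact h
  · rintro i _ ⟨v, rfl⟩
    simp
  · rintro i j h _ ⟨v, rfl⟩
    simp [Finsupp.single_eq_of_ne (Ne.symm h)]
  · intro i w hw
    rw [← LinearMap.mem_ker, Submodule.ker_mkQ] at hw ⊢
    have : N.famRel m ≤ (N.famRel m).comap (Finsupp.lsingle i ∘ₗ Finsupp.lapply i) := by
      refine Submodule.span_le.2 ?_
      rintro _ ⟨j, n, J, v, hv, rfl⟩
      rw [SetLike.mem_coe, Submodule.mem_comap, LinearMap.comp_apply, Finsupp.lapply_apply]
      by_cases h : j = i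
      · subst h
        rw [Finsupp.single_eq_same]
        exact N.single_mem_famRel m _ _ hv
      · rw [Finsupp.single_eq_of_ne (Ne.symm h), map_zero]
        exact zero_mem _
    exact this hw

theorem coRep_mem_deg (hm : 0 < m) {i j : ℤ} {w : N.CoFam m} {a : GWA (congPoly k m)}
    (hw : w ∈ LinearMap.range (N.coGen m i)) (ha : a ∈ GWA.grading (congPoly k m) j) :
    N.coRep hm (MulOpposite.op a) w ∈ LinearMap.range (N.coGen m (i + j)) := by
  refine rep_mem_deg_of_gen (N.coRep hm) (fun i => LinearMap.range (N.coGen m i)) ?_ hw ha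
  rintro (_ | _ | _) i _ ⟨v, rfl⟩
  · rw [coRep_x]; exact ⟨_, rfl⟩
  · rw [coRep_y]; exact ⟨_, rfl⟩
  · rw [coRep_z, show GWA.genDeg .z = 0 from rfl, add_zero]; exact ⟨_, rfl⟩

theorem stepWeight_eq_one {lam : ℤ → k[X]} {t : ℤ → Prop} {i : ℤ} (h : ¬ t i) (h' : ¬ t (i + m)) :
    stepWeight lam m t i = 1 := by
  rw [stepWeight, pointWeight_neg h, pointWeight_neg h', mul_one]

theorem coGen_pAct_mem (hm : 0 < m) {S : Submodule k (N.CoFam m)}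
    (hS : ∀ r, ∀ w ∈ S, N.coRep hm r w ∈ S) {i : ℤ} (p : k[X]) {v : N.carrier}
    (hv : N.coGen m i v ∈ S) : N.coGen m i (N.pAct p v) ∈ S := by
  have hX : ∀ v, N.coGen m i v ∈ S → N.coGen m i (N.pAct X v) ∈ S := by
    intro v hv
    have h := sub_mem (hS (MulOpposite.op (GWA.gen _ .z)) _ hv) (S.smul_mem (i : k) hv)
    rw [coRep_z, linFactor, map_add, LinearMap.add_apply, pAct_C, map_add, map_smul,
      add_sub_cancel_right] at h
    exact h
  have h := aeval_mem (S := N.pAct X) (D := S.comap (N.coGen m i)) hX p hv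
  rwa [Polynomial.aeval_algHom_apply, aeval_X_left_apply] at h

/-- It is enough to place each of finitely many homogeneous generators of `N` in a bounded interval
of positions: beyond it the weight of `x` to the right, or of `y` to the left, is `1`, so these
operators move the generator on unchanged. -/
theorem coRep_finite (hm : 0 < m) : ∃ s : Finset (N.CoFam m), ∀ S : Submodule k (N.CoFam m),
    (∀ r, ∀ w ∈ S, N.coRep hm r w ∈ S) → (∀ w ∈ s, w ∈ S) → S = ⊤ := by
  classical
  obtain ⟨s, hs, hs'⟩ := N.exists_homogeneous_generators
  choose! I hI using hs
  choose B hB using isHalfLine_ptype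
  let c : N.carrier → ℕ := fun v => (B (I v)).natAbs + m
  refine ⟨s.biUnion fun v => (Finset.Icc (-c v : ℤ) (c v)).image fun i => N.coGen m i v,
    fun S hS hsS => ?_⟩
  have hmem : ∀ v ∈ s, ∀ i, N.coGen m i v ∈ S := by
    intro v hv
    have hc : ∀ i : ℤ, -c v ≤ i → i ≤ c v → N.coGen m i v ∈ S := fun i h h' =>
      hsS _ (Finset.mem_biUnion.2 ⟨v, hv, Finset.mem_image.2 ⟨i, Finset.mem_Icc.2 ⟨h, h'⟩, rfl⟩⟩)
    have hup : ∀ i : ℤ, c v ≤ i → N.coGen m i v ∈ S := by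
      intro i hi
      induction i, hi using Int.leInduction with
      | base => exact hc _ (by omega) le_rfl
      | succ i hi ih =>
        have h := hS (MulOpposite.op (GWA.gen _ .x)) _ ih
        rwa [coRep_x, N.degAct_apply _ (hI v hv), stepWeight_eq_one, map_one,
          Module.End.one_apply] at h
        · exact (hB (I v) i).2 (by simp only [c] at hi; omega)
        · exact (hB (I v) _).2 (by simp only [c] at hi; omega)
    have hdown : ∀ i : ℤ, i ≤ -c v → N.coGen m i v ∈ S := by
      intro i hi
      induction i, hi using Int.leInductionDown with
      | base => exact hc _ le_rfl (by omega)
      | pred i hi ih =>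
        have h := hS (MulOpposite.op (GWA.gen _ .y)) _ ih
        rwa [coRep_y, N.degAct_apply _ (hI v hv), stepWeight_eq_one, map_one,
          Module.End.one_apply] at h
        · exact not_not.2 ((hB (I v) _).1 (by simp only [c] at hi; omega))
        · exact not_not.2 ((hB (I v) _).1 (by simp only [c] at hi; omega))
    intro i
    rcases le_total i (-c v) with h | h
    · exact hdown i h
    · rcases le_total i (c v) with h' | h'
      · exact hc i h h'
      · exact hup i h'
  -- In the quotient `bₙ` becomes a polynomial which depends on the degree of the element and on the
  -- position. Quantifying over all positions and all degree-dependent polynomials makes the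
  -- condition stable under `B`.
  have hall : ∀ v, ∀ i d, N.coGen m i (N.degAct d v) ∈ S := by
    let T : Submodule k N.carrier :=
      ⨅ (i : ℤ) (d : ZFin → k[X]), S.comap (N.coGen m i ∘ₗ N.degAct d)
    have hT : ∀ v, v ∈ T ↔ ∀ i d, N.coGen m i (N.degAct d v) ∈ S := by
      intro v
      simp [T, Submodule.mem_iInf]
    intro v
    rw [← hT]
    have hv : v ∈ Submodule.span (BRing k)ᵐᵒᵖ (s : Set N.carrier) := hs' ▸ Submodule.mem_top
    induction hv using Submodule.span_induction with
    | mem v h =>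
      rw [hT]
      intro i d
      rw [N.degAct_apply _ (hI v h)]
      exact N.coGen_pAct_mem hm hS _ (hmem v h i)
    | zero => exact zero_mem _
    | add v w _ _ hv hw => exact add_mem hv hw
    | smul r v _ hv =>
      refine smul_mem_of_gen (BRing.adjoin_gen k) T (fun g v hv => ?_) r.unop hv
      rw [hT] at hv ⊢
      intro i d
      cases g with
      | none =>
        have h : MulOpposite.op (BRing.gen k none) • v = N.degAct (fun _ => X) v := by
          rw [degAct_const, pAct_apply, BRing.ofPoly, aeval_X, bAct_apply]
        rw [h, degAct_degAct]
        exact hv _ _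
      | some n =>
        change N.coGen m i (N.degAct d (N.toggleAct n v)) ∈ S
        rw [degAct_toggleAct, coGen_toggleAct, degAct_degAct]
        exact hv _ _
  rw [eq_top_iff]
  rintro w -
  obtain ⟨w, rfl⟩ := Submodule.mkQ_surjective _ w
  induction w using Finsupp.induction_linear with
  | zero => rw [map_zero]; exact zero_mem _
  | add v w hv hw => rw [map_add]; exact add_mem hv hw
  | single i v =>
    have h := hall v i fun _ => 1
    rwa [degAct_const, map_one] at h

/-- The value of the left adjoint of the functor of families. -/
noncomputable def coObj (hm : 0 < m) : GrMod (GWA.grading (congPoly k m)) :=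
  ofRep (N.CoFam m) (N.coRep hm) (fun i => LinearMap.range (N.coGen m i)) N.coGen_isInternal
    (N.coRep_mem_deg hm) (N.coRep_finite hm)

/-- The elements of degree `i` of the left adjoint. -/
noncomputable def coElt (hm : 0 < m) (i : ℤ) : N.carrier →ₗ[k] (N.coObj hm).carrier := N.coGen m i

theorem coObj_hom_ext (hm : 0 < m) {T : Type*} [AddCommGroup T] [Module k T]
    {f g : (N.coObj hm).carrier →ₗ[k] T}
    (h : ∀ i J, ∀ v ∈ N.deg J, f (N.coElt hm i v) = g (N.coElt hm i v)) : f = g :=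
  N.coFam_hom_ext m h

theorem coElt_toggleAct (hm : 0 < m) (i n : ℤ) {J : ZFin} {v : N.carrier} (hv : v ∈ N.deg J) :
    N.coElt hm i (N.toggleAct n v) =
      N.coElt hm i (N.pAct (toggleWeight (linFactor k) m n (ptype J) i) v) := by
  rw [← N.degAct_apply (fun J => toggleWeight (linFactor k) m n (ptype J) i) hv]
  exact N.coGen_toggleAct m i n v

theorem coObj_op_x (hm : 0 < m) (i : ℤ) {J : ZFin} {v : N.carrier} (hv : v ∈ N.deg J) :
    (N.coObj hm).op .x (N.coElt hm i v) =
      N.coElt hm (i + 1) (N.pAct (stepWeight (linFactor k) m (ptype J) i) v) := by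
  rw [← N.degAct_apply (fun J => stepWeight (linFactor k) m (ptype J) i) hv]
  exact N.coRep_x hm i v

theorem coObj_op_y (hm : 0 < m) (i : ℤ) {J : ZFin} {v : N.carrier} (hv : v ∈ N.deg J) :
    (N.coObj hm).op .y (N.coElt hm (i + 1) v) =
      N.coElt hm i (N.pAct (stepWeight (linFactor k) m (fun j => ¬ ptype J j) i) v) := by
  rw [← N.degAct_apply (fun J => stepWeight (linFactor k) m (fun j => ¬ ptype J j) i) hv]
  have h := N.coRep_y hm (i + 1) v
  rw [add_sub_cancel_right] at h
  exact h

theorem coObj_op_z (hm : 0 < m) (i : ℤ) (v : N.carrier) :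
    (N.coObj hm).op .z (N.coElt hm i v) = N.coElt hm i (N.pAct (linFactor k i) v) :=
  N.coRep_z hm i v

theorem coObj_act (hm : 0 < m) (i : ℤ) (p : k[X]) (v : N.carrier) :
    (N.coObj hm).chain.act i p (N.coElt hm i v) = N.coElt hm i (N.pAct p v) := by
  have h := LinearMap.map_aeval_of_comm (N.coElt hm i) (S := N.pAct X)
    (T := (N.coObj hm).op .z - algebraMap k _ (i : k)) (fun v => ?_) p v
  · rw [Polynomial.aeval_algHom_apply, aeval_X_left_apply] at h
    exact h.symm
  · rw [LinearMap.sub_apply, Module.algebraMap_end_apply, coObj_op_z, linFactor, map_add,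
      LinearMap.add_apply, pAct_C, map_add, map_smul, add_sub_cancel_right]

theorem coElt_mem_gfam (hm : 0 < m) {J : ZFin} {v : N.carrier} (hv : v ∈ N.deg J) :
    (fun i => N.coElt hm i v) ∈ (N.coObj hm).gfam J := by
  refine (N.coObj hm).mem_gfam.2 ⟨fun i => ⟨?_, ?_⟩, fun i => ⟨v, rfl⟩⟩
  · rw [coObj_act]
    exact N.coObj_op_x hm i hv
  · rw [coObj_act]
    exact N.coObj_op_y hm i hv

end GrMod

/-! ### The adjunction -/

namespace GrMod

variable {k : Type u} [Field k] {m : ℕ}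

section EvalAt

variable (M : GrMod (GWA.grading (congPoly k m)))

/-- The sum of the members of index `i` of the families. -/
noncomputable def evalAt (i : ℤ) : M.totalFam →ₗ[k] M.carrier :=
  Finsupp.lsum k (fun _ => LinearMap.proj (φ := fun _ => M.carrier) i) ∘ₗ M.famVal

theorem evalAt_famSingle (i : ℤ) (J : ZFin) (u : M.gfam J) :
    M.evalAt i (M.famSingle J u) = u.1 i := by
  rw [evalAt, LinearMap.comp_apply, famVal_famSingle, Finsupp.lsum_single]
  rfl

theorem evalAt_famP (i : ℤ) (p : k[X]) (J : ZFin) (u : M.gfam J) :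
    M.evalAt i (M.famP p (M.famSingle J u)) = M.chain.act i p (u.1 i) := by
  rw [famP_famSingle, evalAt_famSingle]; rfl

theorem evalAt_famB (hm : 0 < m) (i n : ℤ) (J : ZFin) (u : M.gfam J) :
    M.evalAt i (M.famB hm n (M.famSingle J u)) =
      M.chain.act i (toggleWeight (linFactor k) m n (ptype J) i) (u.1 i) := by
  rw [famB_famSingle, evalAt_famSingle]; rfl

end EvalAt

variable [CharZero k] (N : GrMod (BRing.grading k))

/-- The unit of the adjunction as a linear map. -/
noncomputable def unitLin (hm : 0 < m) : N.carrier →ₗ[k] (N.coObj hm).totalFam :=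
  N.degLift fun J => (N.coObj hm).famSingle J ∘ₗ
    ((LinearMap.pi fun i => N.coElt hm i).comp (N.deg J).subtype).codRestrict _
      fun v => N.coElt_mem_gfam hm v.2

theorem unitLin_apply (hm : 0 < m) {J : ZFin} {v : N.carrier} (hv : v ∈ N.deg J) :
    N.unitLin hm v = (N.coObj hm).famSingle J ⟨_, N.coElt_mem_gfam hm hv⟩ :=
  N.degLift_apply _ ⟨v, hv⟩

theorem unitLin_pAct (hm : 0 < m) (p : k[X]) (v : N.carrier) :
    N.unitLin hm (N.pAct p v) = (N.coObj hm).famP p (N.unitLin hm v) := by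
  refine LinearMap.congr_fun (f := N.unitLin hm ∘ₗ N.pAct p)
    (g := (N.coObj hm).famP p ∘ₗ N.unitLin hm) (ext_of_deg fun J v hv => ?_) v
  rw [LinearMap.comp_apply, LinearMap.comp_apply, N.unitLin_apply hm hv,
    N.unitLin_apply hm (N.pAct_mem_deg p hv), famP_famSingle]
  congr 2
  funext i
  exact (N.coObj_act hm i p v).symm

theorem unitLin_toggleAct (hm : 0 < m) (n : ℤ) (v : N.carrier) :
    N.unitLin hm (N.toggleAct n v) = (N.coObj hm).famB hm n (N.unitLin hm v) := by
  refine LinearMap.congr_fun (f := N.unitLin hm ∘ₗ N.toggleAct n)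
    (g := (N.coObj hm).famB hm n ∘ₗ N.unitLin hm) (ext_of_deg fun J v hv => ?_) v
  rw [LinearMap.comp_apply, LinearMap.comp_apply, N.unitLin_apply hm hv,
    N.unitLin_apply hm (N.toggleAct_mem_deg n hv), famB_famSingle]
  congr 2
  funext i
  exact (N.coElt_toggleAct hm i n hv).trans (N.coObj_act hm i _ v).symm

theorem smul_gen_none (v : N.carrier) :
    MulOpposite.op (BRing.gen k none) • v = N.pAct X v := by
  rw [pAct_apply, BRing.ofPoly, aeval_X, bAct_apply]

/-- The unit of the adjunction. -/
noncomputable def unit (hm : 0 < m) : N ⟶ (N.coObj hm).famObj hm :=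
  homOfGen (M := N) (N := (N.coObj hm).famObj hm) (BRing.adjoin_gen k) (N.unitLin hm)
    (by
      rintro (_ | n) v
      · rw [famObj_smul_z, smul_gen_none]
        exact N.unitLin_pAct hm X v
      · rw [famObj_smul_b]
        exact N.unitLin_toggleAct hm n v)
    (by
      intro J v hv
      exact ⟨_, (N.unitLin_apply hm hv).symm⟩)

variable {N} {M : GrMod (GWA.grading (congPoly k m))}

theorem exists_famSingle (hm : 0 < m) (ψ : N ⟶ M.famObj hm) {J : ZFin} {v : N.carrier}
    (hv : v ∈ N.deg J) : ∃ u, M.famSingle J u = ψ.hom v := ψ.map_mem hv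

theorem hom_pAct (hm : 0 < m) (ψ : N ⟶ M.famObj hm) (p : k[X]) (v : N.carrier) :
    ψ.hom (N.pAct p v) = M.famP p (ψ.hom v) :=
  (ψ.hom.map_smul _ v).trans (M.famObj_smul_aeval hm p _)

theorem hom_toggleAct (hm : 0 < m) (ψ : N ⟶ M.famObj hm) (n : ℤ) (v : N.carrier) :
    ψ.hom (N.toggleAct n v) = M.famB hm n (ψ.hom v) :=
  (ψ.hom.map_smul _ v).trans (M.famObj_smul_b hm n _)

/-- On a family of type `J`, taking the member of index `i` turns `bₙ` into its weight at `i`; this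
is exactly the relation divided out. -/
theorem famRel_le_ker (hm : 0 < m) (ψ : N ⟶ M.famObj hm) : N.famRel m ≤ LinearMap.ker
    (Finsupp.lsum k fun i => (M.evalAt i ∘ₗ (ψ.hom.restrictScalars k : _ →ₗ[k] M.totalFam))) := by
  refine Submodule.span_le.2 ?_
  rintro _ ⟨i, n, J, v, hv, rfl⟩
  obtain ⟨u, hu⟩ := exists_famSingle hm ψ hv
  rw [SetLike.mem_coe, LinearMap.mem_ker, Finsupp.lsum_single, map_sub, sub_eq_zero]
  change M.evalAt i (ψ.hom (N.toggleAct n v)) = M.evalAt i (ψ.hom (N.pAct _ v))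
  rw [hom_toggleAct, hom_pAct, ← hu]
  exact (M.evalAt_famB hm i n J u).trans (M.evalAt_famP i _ J u).symm

/-- The transpose of a homomorphism as a linear map. -/
noncomputable def transposeLin (hm : 0 < m) (ψ : N ⟶ M.famObj hm) :
    (N.coObj hm).carrier →ₗ[k] M.carrier :=
  (N.famRel m).liftQ _ (famRel_le_ker hm ψ)

theorem transposeLin_coElt (hm : 0 < m) (ψ : N ⟶ M.famObj hm) (i : ℤ) (v : N.carrier) :
    transposeLin hm ψ (N.coElt hm i v) = M.evalAt i (ψ.hom v) := by
  refine ((N.famRel m).liftQ_apply _ _).trans ?_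
  exact Finsupp.lsum_single ..

theorem transposeLin_pAct (hm : 0 < m) (ψ : N ⟶ M.famObj hm) (i : ℤ) {J : ZFin} {v : N.carrier}
    {u : M.gfam J} (hu : M.famSingle J u = ψ.hom v) (p : k[X]) :
    transposeLin hm ψ (N.coElt hm i (N.pAct p v)) = M.chain.act i p (u.1 i) := by
  rw [transposeLin_coElt, hom_pAct, ← hu]
  exact M.evalAt_famP i _ J u

/-- The transpose of a homomorphism. -/
noncomputable def transpose (hm : 0 < m) (ψ : N ⟶ M.famObj hm) : N.coObj hm ⟶ M :=
  homOfGen (M := N.coObj hm) (N := M) (GWA.adjoin_gen _) (transposeLin hm ψ)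
    (by
      intro g w
      refine LinearMap.congr_fun (f := transposeLin hm ψ ∘ₗ (N.coObj hm).op g)
        (g := M.op g ∘ₗ transposeLin hm ψ) (N.coObj_hom_ext hm fun i J v hv => ?_) w
      obtain ⟨u, hu⟩ := exists_famSingle hm ψ hv
      have hu' := (M.mem_gfam.1 u.2).1
      have hi : ∀ i, transposeLin hm ψ (N.coElt hm i v) = u.1 i := fun i => by
        rw [transposeLin_coElt, ← hu]
        exact M.evalAt_famSingle i J u
      rw [LinearMap.comp_apply, LinearMap.comp_apply]
      cases g with
      | x => rw [N.coObj_op_x hm i hv, transposeLin_pAct hm ψ _ hu, hi, ← (hu' i).1]; rfl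
      | y =>
        obtain ⟨j, rfl⟩ : ∃ j, i = j + 1 := ⟨i - 1, by ring⟩
        rw [N.coObj_op_y hm j hv, transposeLin_pAct hm ψ _ hu, hi, ← (hu' j).2]; rfl
      | z => rw [N.coObj_op_z hm i, transposeLin_pAct hm ψ _ hu, hi, M.op_z_eq_act i]; rfl)
    (by
      rintro i _ ⟨v, rfl⟩
      have h : (⊤ : Submodule k N.carrier) ≤
          (M.deg i).comap (transposeLin hm ψ ∘ₗ N.coElt hm i) := by
        rw [← N.iSup_deg]
        refine iSup_le fun J v hv => ?_
        obtain ⟨u, hu⟩ := exists_famSingle hm ψ hv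
        change transposeLin hm ψ (N.coElt hm i v) ∈ M.deg i
        rw [transposeLin_coElt, ← hu]
        refine (congrArg (· ∈ M.deg i) (M.evalAt_famSingle i J u)).mpr ?_
        exact (M.mem_gfam.1 u.2).2 i
      exact h (Submodule.mem_top (x := v)))

theorem unit_famMap (hm : 0 < m) (g : N.coObj hm ⟶ M) {J : ZFin} {v : N.carrier}
    (hv : v ∈ N.deg J) : (N.unit hm ≫ famMap hm g).hom v =
      M.famSingle J ⟨_, comp_mem_gfam g (N.coElt_mem_gfam hm hv)⟩ := by
  have h : famMapLin g (N.unitLin hm v) =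
      M.famSingle J ⟨_, comp_mem_gfam g (N.coElt_mem_gfam hm hv)⟩ := by
    rw [N.unitLin_apply hm hv, famMapLin_famSingle]
  exact h

/-- A morphism from `N.coObj hm` is determined by the images of the elements `N.coElt hm i v`, and
for `v` of degree `J` these images form a family of type `J`, which is the transposed morphism at
`v`. Evaluation of families at positions recovers the original morphism. -/
theorem unit_famMap_bijective (hm : 0 < m) : Function.Bijective
    fun g : N.coObj hm ⟶ M => N.unit hm ≫ famMap hm g := by
  constructor
  · intro g g' h
    have : g.hom.restrictScalars k = g'.hom.restrictScalars k := by
      refine N.coObj_hom_ext hm fun i J v hv => ?_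
      have h' := congrArg (fun f : N ⟶ M.famObj hm => M.evalAt i (f.hom v)) h
      change M.evalAt i ((N.unit hm ≫ famMap hm g).hom v) =
        M.evalAt i ((N.unit hm ≫ famMap hm g').hom v) at h'
      rw [unit_famMap hm g hv, unit_famMap hm g' hv] at h'
      exact (M.evalAt_famSingle _ _ _).symm.trans (h'.trans (M.evalAt_famSingle _ _ _))
    ext w
    exact LinearMap.congr_fun this w
  · intro ψ
    refine ⟨transpose hm ψ, ?_⟩
    have : (N.unit hm ≫ famMap hm (transpose hm ψ)).hom.restrictScalars k =
        ψ.hom.restrictScalars k := by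
      refine ext_of_deg fun J v hv => ?_
      refine (unit_famMap hm (transpose hm ψ) hv).trans ?_
      obtain ⟨u, hu⟩ := exists_famSingle hm ψ hv
      refine Eq.trans ?_ hu
      congr 2
      funext i
      refine (transposeLin_coElt hm ψ i v).trans ?_
      rw [← hu]
      exact M.evalAt_famSingle i J u
    ext v
    exact LinearMap.congr_fun this v

/-- The bijections of the adjunction. -/
noncomputable def famEquiv (hm : 0 < m) (N : GrMod (BRing.grading k))
    (M : GrMod (GWA.grading (congPoly k m))) :
    (N.coObj hm ⟶ M) ≃ (N ⟶ (famFunctor k hm).obj M) :=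
  Equiv.ofBijective _ (unit_famMap_bijective hm)

theorem famEquiv_naturality (hm : 0 < m) (N : GrMod (BRing.grading k))
    (M M' : GrMod (GWA.grading (congPoly k m))) (g : M ⟶ M') (h : N.coObj hm ⟶ M) :
    famEquiv hm N M' (h ≫ g) = famEquiv hm N M h ≫ (famFunctor k hm).map g := by
  change N.unit hm ≫ (famFunctor k hm).map (h ≫ g) =
    (N.unit hm ≫ (famFunctor k hm).map h) ≫ (famFunctor k hm).map g
  exact (congrArg (N.unit hm ≫ ·) ((famFunctor k hm).map_comp h g)).trans
    (Category.assoc _ _ _).symm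

variable (k) in
/-- The left adjoint of the functor of families. -/
noncomputable def coFunctor (hm : 0 < m) :
    GrMod (BRing.grading k) ⥤ GrMod (GWA.grading (congPoly k m)) :=
  Adjunction.leftAdjointOfEquiv (famEquiv hm) (famEquiv_naturality hm)

variable (k) in
/-- The adjunction. -/
noncomputable def famAdjunction (hm : 0 < m) : coFunctor k hm ⊣ famFunctor k hm :=
  Adjunction.adjunctionOfEquivLeft (famEquiv hm) (famEquiv_naturality hm)

theorem famAdjunction_unit (hm : 0 < m) (N : GrMod (BRing.grading k)) :
    (famAdjunction k hm).unit.app N = N.unit hm := by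
  change N.unit hm ≫ (famFunctor k hm).map (𝟙 (N.coObj hm)) = _
  exact (congrArg (N.unit hm ≫ ·) ((famFunctor k hm).map_id _)).trans (Category.comp_id _)

end GrMod

/-! ### The unit of the adjunction is invertible -/

section Comparison

variable {k : Type u} [Field k]

open Classical in
/-- The element `bₙ` if `n ∈ K`, and `z + n` if `n ∈ S \\ K`. -/
noncomputable def compFactor (k : Type u) [Field k] (K : ZFin) (S : Finset ℤ) (n : ℤ) : BRing k :=
  if n ∈ ofBoolRing K then BRing.gen k (some n)
  else if n ∈ S then BRing.ofPoly k (linFactor k n) else 1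

open Classical in
/-- The product of the `bₙ` for `n ∈ K` and the `z + n` for `n ∈ S \ K`. -/
noncomputable def compProd (k : Type u) [Field k] (K : ZFin) (S : Finset ℤ) : BRing k :=
  ∏ n ∈ ofBoolRing K ∪ S, compFactor k K S n

theorem compProd_eq (K : ZFin) (S : Finset ℤ) {T : Finset ℤ} (hT : ∀ n ∈ ofBoolRing K, n ∈ T)
    (hT' : S ⊆ T) : compProd k K S = ∏ n ∈ T, compFactor k K S n := by
  classical
  refine Finset.prod_subset (Finset.union_subset hT hT') fun n _ hn => ?_
  rw [Finset.mem_union, not_or] at hn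
  rw [compFactor, if_neg hn.1, if_neg hn.2]

theorem mul_mul_eq_of_mul_eq {R : Type*} [CommRing R] {a b p q : R} (h : a * b = p * q) (r : R) :
    a * r * b = p * (q * r) := by
  rw [mul_right_comm, h, mul_assoc]

theorem gen_mul_gen (n : ℤ) : BRing.gen k (some n) * BRing.gen k (some n) =
    BRing.ofPoly k (linFactor k n ^ 2) := BRing.gen_mul_self k n

/-- Only the factor at `n` is affected. On `S` the elements `bₙ` and `z + n` are exchanged at the
cost of one `z + n`; off `S` the cost is nothing when `bₙ` supplies a factor of the product for `K`,
and `bₙ²` otherwise. For `S = [a, a + m)` this `w` is the comparison weight at position `a`. -/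
theorem compProd_mul_gen {K : ZFin} {S : Finset ℤ} {n : ℤ} {w : k[X]}
    (hw : w = if n ∈ S then linFactor k n else if n ∈ ofBoolRing K then 1 else linFactor k n ^ 2) :
    compProd k (K + bdeg n) S * BRing.gen k (some n) = BRing.ofPoly k w * compProd k K S := by
  classical
  let T := insert n (ofBoolRing K ∪ S)
  have hKT : ∀ j ∈ ofBoolRing K, j ∈ T := fun j hj =>
    Finset.mem_insert_of_mem (Finset.mem_union_left _ hj)
  have hK : ∀ j, j ∈ ofBoolRing (K + bdeg n) ↔ ¬ (j ∈ ofBoolRing K ↔ j = n) := by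
    intro j
    rw [mem_ofBoolRing_add, mem_ofBoolRing_genDeg]
  rw [compProd_eq K S hKT fun j hj => Finset.mem_insert_of_mem (Finset.mem_union_right _ hj),
    compProd_eq (K + bdeg n) S (T := T) ?_
      fun j hj => Finset.mem_insert_of_mem (Finset.mem_union_right _ hj)]
  · rw [← Finset.mul_prod_erase T _ (Finset.mem_insert_self n _),
      ← Finset.mul_prod_erase T _ (Finset.mem_insert_self n _)]
    have hrest : ∏ j ∈ T.erase n, compFactor k (K + bdeg n) S j =
        ∏ j ∈ T.erase n, compFactor k K S j := by
      refine Finset.prod_congr rfl fun j hj => ?_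
      have hjn := (Finset.mem_erase.1 hj).1
      have : j ∈ ofBoolRing (K + bdeg n) ↔ j ∈ ofBoolRing K := by rw [hK]; tauto
      rw [compFactor, compFactor]
      simp only [this]
    have hfac : compFactor k (K + bdeg n) S n * BRing.gen k (some n) =
        BRing.ofPoly k w * compFactor k K S n := by
      subst hw
      rw [compFactor, compFactor]
      by_cases h1 : n ∈ ofBoolRing K
      · rw [if_neg (by rw [hK]; tauto), if_pos h1]
        by_cases h2 : n ∈ S
        · simp only [if_pos h2, if_pos h1]
        · rw [if_neg h2, if_neg h2, if_pos h1, map_one]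
      · rw [if_pos (by rw [hK]; tauto), if_neg h1, gen_mul_gen]
        by_cases h2 : n ∈ S
        · simp only [if_pos h2, if_neg h1, pow_two, map_mul]
        · rw [if_neg h2, if_neg h2, if_neg h1, mul_one]
    rw [hrest]
    exact mul_mul_eq_of_mul_eq hfac _
  · intro j hj
    rw [hK] at hj
    by_cases h : j = n
    · rw [h]; exact Finset.mem_insert_self _ _
    · exact hKT j (by tauto)

/-- Squaring removes the `bₙ`, which turns an annihilator in `B` into a polynomial annihilator. -/
theorem compProd_mul_self (K : ZFin) (S : Finset ℤ) : ∃ T : Finset ℤ,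
    (∀ n, n ∈ T ↔ n ∈ ofBoolRing K ∨ n ∈ S) ∧
      compProd k K S * compProd k K S = BRing.ofPoly k (∏ n ∈ T, linFactor k n ^ 2) := by
  classical
  refine ⟨ofBoolRing K ∪ S, fun n => Finset.mem_union, ?_⟩
  rw [compProd, ← Finset.prod_mul_distrib, map_prod]
  refine Finset.prod_congr rfl fun n hn => ?_
  rw [compFactor]
  by_cases h : n ∈ ofBoolRing K
  · rw [if_pos h, gen_mul_gen]
  · rw [if_neg h, if_pos ((Finset.mem_union.1 hn).resolve_left h), ← map_mul, pow_two]

end Comparison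

namespace GrMod

variable {k : Type u} [Field k] {m : ℕ} (N : GrMod (BRing.grading k))

/-- A point of `[a, a + m)` has one gap on each side of position `a`, so toggling it costs `z + n`
in either direction. Any other point has both gaps on one side: toggling towards the threshold type
`J'` is free, toggling away from it costs the square. -/
theorem toggleWeight_eq {a : ℤ} {J J' : ZFin} (hJ' : ∀ n, ptype J' n ↔ n < a) (n : ℤ) :
    toggleWeight (linFactor k) m n (ptype J) a = if n ∈ Finset.Ico a (a + m) then linFactor k n else
      if n ∈ ofBoolRing (J + J') then 1 else linFactor k n ^ 2 := by
  have hmem : n ∈ ofBoolRing (J + J') ↔ ¬ (ptype J n ↔ n < a) := by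
    rw [← hJ', mem_ofBoolRing_add, ptype, ptype]
    tauto
  by_cases ht : ptype J n <;> by_cases hK : n ∈ ofBoolRing (J + J') <;>
    simp only [hK, if_true, if_false, Finset.mem_Ico]
  · have := mt (fun h : n < a => iff_of_true ht h) (hmem.1 hK)
    rw [toggleWeight_pos ht, gapCount]
    split_ifs <;> first | omega | simp
  · have := (not_not.1 (mt hmem.2 hK)).1 ht
    rw [toggleWeight_pos ht, gapCount]
    split_ifs <;> first | omega | simp
  · have : n < a := by
      by_contra h
      exact hmem.1 hK (iff_of_false ht h)
    rw [toggleWeight_neg ht, gapCount]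
    split_ifs <;> first | omega | simp
  · have := mt (not_not.1 (mt hmem.2 hK)).2 ht
    rw [toggleWeight_neg ht, gapCount]
    split_ifs <;> first | omega | simp

/-- Multiplication by `compProd` moves each component of `N` to the degree `J'`. By
`compProd_mul_gen` and `toggleWeight_eq` it respects the relations at position `a`, so it detects
elements which become zero there. -/
theorem bAct_compProd_eq_zero (hm : 0 < m) {a : ℤ} {J J' : ZFin} (hJ' : ∀ n, ptype J' n ↔ n < a)
    {v : N.carrier} (hv : v ∈ N.deg J) (h : N.coElt hm a v = 0) :
    N.bAct (compProd k (J + J') (Finset.Ico a (a + m))) v = 0 := by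
  let θ : N.carrier →ₗ[k] N.carrier := N.degLift fun J =>
    N.bAct (compProd k (J + J') (Finset.Ico a (a + m))) ∘ₗ (N.deg J).subtype
  have hθ : ∀ {J} {v : N.carrier}, v ∈ N.deg J →
      θ v = N.bAct (compProd k (J + J') (Finset.Ico a (a + m))) v :=
    fun hv => N.degLift_apply _ ⟨_, hv⟩
  have hle : N.famRel m ≤ LinearMap.ker (θ ∘ₗ Finsupp.lapply a) := by
    refine Submodule.span_le.2 ?_
    rintro _ ⟨i, n, I, w, hw, rfl⟩
    rw [SetLike.mem_coe, LinearMap.mem_ker, LinearMap.comp_apply, Finsupp.lapply_apply]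
    by_cases hi : i = a
    · subst hi
      rw [Finsupp.single_eq_same, map_sub, hθ (N.toggleAct_mem_deg n hw),
        hθ (N.pAct_mem_deg _ hw), toggleWeight_eq hJ', pAct_apply, bAct_comm, toggleAct,
        ← Module.End.mul_apply, ← map_mul, ← Module.End.mul_apply, ← map_mul, add_right_comm,
        compProd_mul_gen rfl, sub_self]
    · rw [Finsupp.single_eq_of_ne (Ne.symm hi), map_zero]
  have hmem : Finsupp.single a v ∈ N.famRel m := (Submodule.Quotient.mk_eq_zero _).1 h
  have := hle hmem
  rwa [LinearMap.mem_ker, LinearMap.comp_apply, Finsupp.lapply_apply, Finsupp.single_eq_same,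
    hθ hv] at this

/-- The annihilator is the square of `compProd`: its points are those where `ptype J` differs from
the threshold at `a`, together with those of `[a, a + m)`. -/
theorem exists_pAct_eq_zero (hm : 0 < m) (a : ℤ) {J : ZFin} {t : ℤ → Prop}
    (ht : ∀ n, (¬ (ptype J n ↔ n < a) ∨ a ≤ n ∧ n < a + m) → t n) {v : N.carrier}
    (hv : v ∈ N.deg J) (h : N.coElt hm a v = 0) :
    ∃ p ∈ weightMonoid (linFactor k) t, N.pAct p v = 0 := by
  obtain ⟨J', hJ'⟩ := exists_ptype_iff_lt a
  obtain ⟨T, hT, hT'⟩ := compProd_mul_self (k := k) (J + J') (Finset.Ico a (a + m))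
  refine ⟨∏ n ∈ T, linFactor k n ^ 2, Submonoid.prod_mem _ fun n hn =>
    Submonoid.pow_mem _ (lam_mem_weightMonoid (linFactor k) (ht n ?_)) 2, ?_⟩
  · rw [hT, Finset.mem_Ico] at hn
    rw [← hJ']
    refine hn.imp_left fun hn => ?_
    rw [mem_ofBoolRing_add] at hn
    rw [ptype, ptype]
    tauto
  · rw [pAct_apply, ← hT', map_mul, Module.End.mul_apply,
      N.bAct_compProd_eq_zero hm hJ' hv h, map_zero]

variable [CharZero k]

/-- An element `v` of degree `J` killed by the unit is zero at every position. Far to the left all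
points of the resulting annihilator have type `ptype J`, far to the right none has. The two
annihilators are coprime, so `v = 0`. -/
theorem unit_injective (hm : 0 < m) : Function.Injective (N.unit hm).hom := by
  have hJ : ∀ J, ∀ v ∈ N.deg J, (N.unit hm).hom v = 0 → v = 0 := by
    intro J v hv h
    have h0 : ∀ i, N.coElt hm i v = 0 := by
      intro i
      have h1 : N.unitLin hm v = 0 := h
      rw [N.unitLin_apply hm hv] at h1
      have h2 := congrArg ((N.coObj hm).evalAt i) h1
      rwa [evalAt_famSingle, map_zero] at h2
    obtain ⟨a, -, -, ha, -⟩ := (isHalfLine_ptype J).exists_left m 0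
    obtain ⟨b, -, -, hb, -⟩ := (isHalfLine_ptype J).exists_right m 0
    obtain ⟨p, hp, hpv⟩ := N.exists_pAct_eq_zero hm a (t := ptype J) (fun n hn => by
      by_contra hn'
      have := mt (ha n) hn'
      rcases hn with hn | hn
      · exact hn ⟨fun h => absurd h hn', fun _ => by omega⟩
      · omega) hv (h0 a)
    obtain ⟨q, hq, hqv⟩ := N.exists_pAct_eq_zero hm b (t := fun n => ¬ ptype J n) (fun n hn hn' => by
      have := mt (hb n) (not_not.2 hn')
      rcases hn with hn | hn
      · exact hn ⟨fun _ => by omega, fun _ => hn'⟩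
      · omega) hv (h0 b)
    obtain ⟨r, s, hrs⟩ := isCoprime_of_mem_weightMonoid (isCoprime_linFactor k) hp hq
    have h1 : N.pAct (r * p + s * q) v = 0 := by
      rw [map_add, LinearMap.add_apply, pAct_mul, pAct_mul, hpv, hqv, map_zero, map_zero, add_zero]
    rwa [hrs, map_one] at h1
  rw [injective_iff_map_eq_zero]
  intro v hv
  have hle := ker_le_iSup (N.unit hm) (show v ∈ _ from hv)
  have hbot : (⨆ J, LinearMap.ker ((N.unit hm).hom.restrictScalars k) ⊓ N.deg J) ≤ ⊥ :=
    iSup_le fun J w hw => hJ J w hw.2 hw.1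
  exact hbot hle

/-- Every component of `N.coObj hm` is spanned by values of families in the image of the unit, so
`eq_top_of_stable` applies with any bounds. -/
theorem unit_surjective (hm : 0 < m) : Function.Surjective (N.unit hm).hom := by
  have hspan : ∀ i, ∀ w ∈ (N.coObj hm).deg i, w ∈ Submodule.span k
      {w | ∃ J, ∃ u : (N.coObj hm).gfam J,
        (N.coObj hm).famSingle J u ∈ LinearMap.range (N.unitLin hm) ∧ u.1 i = w} := by
    rintro i _ ⟨v, rfl⟩
    have h : (⊤ : Submodule k N.carrier) ≤ (Submodule.span k
      {w | ∃ J, ∃ u : (N.coObj hm).gfam J, (N.coObj hm).famSingle J u ∈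
        LinearMap.range (N.unitLin hm) ∧ u.1 i = w}).comap (N.coElt hm i) := by
      rw [← N.iSup_deg]
      exact iSup_le fun J v hv => Submodule.subset_span
        ⟨J, ⟨_, N.coElt_mem_gfam hm hv⟩, ⟨v, N.unitLin_apply hm hv⟩, rfl⟩
    exact h (Submodule.mem_top (x := v))
  have htop := (N.coObj hm).eq_top_of_stable hm (LinearMap.range (N.unitLin hm))
    (by rintro p _ ⟨v, rfl⟩; exact ⟨_, N.unitLin_pAct hm p v⟩)
    (by rintro n _ ⟨v, rfl⟩; exact ⟨_, N.unitLin_toggleAct hm n v⟩) (a₀ := 0) (b₀ := 0)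
    (fun i _ => hspan i) fun i _ => hspan i
  exact (LinearMap.range_eq_top (f := N.unitLin hm)).1 htop

instance (hm : 0 < m) : IsIso (famAdjunction k hm).unit := by
  have : ∀ N, IsIso ((famAdjunction k hm).unit.app N) := fun N => by
    rw [famAdjunction_unit]
    exact isIso_of_bijective _ ⟨N.unit_injective hm, N.unit_surjective hm⟩
  exact NatIso.isIso_of_isIso_app _

/-! ### The equivalence of categories -/

theorem isoModFdim_of_isIso_map (hm : 0 < m) {M M' : GrMod (GWA.grading (congPoly k m))}
    (f : M ⟶ M') [IsIso ((famFunctor k hm).map f)] : isoModFdim _ f := by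
  have h := bijective_of_isIso ((famFunctor k hm).map f)
  exact ⟨ker_finiteDimensional h.1, coker_finiteDimensional h.2⟩

/-- An invertible unit makes the left adjoint fully faithful and the image of the counit under
`famFunctor` invertible. Since this functor inverts only `isoModFdim`, the counit lies in that
class; a right adjoint with these properties is a localization. -/
instance isLocalization_famFunctor (hm : 0 < m) :
    (famFunctor k hm).IsLocalization (isoModFdim (GWA.grading (congPoly k m))) := by
  have : (coFunctor k hm).Full := (famAdjunction k hm).fullyFaithfulLOfIsIsoUnit.full
  have : (coFunctor k hm).Faithful := (famAdjunction k hm).fullyFaithfulLOfIsIsoUnit.faithful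
  refine (famAdjunction k hm).isLocalization_rightAdjoint _ (fun M M' f hf => isIso_famMap hm hf)
    fun M => ?_
  have : IsIso ((famFunctor k hm).map ((famAdjunction k hm).counit.app M)) := inferInstance
  exact isoModFdim_of_isIso_map hm _

/-- Additivity and linearity may be tested after composition with the quotient functor, where the
equivalence becomes isomorphic to `famFunctor`. -/
theorem exists_equivalence (hm : 0 < m) :
    ∃ e : Qgr (GWA.grading (congPoly k m)) ≌ GrMod (BRing.grading k),
      e.functor.Additive ∧ e.functor.Linear k := by
  let W := isoModFdim (GWA.grading (congPoly k m))
  let e := Localization.equivalenceFromModel (famFunctor k hm) W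
  let iso := Localization.qCompEquivalenceFromModelFunctorIso (famFunctor k hm) W
  refine ⟨e, ?_, ?_⟩
  · rw [Localization.functor_additive_iff W.Q W]
    exact Functor.additive_of_iso iso.symm
  · let : Localization.Lifting W.Q W (famFunctor k hm) e.functor := ⟨iso⟩
    exact (Localization.functor_linear_iff W.Q W k (famFunctor k hm) e.functor).1 inferInstance

end GrMod

/-! ### The multiple root case -/

/-! ### Skew Laurent polynomials and homogeneous elements of `A(f)` -/

namespace GWA

variable {k : Type u} [Field k]

/-- The action of `A(gh)` on skew Laurent polynomials `∑ pᵢ tⁱ` from the right, where `x` acts as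
`g t` and `y` as `t⁻¹ h`. -/
theorem exists_laurent (g h : k[X]) : ∃ ρ : (GWA (g * h))ᵐᵒᵖ →ₐ[k] Module.End k (ℤ →₀ k[X]),
    (∀ i p, ρ (MulOpposite.op (gen _ .x)) (Finsupp.single i p) =
      Finsupp.single (i + 1) (p * g.comp (linFactor k i))) ∧
    (∀ i p, ρ (MulOpposite.op (gen _ .y)) (Finsupp.single i p) =
      Finsupp.single (i - 1) (p * h.comp (linFactor k (i - 1)))) ∧
    ∀ i p, ρ (MulOpposite.op (gen _ .z)) (Finsupp.single i p) =
      Finsupp.single i (p * linFactor k i) := by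
  let x : Module.End k (ℤ →₀ k[X]) := Finsupp.lsum k fun i =>
    Finsupp.lsingle (i + 1) ∘ₗ LinearMap.mulRight k (g.comp (linFactor k i))
  let y : Module.End k (ℤ →₀ k[X]) := Finsupp.lsum k fun i =>
    Finsupp.lsingle (i - 1) ∘ₗ LinearMap.mulRight k (h.comp (linFactor k (i - 1)))
  let z : Module.End k (ℤ →₀ k[X]) := Finsupp.lsum k fun i =>
    Finsupp.lsingle i ∘ₗ LinearMap.mulRight k (linFactor k i)
  have hx : ∀ i p, x (Finsupp.single i p) =
      Finsupp.single (i + 1) (p * g.comp (linFactor k i)) := fun i p => by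
    simp only [x, Finsupp.lsum_single]; rfl
  have hy : ∀ i p, y (Finsupp.single i p) =
      Finsupp.single (i - 1) (p * h.comp (linFactor k (i - 1))) := fun i p => by
    simp only [y, Finsupp.lsum_single]; rfl
  have hz : ∀ i p, z (Finsupp.single i p) = Finsupp.single i (p * linFactor k i) := fun i p => by
    simp only [z, Finsupp.lsum_single]; rfl
  have haeval : ∀ (c i : ℤ) (q p : k[X]), aeval (z - algebraMap k _ (c : k)) q (Finsupp.single i p) =
      Finsupp.single i (p * q.comp (linFactor k (i - c))) := by
    intro c i q p
    have h1 := LinearMap.map_aeval_of_comm (Finsupp.lsingle (R := k) i)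
      (S := Algebra.lmul k k[X] (linFactor k (i - c))) (T := z - algebraMap k _ (c : k)) ?_ q p
    · rw [Polynomial.aeval_algHom_apply, ← Polynomial.comp_eq_aeval, mul_comm] at *
      exact h1.symm
    · intro p
      change Finsupp.single i (linFactor k (i - c) * p) = _
      rw [LinearMap.sub_apply, Module.algebraMap_end_apply, Finsupp.lsingle_apply, hz,
        Finsupp.smul_single, ← Finsupp.single_sub, smul_eq_C_mul]
      congr 1
      simp only [linFactor, Int.cast_sub, C_sub]
      ring
  have hrep := GWA.exists_rep (g * h) x y z (Finsupp.lhom_ext fun i p => ?_)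
    (Finsupp.lhom_ext fun i p => ?_) (Finsupp.lhom_ext fun i p => ?_)
    (Finsupp.lhom_ext fun i p => ?_)
  · obtain ⟨ρ, h1, h2, h3⟩ := hrep
    refine ⟨ρ, ?_, ?_, ?_⟩
    · rw [h1]; exact hx
    · rw [h2]; exact hy
    · rw [h3]; exact hz
  · rw [Module.End.mul_apply, Module.End.mul_apply, LinearMap.add_apply, Module.End.one_apply, hx,
      hz, hz, ← Finsupp.single_add, hx]
    congr 1
    simp only [linFactor, Int.cast_add, Int.cast_one, C_add, C_1]
    ring
  · rw [Module.End.mul_apply, Module.End.mul_apply, LinearMap.sub_apply, Module.End.one_apply, hy,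
      hz, hz, ← Finsupp.single_sub, hy]
    congr 1
    simp only [linFactor, Int.cast_sub, Int.cast_one, C_sub, C_1]
    ring
  · have h0 := haeval 0 i (g * h) p
    have hz0 : z - algebraMap k (Module.End k (ℤ →₀ k[X])) ((0 : ℤ) : k) = z :=
      LinearMap.ext fun w => by
        rw [LinearMap.sub_apply, Module.algebraMap_end_apply, Int.cast_zero, zero_smul, sub_zero]
    rw [hz0, sub_zero] at h0
    rw [h0, Module.End.mul_apply, hx, hy, add_sub_cancel_right, mul_comp, mul_assoc]
  · have h0 := haeval 1 i (g * h) p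
    rw [Int.cast_one, map_one] at h0
    rw [h0, Module.End.mul_apply, hy, hx, sub_add_cancel, mul_comp, mul_assoc,
      mul_comm (h.comp _)]

variable (f : k[X])

theorem x_mul_aeval (p : k[X]) :
    gen f .x * aeval (gen f .z) p = aeval (gen f .z) (p.comp (X + 1)) * gen f .x := by
  induction p using Polynomial.induction_on with
  | C a => simp [Algebra.commutes]
  | add p q hp hq => simp only [map_add, add_comp, mul_add, add_mul, hp, hq]
  | monomial n a ih =>
    rw [pow_succ, ← mul_assoc, map_mul, ← mul_assoc, ih, mul_assoc, aeval_X, gen_x_mul_z,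
      ← mul_assoc, ← map_mul, mul_comp (C a * X ^ n) X, X_comp]

theorem y_mul_aeval (p : k[X]) :
    gen f .y * aeval (gen f .z) p = aeval (gen f .z) (p.comp (X - 1)) * gen f .y := by
  induction p using Polynomial.induction_on with
  | C a => simp [Algebra.commutes]
  | add p q hp hq => simp only [map_add, add_comp, mul_add, add_mul, hp, hq]
  | monomial n a ih =>
    rw [pow_succ, ← mul_assoc, map_mul, ← mul_assoc, ih, mul_assoc, aeval_X, gen_y_mul_z,
      ← mul_assoc, ← map_mul, mul_comp (C a * X ^ n) X, X_comp]

theorem x_pow_mul_aeval (j : ℕ) (p : k[X]) : gen f .x ^ j * aeval (gen f .z) p =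
    aeval (gen f .z) (p.comp (linFactor k j)) * gen f .x ^ j := by
  induction j generalizing p with
  | zero => simp [linFactor]
  | succ j ih =>
    rw [pow_succ, mul_assoc, x_mul_aeval, ← mul_assoc, ih, comp_assoc, mul_assoc]
    congr 3
    simp [linFactor]
    ring

theorem y_pow_mul_aeval (j : ℕ) (p : k[X]) : gen f .y ^ j * aeval (gen f .z) p =
    aeval (gen f .z) (p.comp (linFactor k (-j))) * gen f .y ^ j := by
  induction j generalizing p with
  | zero => simp [linFactor]
  | succ j ih =>
    rw [pow_succ, mul_assoc, y_mul_aeval, ← mul_assoc, ih, comp_assoc, mul_assoc]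
    congr 3
    simp [linFactor]
    ring

/-- The homogeneous elements of degree `n` are the multiples of a power of `x` or `y`. -/
theorem exists_of_mem_grading {n : ℤ} {a : GWA f} (ha : a ∈ grading f n) :
    ∃ p : k[X], a = aeval (gen f .z) p * (gen f .x ^ n.toNat * gen f .y ^ (-n).toNat) := by
  have hspan : grading f n ≤ LinearMap.range
      ((LinearMap.mulRight k (gen f .x ^ n.toNat * gen f .y ^ (-n).toNat)).comp
        (aeval (R := k) (gen f .z)).toLinearMap) := by
    clear ha
    refine Submodule.span_le.2 ?_
    rintro _ ⟨l, rfl, rfl⟩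
    suffices ∃ p : k[X], aeval (gen f .z) p * (gen f .x ^ (l.map genDeg).sum.toNat *
        gen f .y ^ (-(l.map genDeg).sum).toNat) = (l.map (gen f)).prod from this
    induction l with
    | nil => exact ⟨1, by simp⟩
    | cons i l ih =>
      obtain ⟨p, hp⟩ := ih
      simp only [List.map_cons, List.sum_cons, List.prod_cons]
      rw [← hp]
      generalize (l.map genDeg).sum = n
      cases i with
      | x =>
        rw [← mul_assoc, x_mul_aeval, mul_assoc, ← mul_assoc (gen f .x), ← pow_succ']
        rcases le_or_gt 0 n with h | h
        · refine ⟨p.comp (X + 1), ?_⟩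
          rw [show (-n).toNat = 0 by omega,
            show (-(genDeg .x + n)).toNat = 0 by simp only [genDeg]; omega,
            show (genDeg .x + n).toNat = n.toNat + 1 by simp only [genDeg]; omega]
        · refine ⟨p.comp (X + 1) * f, ?_⟩
          rw [show n.toNat = 0 by omega,
            show (genDeg .x + n).toNat = 0 by simp only [genDeg]; omega,
            show (-n).toNat = (-(genDeg .x + n)).toNat + 1 by simp only [genDeg]; omega,
            pow_zero, zero_add, pow_one, one_mul, pow_succ' (gen f .y), map_mul,
            ← mul_assoc (gen f .x), gen_x_mul_y, mul_assoc]
      | y =>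
        rw [← mul_assoc, y_mul_aeval, mul_assoc]
        rcases le_or_gt n 0 with h | h
        · refine ⟨p.comp (X - 1), ?_⟩
          rw [show n.toNat = 0 by omega,
            show (genDeg .y + n).toNat = 0 by simp only [genDeg]; omega,
            show (-(genDeg .y + n)).toNat = (-n).toNat + 1 by simp only [genDeg]; omega, pow_succ']
          simp only [pow_zero, one_mul]
        · refine ⟨p.comp (X - 1) * f.comp (X - 1), ?_⟩
          rw [show (-n).toNat = 0 by omega,
            show (-(genDeg .y + n)).toNat = 0 by simp only [genDeg]; omega,
            show n.toNat = (genDeg .y + n).toNat + 1 by simp only [genDeg]; omega,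
            pow_succ', map_mul, pow_zero, mul_one, mul_one, ← mul_assoc (gen f .y), gen_y_mul_x,
            mul_assoc]
      | z =>
        refine ⟨X * p, ?_⟩
        rw [show genDeg .z = 0 from rfl, zero_add, map_mul, aeval_X, mul_assoc]
  obtain ⟨p, hp⟩ := hspan ha
  exact ⟨p, hp.symm⟩

theorem exists_aeval_of_mem_grading_zero {a : GWA f} (ha : a ∈ grading f 0) :
    ∃ p : k[X], a = aeval (gen f .z) p := by
  obtain ⟨p, hp⟩ := exists_of_mem_grading f ha
  exact ⟨p, by simpa using hp⟩

theorem aeval_mem_grading_zero (p : k[X]) : aeval (gen f .z) p ∈ grading f 0 := by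
  have hz : gen f .z ∈ grading f 0 := gen_mem_wordGrading (gen f) genDeg .z
  have h := (aeval (R := k) (⟨gen f .z, hz⟩ : SetLike.GradeZero.subalgebra (grading f)) p).2
  rwa [Polynomial.aeval_subalgebra_coe] at h

/-- Divisibility of all coefficients is preserved by the action on skew Laurent polynomials. -/
theorem dvd_of_laurent {g h : k[X]} {ρ : (GWA (g * h))ᵐᵒᵖ →ₐ[k] Module.End k (ℤ →₀ k[X])}
    (hx : ∀ i p, ρ (MulOpposite.op (gen _ .x)) (Finsupp.single i p) =
      Finsupp.single (i + 1) (p * g.comp (linFactor k i)))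
    (hy : ∀ i p, ρ (MulOpposite.op (gen _ .y)) (Finsupp.single i p) =
      Finsupp.single (i - 1) (p * h.comp (linFactor k (i - 1))))
    (hz : ∀ i p, ρ (MulOpposite.op (gen _ .z)) (Finsupp.single i p) =
      Finsupp.single i (p * linFactor k i)) (c : k[X]) (i j : ℤ) (a : GWA (g * h)) :
    c ∣ ρ (MulOpposite.op a) (Finsupp.single i c) j := by
  let D : Submodule k (ℤ →₀ k[X]) := Submodule.span k {w | ∃ i p, Finsupp.single i (c * p) = w}
  have hD : ∀ w ∈ D, c ∣ w j := by
    intro w hw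
    induction hw using Submodule.span_induction with
    | mem w h =>
      obtain ⟨i, p, rfl⟩ := h
      rw [Finsupp.single_apply]
      split_ifs
      · exact dvd_mul_right _ _
      · exact dvd_zero _
    | zero => exact dvd_zero _
    | add v w _ _ hv hw => exact dvd_add hv hw
    | smul r w _ hw =>
      rw [Finsupp.smul_apply, smul_eq_C_mul]
      exact dvd_mul_of_dvd_right hw _
  refine hD _ (rep_mem_of_gen ρ (adjoin_gen _) D (fun g w hw => ?_) a
    (Submodule.subset_span ⟨i, 1, by rw [mul_one]⟩))
  have hle : D ≤ D.comap (ρ (MulOpposite.op (gen _ g))) := by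
    refine Submodule.span_le.2 ?_
    rintro _ ⟨i, p, rfl⟩
    rw [SetLike.mem_coe, Submodule.mem_comap]
    cases g with
    | x => rw [hx, mul_assoc]; exact Submodule.subset_span ⟨_, _, rfl⟩
    | y => rw [hy, mul_assoc]; exact Submodule.subset_span ⟨_, _, rfl⟩
    | z => rw [hz, mul_assoc]; exact Submodule.subset_span ⟨_, _, rfl⟩
  exact hle hw

theorem laurent_aeval {g h : k[X]} {ρ : (GWA (g * h))ᵐᵒᵖ →ₐ[k] Module.End k (ℤ →₀ k[X])}
    (hz : ∀ i p, ρ (MulOpposite.op (gen _ .z)) (Finsupp.single i p) =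
      Finsupp.single i (p * linFactor k i)) (i : ℤ) (p q : k[X]) :
    ρ (MulOpposite.op (aeval (gen _ .z) q)) (Finsupp.single i p) =
      Finsupp.single i (p * q.comp (linFactor k i)) := by
  induction q using Polynomial.induction_on generalizing p with
  | C a =>
    rw [aeval_C, ← MulOpposite.algebraMap_apply, AlgHom.commutes, Module.algebraMap_end_apply,
      Finsupp.smul_single, C_comp, smul_eq_C_mul, mul_comm]
  | add q r hq hr =>
    rw [map_add, MulOpposite.op_add, map_add, LinearMap.add_apply, hq, hr, ← Finsupp.single_add,
      add_comp, mul_add]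
  | monomial n a ih =>
    rw [pow_succ, ← mul_assoc, map_mul, aeval_X, MulOpposite.op_mul, map_mul,
      Module.End.mul_apply, ih, hz, mul_comp (C a * X ^ n) X, X_comp, mul_assoc]

/-- At position `0` of the skew Laurent polynomials a polynomial in `z` acts as multiplication by
itself. -/
theorem aeval_injective : Function.Injective (aeval (R := k) (gen f .z)) := by
  obtain ⟨ρ, -, -, hz⟩ := exists_laurent 1 f
  rw [← one_mul f]
  intro p q hpq
  have h := congrArg (fun a => ρ (MulOpposite.op a) (Finsupp.single 0 1) 0) hpq
  simpa only [laurent_aeval hz, Finsupp.single_eq_same, one_mul, linFactor, Int.cast_zero, C_0,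
    add_zero, comp_X] using h

/-- With the factorization `f = f · 1`, the operator `y` acts by a mere shift while `x` takes `1` at
position `0` to `f`. Applied to that `1`, the left side gives the shifted `p`; the right side has
only coefficients divisible by `f`. -/
theorem dvd_of_y_pow_mul_eq {j : ℕ} {p : k[X]} {a : GWA f}
    (h : gen f .y ^ j * aeval (gen f .z) p = gen f .x * a) : f ∣ p.comp (linFactor k (-j)) := by
  obtain ⟨ρ, hx, hy, hz⟩ := exists_laurent f 1
  revert a
  rw [← mul_one f]
  intro a h
  have hpow : ∀ j : ℕ, ρ (MulOpposite.op (gen _ .y ^ j)) (Finsupp.single 0 1) =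
      Finsupp.single (-j : ℤ) 1 := by
    intro j
    induction j with
    | zero => simp
    | succ j ih =>
      rw [pow_succ, MulOpposite.op_mul, map_mul, Module.End.mul_apply, ih, hy, one_comp, one_mul]
      congr 1
      push_cast; ring
  have h' := congrArg (fun a => ρ (MulOpposite.op a) (Finsupp.single 0 1) (-j)) h
  simp only [MulOpposite.op_mul, map_mul, Module.End.mul_apply, hpow, laurent_aeval hz,
    Finsupp.single_eq_same, one_mul, hx] at h'
  rw [h']
  have h0 : f.comp (linFactor k 0) = f := by simp [linFactor]
  rw [h0]
  simpa using dvd_of_laurent hx hy hz f (0 + 1) (-j) a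

/-- The factorization `f = 1 · f` is used instead, so that `x` is the shift and `y` takes `1` at
position `0` to `f(z - 1)`. -/
theorem dvd_of_x_pow_mul_eq {j : ℕ} {p : k[X]} {a : GWA f}
    (h : gen f .x ^ j * aeval (gen f .z) p = gen f .y * a) :
    f.comp (linFactor k (-1)) ∣ p.comp (linFactor k j) := by
  obtain ⟨ρ, hx, hy, hz⟩ := exists_laurent 1 f
  revert a
  rw [← one_mul f]
  intro a h
  have hpow : ∀ j : ℕ, ρ (MulOpposite.op (gen _ .x ^ j)) (Finsupp.single 0 1) =
      Finsupp.single (j : ℤ) 1 := by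
    intro j
    induction j with
    | zero => simp
    | succ j ih =>
      rw [pow_succ, MulOpposite.op_mul, map_mul, Module.End.mul_apply, ih, hx, one_comp, one_mul]
      push_cast; rfl
  have h' := congrArg (fun a => ρ (MulOpposite.op a) (Finsupp.single 0 1) j) h
  simp only [MulOpposite.op_mul, map_mul, Module.End.mul_apply, hpow, laurent_aeval hz,
    Finsupp.single_eq_same, one_mul, hy] at h'
  rw [h']
  simpa using dvd_of_laurent hx hy hz _ (0 - 1) j a

end GWA

theorem mul_mul_eq_mul_mul_of_mul_eq {R : Type*} [CommRing R] {a b c d : R} (h : a * b = c * d)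
    (p : R) : p * c * d = a * (p * b) := by
  rw [mul_assoc, ← h, mul_left_comm]

/-! ### The homogeneous components of `B` -/

namespace BRing

variable (k : Type u) [Field k]

theorem exists_evalHom : ∃ ε : BRing k →ₐ[k] k[X], ε (gen k none) = X ∧
    ∀ n, ε (gen k (some n)) = linFactor k n :=
  exists_rep X (linFactor k) (fun _ => mul_comm _ _) (fun _ _ => mul_comm _ _) fun n => by
    rw [aeval_X_left_apply, pow_two]; rfl

/-- The homomorphism from `B` to `k[z]` which maps `bₙ` to `z + n`. -/
noncomputable def evalHom : BRing k →ₐ[k] k[X] := (exists_evalHom k).choose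

theorem evalHom_gen (n : ℤ) : evalHom k (gen k (some n)) = linFactor k n :=
  (exists_evalHom k).choose_spec.2 n

theorem evalHom_ofPoly (p : k[X]) : evalHom k (ofPoly k p) = p := by
  rw [ofPoly, ← Polynomial.aeval_algHom_apply, evalHom, (exists_evalHom k).choose_spec.1,
    aeval_X_left_apply]

/-- The product of the `bₙ` for `n ∈ J`. -/
noncomputable def genProd (J : Finset ℤ) : BRing k := ∏ n ∈ J, gen k (some n)

theorem evalHom_genProd (J : Finset ℤ) :
    evalHom k (genProd k J) = ∏ n ∈ J, linFactor k n := by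
  rw [genProd, map_prod]
  exact Finset.prod_congr rfl fun n _ => evalHom_gen k n

theorem genProd_mem_grading (J : ZFin) : genProd k (ofBoolRing J) ∈ grading k J := by
  classical
  suffices ∀ J : Finset ℤ, genProd k J ∈ grading k (toBoolRing J) from this _
  intro J
  induction J using Finset.induction_on with
  | empty => rw [genProd, Finset.prod_empty]; exact SetLike.GradedOne.one_mem (A := grading k)
  | insert n J hn ih =>
    rw [genProd, Finset.prod_insert hn]
    have h := SetLike.mul_mem_graded (gen_mem_wordGrading (k := k) (gen k) genDeg (some n)) ih
    have hdeg : genDeg (some n) + toBoolRing J = toBoolRing (insert n J) := by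
      refine zfin_ext fun j => ?_
      rw [mem_ofBoolRing_add, mem_ofBoolRing_genDeg, ofBoolRing_toBoolRing, ofBoolRing_toBoolRing,
        Finset.mem_insert]
      by_cases h : j = n
      · subst h; tauto
      · tauto
    rwa [hdeg] at h

theorem ofPoly_mem_grading_zero (p : k[X]) : ofPoly k p ∈ grading k 0 := by
  have hz : gen k none ∈ grading k 0 := gen_mem_wordGrading (gen k) genDeg none
  have h := (aeval (R := k) (⟨gen k none, hz⟩ : SetLike.GradeZero.subalgebra (grading k)) p).2
  rwa [Polynomial.aeval_subalgebra_coe] at h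

theorem ofPoly_mul_genProd_mem (p : k[X]) (J : ZFin) :
    ofPoly k p * genProd k (ofBoolRing J) ∈ grading k J := by
  have h := SetLike.mul_mem_graded (ofPoly_mem_grading_zero k p) (genProd_mem_grading k J)
  rwa [zero_add] at h

theorem gen_mul_genProd (n : ℤ) (J : ZFin) : ∃ p : k[X],
    gen k (some n) * genProd k (ofBoolRing J) =
      ofPoly k p * genProd k (ofBoolRing (genDeg (some n) + J)) := by
  classical
  by_cases h : n ∈ ofBoolRing J
  · refine ⟨linFactor k n ^ 2, ?_⟩
    have hJ : ofBoolRing (genDeg (some n) + J) = (ofBoolRing J).erase n := by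
      ext j
      rw [mem_ofBoolRing_add, mem_ofBoolRing_genDeg, Finset.mem_erase]
      by_cases h' : j = n
      · subst h'; tauto
      · tauto
    rw [hJ, genProd, genProd, ← Finset.mul_prod_erase _ _ h, ← gen_mul_gen]
    exact (mul_assoc _ _ _).symm
  · refine ⟨1, ?_⟩
    have hJ : ofBoolRing (genDeg (some n) + J) = insert n (ofBoolRing J) := by
      ext j
      rw [mem_ofBoolRing_add, mem_ofBoolRing_genDeg, Finset.mem_insert]
      by_cases h' : j = n
      · subst h'; tauto
      · tauto
    rw [hJ, genProd, genProd, Finset.prod_insert h, map_one]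
    exact (one_mul _).symm

theorem exists_of_mem_grading {J : ZFin} {b : BRing k} (hb : b ∈ grading k J) :
    ∃ p, b = ofPoly k p * genProd k (ofBoolRing J) := by
  have hspan : grading k J ≤ LinearMap.range
      ((LinearMap.mulRight k (genProd k (ofBoolRing J))).comp (ofPoly k).toLinearMap) := by
    clear hb
    refine Submodule.span_le.2 ?_
    rintro _ ⟨l, rfl, rfl⟩
    suffices ∃ p : k[X], ofPoly k p * genProd k (ofBoolRing (l.map genDeg).sum) =
        (l.map (gen k)).prod from this
    induction l with
    | nil =>
      refine ⟨1, ?_⟩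
      rw [map_one, genProd]
      exact (one_mul _).trans Finset.prod_empty
    | cons i l ih =>
      obtain ⟨p, hp⟩ := ih
      simp only [List.map_cons, List.sum_cons, List.prod_cons]
      rw [← hp]
      cases i with
      | none =>
        refine ⟨X * p, ?_⟩
        rw [show genDeg none = 0 from rfl, zero_add, map_mul, ofPoly, aeval_X]
        exact mul_assoc _ _ _
      | some n =>
        obtain ⟨q, hq⟩ := gen_mul_genProd k n (l.map genDeg).sum
        refine ⟨p * q, ?_⟩
        rw [map_mul]
        exact mul_mul_eq_mul_mul_of_mul_eq (R := BRing k) hq _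
  obtain ⟨p, hp⟩ := hspan hb
  exact ⟨p, hp.symm⟩

/-- The homomorphism identifies `bₙ` with `z + n`, but on one component it is injective: a component
consists of the `k[z]`-multiples of a single product of the `bₙ`, whose image is nonzero. -/
theorem eq_zero_of_evalHom_eq_zero {J : ZFin} {b : BRing k} (hb : b ∈ grading k J)
    (h : evalHom k b = 0) : b = 0 := by
  obtain ⟨p, rfl⟩ := exists_of_mem_grading k hb
  rw [map_mul, evalHom_ofPoly, evalHom_genProd] at h
  rcases mul_eq_zero.1 h with h | h
  · rw [h, map_zero]
    exact zero_mul _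
  · exact absurd h (Finset.prod_ne_zero_iff.2 fun n _ => linFactor_ne_zero k n)

end BRing

section

variable {k : Type u} [Field k]

theorem comp_linFactor_comp (p : k[X]) (i j : ℤ) :
    (p.comp (linFactor k i)).comp (linFactor k j) = p.comp (linFactor k (i + j)) := by
  rw [comp_assoc]
  congr 1
  simp only [linFactor, add_comp, X_comp, C_comp, Int.cast_add, C_add]
  ring

theorem comp_linFactor_zero (p : k[X]) : p.comp (linFactor k 0) = p := by
  simp [linFactor]

end

namespace GWA

variable {k : Type u} [Field k] (f : k[X])

/-- The coefficient `f` is written as `xy`, and `q` moves past `x` with a shift of its argument. -/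
theorem aeval_mul_y_pow (n : ℕ) (q : k[X]) : aeval (gen f .z) (f * q) * gen f .y ^ n =
    gen f .x * (aeval (gen f .z) (q.comp (linFactor k (-1))) * gen f .y ^ (n + 1)) := by
  rw [← mul_assoc, x_mul_aeval, show (X + 1 : k[X]) = linFactor k 1 by simp [linFactor],
    comp_linFactor_comp, neg_add_cancel, comp_linFactor_zero, pow_succ', mul_assoc,
    ← mul_assoc (gen f .x), gen_x_mul_y, ← mul_assoc, ← map_mul, mul_comm q]

theorem aeval_mul_x_pow (n : ℕ) (q : k[X]) :
    aeval (gen f .z) (f.comp (linFactor k (-1)) * q) * gen f .x ^ n =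
      gen f .y * (aeval (gen f .z) (q.comp (linFactor k 1)) * gen f .x ^ (n + 1)) := by
  have h1 : (X - 1 : k[X]) = linFactor k (-1) := by simp [linFactor, sub_eq_add_neg]
  rw [← mul_assoc, y_mul_aeval, h1, comp_linFactor_comp, add_neg_cancel, comp_linFactor_zero,
    pow_succ', mul_assoc, ← mul_assoc (gen f .y), gen_y_mul_x, h1, ← mul_assoc, ← map_mul,
    mul_comm q]

end GWA

/-! ### The modules `ι_J A` in degree zero and the comparison with `B` -/

namespace MultipleRoot

variable {k : Type u} [Field k]

theorem sq_comp_linFactor (j : ℤ) : (X ^ 2 : k[X]).comp (linFactor k j) = linFactor k j ^ 2 := by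
  simp

theorem mem_iotaSingle_nonneg {j : ℕ} {a : A k} : a ∈ iotaSingle k j ↔
    ∃ b, GWA.gen (X ^ 2 : k[X]) .y ^ j * a = GWA.gen (X ^ 2 : k[X]) .x * b := by
  rw [iotaSingle, if_pos (Int.natCast_nonneg j), LinearMap.mem_ker, LinearMap.comp_apply,
    Submodule.mkQ_apply, Submodule.Quotient.mk_eq_zero, Int.toNat_natCast]
  exact ⟨fun ⟨b, hb⟩ => ⟨b, hb.symm⟩, fun ⟨b, hb⟩ => ⟨b, hb.symm⟩⟩

theorem mem_iotaSingle_neg {j : ℕ} {a : A k} : a ∈ iotaSingle k (-(j + 1 : ℕ)) ↔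
    ∃ b, GWA.gen (X ^ 2 : k[X]) .x ^ j * a = GWA.gen (X ^ 2 : k[X]) .y * b := by
  rw [iotaSingle, if_neg (by omega), LinearMap.mem_ker, LinearMap.comp_apply,
    Submodule.mkQ_apply, Submodule.Quotient.mk_eq_zero,
    show (-(-((j + 1 : ℕ) : ℤ)) - 1).toNat = j by omega]
  exact ⟨fun ⟨b, hb⟩ => ⟨b, hb.symm⟩, fun ⟨b, hb⟩ => ⟨b, hb.symm⟩⟩

theorem dvd_of_comp_dvd {p q : k[X]} (j : ℤ) (h : p ∣ q.comp (linFactor k (-j))) :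
    p.comp (linFactor k j) ∣ q := by
  obtain ⟨r, hr⟩ := h
  have h' := congrArg (fun s : k[X] => s.comp (linFactor k j)) hr
  simp only [comp_linFactor_comp, neg_add_cancel, comp_linFactor_zero, mul_comp] at h'
  exact ⟨_, h'⟩

/-- The elements of degree zero of `ι_j A` are the multiples of `(z + j)²`. -/
theorem aeval_mem_iotaSingle (j : ℤ) (p : k[X]) :
    aeval (GWA.gen (X ^ 2 : k[X]) .z) p ∈ iotaSingle k j ↔ linFactor k j ^ 2 ∣ p := by
  rcases lt_or_ge j 0 with hj | hj
  · obtain ⟨n, rfl⟩ : ∃ n : ℕ, j = -(n + 1 : ℕ) := ⟨(-j - 1).toNat, by omega⟩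
    rw [mem_iotaSingle_neg]
    constructor
    · rintro ⟨b, hb⟩
      have h := GWA.dvd_of_x_pow_mul_eq _ hb
      rw [show (n : ℤ) = -(-n) by ring] at h
      have h' := dvd_of_comp_dvd _ h
      rw [comp_linFactor_comp, sq_comp_linFactor] at h'
      rwa [show (-(n + 1 : ℕ) : ℤ) = -1 + -n by push_cast; ring]
    · rintro ⟨q, rfl⟩
      refine ⟨_, (GWA.x_pow_mul_aeval _ _ _).trans (Eq.trans ?_ (GWA.aeval_mul_x_pow _ n
        (q.comp (linFactor k n))))⟩
      rw [mul_comp, ← sq_comp_linFactor, comp_linFactor_comp,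
        show (-(n + 1 : ℕ) : ℤ) + n = -1 by push_cast; ring]
  · obtain ⟨n, rfl⟩ := Int.eq_ofNat_of_zero_le hj
    rw [mem_iotaSingle_nonneg]
    constructor
    · rintro ⟨b, hb⟩
      have h' := dvd_of_comp_dvd _ (GWA.dvd_of_y_pow_mul_eq _ hb)
      rwa [sq_comp_linFactor] at h'
    · rintro ⟨q, rfl⟩
      refine ⟨_, (GWA.y_pow_mul_aeval _ _ _).trans (Eq.trans ?_ (GWA.aeval_mul_y_pow _ n
        (q.comp (linFactor k (-n)))))⟩
      rw [mul_comp, ← sq_comp_linFactor, comp_linFactor_comp, add_neg_cancel, comp_linFactor_zero]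

/-- The squares `(z + n)²` are pairwise coprime, so divisibility by each is divisibility by their
product. -/
theorem aeval_mem_iota [CharZero k] (J : Finset ℤ) (p : k[X]) :
    aeval (GWA.gen (X ^ 2 : k[X]) .z) p ∈ iota k J ↔ (∏ n ∈ J, linFactor k n) ^ 2 ∣ p := by
  simp only [iota, Submodule.mem_iInf, aeval_mem_iotaSingle]
  rw [← Finset.prod_pow]
  constructor
  · exact fun h => Finset.prod_dvd_of_coprime
      (fun n _ n' _ hn => IsCoprime.pow (isCoprime_linFactor k n n' hn)) h
  · exact fun h n hn => (Finset.dvd_prod_of_mem (fun n => linFactor k n ^ 2) hn).trans h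

theorem leftMul_mem_iotaHom [CharZero k] {J : ZFin} {p : k[X]}
    (hp : (∏ n ∈ ofBoolRing J, linFactor k n) ^ 2 ∣ p) :
    leftMul (aeval (GWA.gen (X ^ 2 : k[X]) .z) p) ∈ iotaHom k J := by
  refine ⟨fun n a ha => ?_, fun a => ?_⟩
  · have h := SetLike.mul_mem_graded (GWA.aeval_mem_grading_zero (X ^ 2 : k[X]) p) ha
    rwa [zero_add] at h
  · exact Submodule.smul_mem _ (MulOpposite.op a) ((aeval_mem_iota _ p).2 hp)

/-- Such a homomorphism is left multiplication by the image of `1`, which lies in degree zero, hence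
is a polynomial in `z`. -/
theorem exists_of_mem_iotaHom [CharZero k] {J : ZFin} {φ : A k →ₗ[(A k)ᵐᵒᵖ] A k}
    (hφ : φ ∈ iotaHom k J) : ∃ p : k[X], φ = leftMul (aeval (GWA.gen (X ^ 2 : k[X]) .z)
      ((∏ n ∈ ofBoolRing J, linFactor k n) ^ 2 * p)) := by
  obtain ⟨q, hq⟩ := GWA.exists_aeval_of_mem_grading_zero _
    (hφ.1 0 1 (SetLike.GradedOne.one_mem (A := GWA.grading (X ^ 2 : k[X]))))
  have h := hφ.2 1
  rw [hq, aeval_mem_iota] at h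
  obtain ⟨p, rfl⟩ := h
  refine ⟨p, LinearMap.ext fun a => ?_⟩
  have h1 : φ (1 * a) = φ 1 * a := φ.map_smul (MulOpposite.op a) 1
  rw [hq, one_mul] at h1
  exact h1

/-- The product of the `z + n` for `n ∈ J`. -/
noncomputable def linProd (k : Type u) [Field k] (J : ZFin) : k[X] :=
  ∏ n ∈ ofBoolRing J, linFactor k n

theorem linProd_ne_zero (J : ZFin) : linProd k J ≠ 0 :=
  Finset.prod_ne_zero_iff.2 fun n _ => linFactor_ne_zero k n

/-- A point common to `I` and `J` occurs twice on the right and not at all in `I + J`; this is what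
the factor `h_{I ∩ J}` restores. -/
theorem sq_mul_linProd_add (I J : ZFin) :
    (∏ n ∈ ofBoolRing I ∩ ofBoolRing J, linFactor k n ^ 2) * linProd k (I + J) =
      linProd k I * linProd k J := by
  have hdisj : Disjoint (ofBoolRing (I + J)) (ofBoolRing I ∩ ofBoolRing J) :=
    disjoint_symmDiff_inf (ofBoolRing I) (ofBoolRing J)
  have hunion : ofBoolRing (I + J) ∪ ofBoolRing I ∩ ofBoolRing J = ofBoolRing I ∪ ofBoolRing J :=
    symmDiff_sup_inf (ofBoolRing I) (ofBoolRing J)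
  have h1 := Finset.prod_union hdisj (f := linFactor k)
  rw [hunion] at h1
  have h2 := Finset.prod_union_inter (s₁ := ofBoolRing I) (s₂ := ofBoolRing J) (f := linFactor k)
  rw [h1] at h2
  rw [linProd, linProd, linProd, ← h2, Finset.prod_pow]
  ring

/-- The map from `B_J` to the homomorphisms from `A` to `ι_J A`. -/
noncomputable def toIotaHom [CharZero k] (J : ZFin) : BRing.grading k J →ₗ[k] iotaHom k J where
  -- The image of `b` under `evalHom` contains the product of the `z + n`, `n ∈ J`, only once; the
  -- further `linProd k J` supplies the square required for values in `ι_J A`.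
  toFun b := ⟨leftMul (aeval (GWA.gen (X ^ 2 : k[X]) .z) (BRing.evalHom k b.1 * linProd k J)), by
    refine leftMul_mem_iotaHom ?_
    obtain ⟨p, hp⟩ := BRing.exists_of_mem_grading k b.2
    rw [hp, map_mul, BRing.evalHom_ofPoly, BRing.evalHom_genProd]
    exact ⟨p, by rw [linProd]; ring⟩⟩
  map_add' b c := by
    refine Subtype.ext (LinearMap.ext fun a => ?_)
    change aeval _ (BRing.evalHom k (b.1 + c.1) * _) * a = aeval _ _ * a + aeval _ _ * a
    rw [map_add, add_mul, map_add, add_mul]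
  map_smul' c b := by
    refine Subtype.ext (LinearMap.ext fun a => ?_)
    change aeval _ (BRing.evalHom k (c • b.1) * _) * a = c • (aeval _ _ * a)
    rw [map_smul, smul_mul_assoc, map_smul, smul_mul_assoc]

theorem toIotaHom_apply [CharZero k] (J : ZFin) (b : BRing.grading k J) (a : A k) :
    (toIotaHom J b).1 a =
      aeval (GWA.gen (X ^ 2 : k[X]) .z) (BRing.evalHom k b.1 * linProd k J) * a := rfl

/-- Both sides are free of rank one over `k[z]`, on the product of the `bₙ` and on left
multiplication by `∏ (z + n)²`, and the map takes one generator to the other. -/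
theorem toIotaHom_bijective [CharZero k] (J : ZFin) :
    Function.Bijective (toIotaHom (k := k) J) := by
  constructor
  · rw [injective_iff_map_eq_zero]
    intro b hb
    have h1 : (toIotaHom J b).1 1 = 0 := by rw [hb]; rfl
    rw [toIotaHom_apply, mul_one] at h1
    have h2 := GWA.aeval_injective _ (h1.trans (map_zero _).symm)
    exact Subtype.ext (BRing.eq_zero_of_evalHom_eq_zero k b.2
      ((mul_eq_zero.1 h2).resolve_right (linProd_ne_zero J)))
  · intro φ
    obtain ⟨p, hp⟩ := exists_of_mem_iotaHom φ.2
    refine ⟨⟨_, BRing.ofPoly_mul_genProd_mem k p J⟩, Subtype.ext ?_⟩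
    rw [hp]
    refine LinearMap.ext fun a => ?_
    change aeval _ (BRing.evalHom k (BRing.ofPoly k p * BRing.genProd k _) * linProd k J) * a =
      aeval _ _ * a
    rw [map_mul (BRing.evalHom k), BRing.evalHom_ofPoly, BRing.evalHom_genProd, linProd]
    congr 2
    ring

variable (k) in
theorem isInvolutionRing_grading [CharZero k] : IsInvolutionRing k (BRing.grading k) := by
  refine ⟨fun J => LinearEquiv.ofBijective (toIotaHom J) (toIotaHom_bijective J), ?_, ?_⟩
  · refine LinearMap.ext fun a => ?_
    change aeval _ (BRing.evalHom k 1 * linProd k 0) * a = a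
    have h0 : linProd k 0 = 1 := Finset.prod_empty
    rw [map_one, h0, mul_one, map_one, one_mul]
  · intro I J a b t
    change aeval (GWA.gen (X ^ 2 : k[X]) .z) (∏ n ∈ ofBoolRing I ∩ ofBoolRing J, linFactor k n ^ 2) *
      (aeval _ (BRing.evalHom k (a.1 * b.1) * linProd k (I + J)) * t) =
      aeval _ (BRing.evalHom k a.1 * linProd k I) *
        (aeval _ (BRing.evalHom k b.1 * linProd k J) * t)
    refine (mul_assoc _ _ _).symm.trans (Eq.trans (congrArg (· * t) ?_) (mul_assoc _ _ _))
    refine (map_mul (aeval (R := k) (GWA.gen (X ^ 2 : k[X]) .z)) _ _).symm.trans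
      (Eq.trans (congrArg _ ?_) (map_mul _ _ _))
    rw [map_mul (BRing.evalHom k)]
    linear_combination BRing.evalHom k a.1 * BRing.evalHom k b.1 * sq_mul_linProd_add (k := k) I J

end MultipleRoot

theorem mainTheorem3 {k : Type u} [Field k] [IsAlgClosed k] [CharZero k] (m : ℕ) (hm : 0 < m) :
    MultipleRoot.IsInvolutionRing k (BRing.grading k) ∧
    ∃ e : GrMod.Qgr (GWA.grading (X * (X + C (m : k)) : k[X])) ≌ GrMod (BRing.grading k),
      e.functor.Additive ∧ e.functor.Linear k :=
  ⟨MultipleRoot.isInvolutionRing_grading k, GrMod.exists_equivalence hm⟩
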